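/- Work on the deterministic word RAM. Registers and memory cells hold words, i.e. integers $v$ with $|v|<2^w$, where $w$ is the word length; memory cells are addressed by words and are initially $0$ outside the input; loading a constant, adding, subtracting, multiplying, dividing with remainder, and comparing words, and reading or writing a memory cell, take one step each; and no instruction may produce a number that does not fit into a word. A common increasing subsequence of two integer sequences $A$ and $B$ is a sequence of pairs of positions $(x_1,y_1),\dots,(x_s,y_s)$ with $A[x_i]=B[y_i]$ for all $i$ and $x_i<x_{i+1}$, $y_i<y_{i+1}$, $A[x_i]<A[x_{i+1}]$ for $1\le i<s$; its length is $s$. An LCIS of $A$ and $B$ is a common increasing subsequence of maximal length. There is a single program, a constant $k$, and a function $T:\mathbb{N}\to\mathbb{N}$ with $$T(n)=O\!\left(\frac{n^2(\log\log n)^2}{\log^{1/6} n}\right),\qquad\text{in particular } T(n)=o(n^2),$$ such that for every $n$, every two integer sequences $A,B$ with $|A|,|B|\le n$, and every word length $w\ge k\log_2(n+2)$ for which all elements of $A$ and $B$ are words, the program, started with $|A|$, $|B|$, $A$ and $B$ as its input, halts after at most $T(n)$ steps and outputs an LCIS of $A$ and $B$, together with its length. -/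

import Mathlib

/-! ### Common increasing subsequences -/

namespace LCIS

/-- A pair of (0-based) positions of `A` and `B` is matching if it carries the same symbol. -/
def IsMatching (A B : List ℤ) (p : Fin A.length × Fin B.length) : Prop :=
  A.get p.1 = B.get p.2

/-- The strict order on matching pairs: both positions and the symbol increase. -/
def Prec (A B : List ℤ) (p q : Fin A.length × Fin B.length) : Prop :=
  p.1 < q.1 ∧ p.2 < q.2 ∧ A.get p.1 < A.get q.1

/-- A common increasing subsequence: matching pairs `p₁ ≺ p₂ ≺ ⋯ ≺ pₛ`. -/
def IsCommonIncreasing (A B : List ℤ) (L : List (Fin A.length × Fin B.length)) : Prop :=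
  (∀ p ∈ L, IsMatching A B p) ∧ L.IsChain (Prec A B)

/-- A longest common increasing subsequence. -/
def IsLCIS (A B : List ℤ) (L : List (Fin A.length × Fin B.length)) : Prop :=
  IsCommonIncreasing A B L ∧
    ∀ L' : List (Fin A.length × Fin B.length), IsCommonIncreasing A B L' → L'.length ≤ L.length

/-! ### The word RAM

A deterministic machine with finitely many registers (those that its program mentions) and a
random access memory; registers and memory cells hold words, that is, integers `v` with
`|v| < 2 ^ w`, and memory cells are addressed by words. Programs are written with structured
control (sequence, branching on a comparison, while loops) instead of jumps. Every arithmetic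
instruction, memory access and comparison takes one step. -/

/-- `v` fits into a (signed) word of length `w`. -/
def IsWord (w : ℕ) (v : ℤ) : Prop := |v| < 2 ^ w

/-- The arithmetic instructions; `div` and `mod` are integer division with remainder. -/
inductive Op where
  | add
  | sub
  | mul
  | div
  | mod

def Op.eval : Op → ℤ → ℤ → ℤ
  | .add, a, b => a + b
  | .sub, a, b => a - b
  | .mul, a, b => a * b
  | .div, a, b => a / b
  | .mod, a, b => a % b

/-- Comparisons of two words. -/
inductive Cmp where
  | lt
  | le
  | eq

def Cmp.Holds : Cmp → ℤ → ℤ → Prop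
  | .lt, a, b => a < b
  | .le, a, b => a ≤ b
  | .eq, a, b => a = b

/-- Programs. All natural numbers are names of registers.
* `const r c`: put the constant `c` into register `r`;
* `arith r o a b`: put the result of `o`, applied to registers `a` and `b`, into register `r`;
* `load r a`: put the content of the memory cell whose address is in register `a` into `r`;
* `store a r`: write register `r` into the memory cell whose address is in register `a`;
* `ifThenElse c a b P Q`, `whileDo c a b P`: control by the comparison `c` of registers
  `a` and `b`. -/
inductive Prog where
  | skip
  | const (r : ℕ) (c : ℤ)
  | arith (r : ℕ) (o : Op) (a b : ℕ)
  | load (r a : ℕ)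
  | store (a r : ℕ)
  | seq (P Q : Prog)
  | ifThenElse (c : Cmp) (a b : ℕ) (P Q : Prog)
  | whileDo (c : Cmp) (a b : ℕ) (P : Prog)

/-- The contents of the registers and of the memory. -/
structure State where
  reg : ℕ → ℤ
  mem : ℤ → ℤ

def State.setReg (s : State) (r : ℕ) (v : ℤ) : State :=
  { s with reg := Function.update s.reg r v }

def State.setMem (s : State) (a v : ℤ) : State :=
  { s with mem := Function.update s.mem a v }

/-- `Exec w P s t s'`: on a machine with word length `w`, program `P`, started in state `s`, halts
after exactly `t` steps in state `s'`. There is at most one such `t` and `s'`, and there is none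
if `P` runs forever, or if some instruction would produce a number that does not fit into a
word. -/
inductive Exec (w : ℕ) : Prog → State → ℕ → State → Prop where
  | skip (s : State) : Exec w .skip s 1 s
  | const (r : ℕ) (c : ℤ) (s : State) (h : IsWord w c) :
      Exec w (.const r c) s 1 (s.setReg r c)
  | arith (r : ℕ) (o : Op) (a b : ℕ) (s : State) (h : IsWord w (o.eval (s.reg a) (s.reg b))) :
      Exec w (.arith r o a b) s 1 (s.setReg r (o.eval (s.reg a) (s.reg b)))
  | load (r a : ℕ) (s : State) :
      Exec w (.load r a) s 1 (s.setReg r (s.mem (s.reg a)))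
  | store (a r : ℕ) (s : State) :
      Exec w (.store a r) s 1 (s.setMem (s.reg a) (s.reg r))
  | seq {P Q : Prog} {s s' s'' : State} {t t' : ℕ}
      (hP : Exec w P s t s') (hQ : Exec w Q s' t' s'') :
      Exec w (.seq P Q) s (t + t') s''
  | ifTrue {c : Cmp} {a b : ℕ} {P Q : Prog} {s s' : State} {t : ℕ}
      (h : c.Holds (s.reg a) (s.reg b)) (hP : Exec w P s t s') :
      Exec w (.ifThenElse c a b P Q) s (t + 1) s'
  | ifFalse {c : Cmp} {a b : ℕ} {P Q : Prog} {s s' : State} {t : ℕ}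
      (h : ¬ c.Holds (s.reg a) (s.reg b)) (hQ : Exec w Q s t s') :
      Exec w (.ifThenElse c a b P Q) s (t + 1) s'
  | whileTrue {c : Cmp} {a b : ℕ} {P : Prog} {s s' s'' : State} {t t' : ℕ}
      (h : c.Holds (s.reg a) (s.reg b)) (hP : Exec w P s t s')
      (hW : Exec w (.whileDo c a b P) s' t' s'') :
      Exec w (.whileDo c a b P) s (t + t' + 1) s''
  | whileFalse {c : Cmp} {a b : ℕ} {P : Prog} {s : State}
      (h : ¬ c.Holds (s.reg a) (s.reg b)) :
      Exec w (.whileDo c a b P) s 1 s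

/-- The initial state on input `A`, `B`: registers `0` and `1` hold the lengths of `A` and `B`,
the memory cells `0, 1, 2, …` hold the symbols of `A` followed by those of `B`, and all other
registers and cells hold `0`. -/
def inputState (A B : List ℤ) : State where
  reg r := if r = 0 then A.length else if r = 1 then B.length else 0
  mem a := if 0 ≤ a then (A ++ B).getD a.toNat 0 else 0

/-- State `s` holds the sequence of pairs `L` as output: register `0` holds the length of `L`,
register `1` an address, from which on the memory contains the pairs of `L` one after another. -/
def Outputs {a b : ℕ} (s : State) (L : List (Fin a × Fin b)) : Prop :=
  s.reg 0 = L.length ∧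
    ∀ (i : ℕ) (hi : i < L.length),
      s.mem (s.reg 1 + 2 * i) = (L[i].1 : ℕ) ∧ s.mem (s.reg 1 + 2 * i + 1) = (L[i].2 : ℕ)

/-- Program `P` finds a longest common increasing subsequence of any two integer sequences of
length at most `n` in at most `T n` steps, for every word length that is at least
`k * log₂ (n + 2)` and large enough for the symbols of the input. -/
def SolvesLCISInTime (P : Prog) (k : ℕ) (T : ℕ → ℕ) : Prop :=
  ∀ (n : ℕ) (A B : List ℤ), A.length ≤ n → B.length ≤ n →
    ∀ w : ℕ, (n + 2) ^ k ≤ 2 ^ w → (∀ v ∈ A ++ B, IsWord w v) →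
      ∃ (s : State) (t : ℕ) (L : List (Fin A.length × Fin B.length)),
        Exec w P (inputState A B) t s ∧ t ≤ T n ∧ IsLCIS A B L ∧ Outputs s L

end LCIS

/-! The proof gives an algorithm on natural numbers that is correct and takes O(M²/q + M log M)
steps, where M = |A| + |B| and q is about the fourth root of log M, together with a compiler from a
small imperative language to the word RAM that loses only a constant factor (`HX.sim`). The
resulting bound n²/log^{1/4} n is stronger than the one claimed.

Symbols are replaced by ranks (`Ranked`), and the sorted order of all M positions is cut at every
s-th place, s being about M/q. A symbol is heavy if its run of equal entries contains a cut, and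
light otherwise; between two consecutive cuts there are at most s positions with light symbols
(`Env.OK.of_ranked`). Light symbols of class c form group 2c, and the heavy symbol of class c, if
any, forms group 2c + 1; this gives 2q + 2 groups, increasing with the symbol. Let G k i p be the
maximal length of a common increasing subsequence of the first i symbols of A and the first p of B
that uses only groups up to k. Per row only these O(q) functions of p are stored, not one for every
threshold on the symbols.

Row i, with symbol x, leaves G k unchanged if k is below the group of x and replaces it by max (G k,
U) otherwise, where U does not depend on k (`dpG_row`, `Env.OK.G_succ`). U is built from the single
function G (2·cls x) and a set of marked matches. For heavy x, the symbols below x are exactly those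
of the groups up to 2·cls x, and every match is marked. For light x, a match is marked only if the
best chain below x is as long as G of the group of x in front of it; any other match yields nothing
that this G does not have already. At a light match, the best chain below x comes either from a
lower group function or from a light column of the same class, so one scan of a list of at most s
columns determines it (`below_cases`).

As a function of p, each G k i is monotone and grows by at most 1 per step (`dpG_succ_right_le`). A
block of b = q² values is therefore given by its first value and a code below C = b^b. Since C⁴ ≤ M
+ 1, the pointwise maximum of two blocks (`Cell.merge`) and the running maximum over marked
positions (`Cell.run`) can be tabulated in linear time, and each block operation becomes a table
lookup. A row costs O(q·m/b + s) = O(M/q). All rows are kept, along with a parent for every match,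
so a solution is traced back in O(M) steps. -/

set_option linter.constructorNameAsVariable false
set_option linter.unusedSimpArgs false
set_option linter.unusedVariables false

namespace LCIS

/-! ### A small imperative language over natural numbers -/

/-- Variables; the first two hold the input lengths. -/
inductive Var where
  | n | m | M | l | pw | q | q1 | b | s | nb | kk | St | Cc | P2 | B2 | sz1 | sz2
  | t | o | w | i | j | mid | hi | r | cur | cc | x | y | c | g | bs | p | z | u | k | d
  | val | par | e | h | ab | cd | mk | ua | ux | acc | x1 | x2 | cm | f | i1 | p1 | L | len | k0
  deriving DecidableEq

/-- Arrays. -/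
inductive Arr where
  | S | S2 | RK | H | LST | CNT | MASK | POWB | POW2 | T1 | T2 | T3 | ABS | CODE | UA | UX
  | LV | LC | PAR
  deriving DecidableEq

/-- Register of a variable. -/
def Var.idx (x : Var) : ℕ := x.ctorIdx

/-- Residue class of the addresses of an array. -/
def Arr.idx (r : Arr) : ℕ := r.ctorIdx

theorem Var.idx_lt (x : Var) : x.idx < 64 := by cases x <;> decide

theorem Arr.idx_lt (r : Arr) : r.idx < 32 := by cases r <;> decide

theorem Var.idx_inj {x y : Var} (h : x.idx = y.idx) : x = y := by
  cases x <;> first | (cases y <;> first | rfl | (exact absurd h (by decide)))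

theorem Arr.idx_inj {x y : Arr} (h : x.idx = y.idx) : x = y := by
  cases x <;> first | (cases y <;> first | rfl | (exact absurd h (by decide)))

/-- States: variables, arrays, the raw cells `0, 1, 2, …`, and a step counter. -/
structure St where
  v : Var → ℕ
  a : Arr → ℕ → ℕ
  raw : ℕ → ℤ
  time : ℕ

namespace St

def tick (h : St) : St := { h with time := h.time + 1 }

def set (h : St) (x : Var) (k : ℕ) : St :=
  { h with v := Function.update h.v x k, time := h.time + 1 }

def sto (h : St) (r : Arr) (i k : ℕ) : St :=
  { h with a := Function.update h.a r (Function.update (h.a r) i k), time := h.time + 1 }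

def rst (h : St) (i : ℕ) (k : ℕ) : St :=
  { h with raw := Function.update h.raw i (k : ℤ), time := h.time + 1 }

variable (h : St) (x y : Var) (r r' : Arr) (i k : ℕ)

@[simp] theorem tick_v : h.tick.v = h.v := rfl
@[simp] theorem tick_a : h.tick.a = h.a := rfl
@[simp] theorem tick_raw : h.tick.raw = h.raw := rfl
@[simp] theorem tick_time : h.tick.time = h.time + 1 := rfl
@[simp] theorem set_v : (h.set x k).v y = if y = x then k else h.v y := by
  simp [set, Function.update_apply]
@[simp] theorem set_a : (h.set x k).a = h.a := rfl
@[simp] theorem set_raw : (h.set x k).raw = h.raw := rfl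
@[simp] theorem set_time : (h.set x k).time = h.time + 1 := rfl
@[simp] theorem sto_v : (h.sto r i k).v = h.v := rfl
@[simp] theorem sto_a : (h.sto r i k).a r' =
    if r' = r then Function.update (h.a r) i k else h.a r' := by
  simp only [sto, Function.update_apply]
@[simp] theorem sto_raw : (h.sto r i k).raw = h.raw := rfl
@[simp] theorem sto_time : (h.sto r i k).time = h.time + 1 := rfl
@[simp] theorem rst_v : (h.rst i k).v = h.v := rfl
@[simp] theorem rst_a : (h.rst i k).a = h.a := rfl
@[simp] theorem rst_raw : (h.rst i k).raw = Function.update h.raw i (k : ℤ) := rfl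
@[simp] theorem rst_time : (h.rst i k).time = h.time + 1 := rfl

/-- All values are at most `X`. -/
def Bdd (X : ℕ) (h : St) : Prop := (∀ x, h.v x ≤ X) ∧ ∀ r i, h.a r i ≤ X

end St

/-- Expressions. -/
inductive Ex where
  | v (x : Var)
  | c (k : ℕ)
  | add (a b : Ex)
  | sub (a b : Ex)
  | mul (a b : Ex)
  | div (a b : Ex)
  | mod (a b : Ex)
  | ld (r : Arr) (e : Ex)

instance : Add Ex := ⟨Ex.add⟩
instance : Sub Ex := ⟨Ex.sub⟩
instance : Mul Ex := ⟨Ex.mul⟩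
instance : Div Ex := ⟨Ex.div⟩
instance : Mod Ex := ⟨Ex.mod⟩
instance (k : ℕ) : OfNat Ex k := ⟨Ex.c k⟩
instance : Coe Var Ex := ⟨Ex.v⟩
instance : CoeFun Arr (fun _ => Ex → Ex) := ⟨Ex.ld⟩

/-! ### Expressions: values, degree bounds and compilation -/

namespace Ex

@[simp] def ev (h : St) : Ex → ℕ
  | v x => h.v x
  | c k => k
  | add a b => ev h a + ev h b
  | sub a b => ev h a - ev h b
  | mul a b => ev h a * ev h b
  | div a b => ev h a / ev h b
  | mod a b => ev h a % ev h b
  | ld r e => h.a r (ev h e)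

/-- No subtraction is truncated. -/
@[simp] def ok (h : St) : Ex → Prop
  | v _ => True
  | c _ => True
  | add a b => ok h a ∧ ok h b
  | sub a b => ok h a ∧ ok h b ∧ ev h b ≤ ev h a
  | mul a b => ok h a ∧ ok h b
  | div a b => ok h a ∧ ok h b
  | mod a b => ok h a ∧ ok h b
  | ld _ e => ok h e

@[simp] theorem ev_add (h : St) (a b : Ex) : (a + b).ev h = a.ev h + b.ev h := rfl
@[simp] theorem ev_sub (h : St) (a b : Ex) : (a - b).ev h = a.ev h - b.ev h := rfl
@[simp] theorem ev_mul (h : St) (a b : Ex) : (a * b).ev h = a.ev h * b.ev h := rfl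
@[simp] theorem ev_div (h : St) (a b : Ex) : (a / b).ev h = a.ev h / b.ev h := rfl
@[simp] theorem ev_mod (h : St) (a b : Ex) : (a % b).ev h = a.ev h % b.ev h := rfl
@[simp] theorem ev_ofNat (h : St) (k : ℕ) : (OfNat.ofNat k : Ex).ev h = k := rfl
@[simp] theorem ok_add (h : St) (a b : Ex) : (a + b).ok h ↔ a.ok h ∧ b.ok h := Iff.rfl
@[simp] theorem ok_sub (h : St) (a b : Ex) :
    (a - b).ok h ↔ a.ok h ∧ b.ok h ∧ b.ev h ≤ a.ev h := Iff.rfl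
@[simp] theorem ok_mul (h : St) (a b : Ex) : (a * b).ok h ↔ a.ok h ∧ b.ok h := Iff.rfl
@[simp] theorem ok_div (h : St) (a b : Ex) : (a / b).ok h ↔ a.ok h ∧ b.ok h := Iff.rfl
@[simp] theorem ok_mod (h : St) (a b : Ex) : (a % b).ok h ↔ a.ok h ∧ b.ok h := Iff.rfl
@[simp] theorem ok_ofNat (h : St) (k : ℕ) : (OfNat.ofNat k : Ex).ok h := trivial

/-- A bound for the degree of the value in the bound for the variables. -/
def deg : Ex → ℕ
  | v _ => 1
  | c k => k + 1
  | add a b => deg a + deg b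
  | sub a b => deg a + deg b
  | mul a b => deg a + deg b
  | div a b => deg a + deg b
  | mod a b => deg a + deg b
  | ld _ e => deg e + 1

/-- Number of machine steps of the evaluation. -/
def cost : Ex → ℕ
  | v _ => 2
  | c _ => 1
  | add a b => cost a + cost b + 1
  | sub a b => cost a + cost b + 1
  | mul a b => cost a + cost b + 1
  | div a b => cost a + cost b + 1
  | mod a b => cost a + cost b + 1
  | ld _ e => cost e + 5

/-- Compilation to code that puts the value into register `d`. -/
def comp : Ex → ℕ → Prog
  | v x, d => .seq (.const d 0) (.arith d .add x.idx d)
  | c k, d => .const d k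
  | add a b, d => .seq (.seq (comp a d) (comp b (d + 1))) (.arith d .add d (d + 1))
  | sub a b, d => .seq (.seq (comp a d) (comp b (d + 1))) (.arith d .sub d (d + 1))
  | mul a b, d => .seq (.seq (comp a d) (comp b (d + 1))) (.arith d .mul d (d + 1))
  | div a b, d => .seq (.seq (comp a d) (comp b (d + 1))) (.arith d .div d (d + 1))
  | mod a b, d => .seq (.seq (comp a d) (comp b (d + 1))) (.arith d .mod d (d + 1))
  | ld r e, d => .seq (comp e d) (.seq (.const (d + 1) (-32)) (.seq (.arith d .mul d (d + 1))
      (.seq (.const (d + 1) (r.idx + 1)) (.seq (.arith d .sub d (d + 1)) (.load d d)))))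

theorem deg_pos (e : Ex) : 1 ≤ e.deg := by
  induction e <;> simp [deg] <;> omega

/-- Since X ≥ 2, two powers of X with positive exponents have a sum bounded by their product, so
degrees simply add for every binary operation. A literal k lies below X^(k+1). -/
theorem ev_le {X : ℕ} {h : St} (hX : 2 ≤ X) (hb : h.Bdd X) (e : Ex) : e.ev h ≤ X ^ e.deg := by
  have hadd : ∀ a b : ℕ, ∀ d d' : ℕ, 1 ≤ d → 1 ≤ d' → a ≤ X ^ d → b ≤ X ^ d' →
      a + b ≤ X ^ (d + d') := by
    intro a b d d' h1 h2 h3 h4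
    have e1 : 2 ≤ X ^ d := hX.trans (Nat.le_self_pow (by omega) X)
    have e2 : 2 ≤ X ^ d' := hX.trans (Nat.le_self_pow (by omega) X)
    rw [pow_add]
    nlinarith
  induction e with
  | v x => simpa [deg] using hb.1 x
  | c k =>
    simp only [ev, deg]
    exact (Nat.lt_pow_self (by omega : 1 < X)).le.trans (Nat.pow_le_pow_right (by omega) (by omega))
  | add a b iha ihb => exact hadd _ _ _ _ a.deg_pos b.deg_pos iha ihb
  | sub a b iha ihb =>
    exact ((Nat.sub_le _ _).trans (Nat.le_add_right _ _)).trans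
      (hadd _ _ _ _ a.deg_pos b.deg_pos iha ihb)
  | mul a b iha ihb => simpa [deg, pow_add] using Nat.mul_le_mul iha ihb
  | div a b iha ihb =>
    exact ((Nat.div_le_self _ _).trans (Nat.le_add_right _ _)).trans
      (hadd _ _ _ _ a.deg_pos b.deg_pos iha ihb)
  | mod a b iha ihb =>
    exact ((Nat.mod_le _ _).trans (Nat.le_add_right _ _)).trans
      (hadd _ _ _ _ a.deg_pos b.deg_pos iha ihb)
  | ld r e ih =>
    simpa [deg] using (hb.2 r _).trans (Nat.le_self_pow (n := e.deg + 1) (by omega) X)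

end Ex

/-- Address of an array element. -/
def addr (r : Arr) (i : ℕ) : ℤ := (i : ℤ) * (-32) - ((r.idx : ℤ) + 1)

/-- The arrays are interleaved with stride 32 in the negative cells: the residue of an address names
the array. The nonnegative cells remain for the raw input and the output. -/
theorem addr_inj {r r' : Arr} {i i' : ℕ} (h : addr r i = addr r' i') : r = r' ∧ i = i' := by
  have h1 := r.idx_lt
  have h2 := r'.idx_lt
  unfold addr at h
  have h3 : i = i' := by omega
  subst h3
  exact ⟨Arr.idx_inj (by omega), rfl⟩

theorem addr_neg (r : Arr) (i : ℕ) : addr r i < 0 := by unfold addr; omega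

/-- A machine state represents a state of the small language. -/
structure Rep (s : State) (h : St) : Prop where
  reg : ∀ x : Var, s.reg x.idx = h.v x
  arr : ∀ r i, s.mem (addr r i) = h.a r i
  raw : ∀ i : ℕ, s.mem i = h.raw i

theorem Rep.congr {s s' : State} {h : St} (H : Rep s h) (hm : s'.mem = s.mem)
    (hr : ∀ r < 64, s'.reg r = s.reg r) : Rep s' h :=
  ⟨fun x => by rw [hr _ x.idx_lt, H.reg], fun r i => by rw [hm, H.arr], fun i => by rw [hm, H.raw]⟩

theorem isWord_nat {w k : ℕ} (h : k < 2 ^ w) : IsWord w (k : ℤ) := by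
  unfold IsWord
  rw [abs_of_nonneg (by positivity)]
  exact_mod_cast h

theorem isWord_of_le {w k : ℕ} {z : ℤ} (h : k < 2 ^ w) (h1 : -(k : ℤ) ≤ z) (h2 : z ≤ k) :
    IsWord w z := by
  unfold IsWord
  have : (k : ℤ) < 2 ^ w := by exact_mod_cast h
  exact (abs_le.2 ⟨h1, h2⟩).trans_lt this

@[simp] theorem State.setReg_mem (s : State) (r : ℕ) (v : ℤ) : (s.setReg r v).mem = s.mem := rfl
@[simp] theorem State.setReg_reg (s : State) (r r' : ℕ) (v : ℤ) :
    (s.setReg r v).reg r' = if r' = r then v else s.reg r' := by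
  simp [State.setReg, Function.update_apply]
@[simp] theorem State.setMem_reg (s : State) (a v : ℤ) : (s.setMem a v).reg = s.reg := rfl
@[simp] theorem State.setMem_mem (s : State) (a v a' : ℤ) :
    (s.setMem a v).mem a' = if a' = a then v else s.mem a' := by
  simp [State.setMem, Function.update_apply]

/-- Wide enough words for values of degree `D` over `X`. -/
def Wide (w X D : ℕ) : Prop := 64 * (X ^ D + 1) < 2 ^ w

theorem Wide.mono {w X D D' : ℕ} (h : Wide w X D) (hX : 2 ≤ X) (hD : D' ≤ D) : Wide w X D' := by
  unfold Wide at *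
  have := Nat.pow_le_pow_right (by omega : 0 < X) hD
  omega

theorem Wide.lt {w X D k : ℕ} (h : Wide w X D) (hk : k ≤ X ^ D) : k < 2 ^ w := by
  unfold Wide at h; omega

/-- Computing an address passes through -32·i and subtracts at most 32; the factor 64 in `Wide`
leaves room for this. -/
theorem addr_word {w X D : ℕ} (h : Wide w X D) (r : Arr) {i : ℕ} (hi : i ≤ X ^ D) :
    IsWord w (addr r i) ∧ IsWord w ((i : ℤ) * (-32)) ∧ IsWord w (-32) ∧
      IsWord w ((r.idx : ℤ) + 1) := by
  have h1 := r.idx_lt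
  unfold Wide at h
  refine ⟨isWord_of_le (k := 32 * i + 32) (by omega) ?_ ?_,
    isWord_of_le (k := 32 * i) (by omega) ?_ ?_,
    isWord_of_le (k := 32) (by omega) ?_ ?_, isWord_of_le (k := 32) (by omega) ?_ ?_⟩ <;>
  (try unfold addr) <;> push_cast <;> omega

/-- Evaluation into register d touches only registers from d on. Hence the left operand survives in
d while the right one is evaluated in d + 1, and the variables, which live below 64, are preserved.
-/
theorem Ex.comp_exec {w X : ℕ} {h : St} (hX : 2 ≤ X) (hb : h.Bdd X) (e : Ex) :
    ∀ (d : ℕ) (s : State), 64 ≤ d → Wide w X e.deg → e.ok h → Rep s h →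
      ∃ s', Exec w (e.comp d) s e.cost s' ∧ s'.mem = s.mem ∧ s'.reg d = e.ev h ∧
        ∀ r < d, s'.reg r = s.reg r := by
  have bin : ∀ (o : Op) (a b : Ex) (f : ℕ) (d : ℕ) (s : State), 64 ≤ d →
      Wide w X (a.deg + b.deg) → o.eval (a.ev h) (b.ev h) = (f : ℤ) → f ≤ X ^ (a.deg + b.deg) →
      Rep s h →
      (∀ (d : ℕ) (s : State), 64 ≤ d → Rep s h →
      ∃ s', Exec w (a.comp d) s a.cost s' ∧ s'.mem = s.mem ∧ s'.reg d = a.ev h ∧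
        ∀ r < d, s'.reg r = s.reg r) →
      (∀ (d : ℕ) (s : State), 64 ≤ d → Rep s h →
      ∃ s', Exec w (b.comp d) s b.cost s' ∧ s'.mem = s.mem ∧ s'.reg d = b.ev h ∧
        ∀ r < d, s'.reg r = s.reg r) →
      ∃ s', Exec w (.seq (.seq (comp a d) (comp b (d + 1))) (.arith d o d (d + 1))) s
        (a.cost + b.cost + 1) s' ∧ s'.mem = s.mem ∧ s'.reg d = f ∧
        ∀ r < d, s'.reg r = s.reg r := by
    intro o a b f d s hd hW hf hfX hR iha ihb
    obtain ⟨s1, e1, m1, r1, q1⟩ := iha d s hd hR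
    obtain ⟨s2, e2, m2, r2, q2⟩ := ihb (d + 1) s1 (by omega)
      (hR.congr m1 fun r hr => q1 r (by omega))
    have h3 : o.eval (s2.reg d) (s2.reg (d + 1)) = f := by rw [r2, q2 d (by omega), r1, hf]
    refine ⟨s2.setReg d f, .seq (.seq e1 e2) ?_, ?_, ?_, ?_⟩
    · have := Exec.arith (w := w) d o d (d + 1) s2 (by rw [h3]; exact isWord_nat (hW.lt hfX))
      rwa [h3] at this
    · simp [m2, m1]
    · simp
    · intro r hr
      rw [State.setReg_reg, if_neg (by omega), q2 r (by omega), q1 r hr]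
  induction e with
  | v x =>
    intro d s hd hW _ hR
    have hx := x.idx_lt
    have h3 : (h.v x : ℤ) = Op.eval .add ((s.setReg d 0).reg x.idx) ((s.setReg d 0).reg d) := by
      simp [Op.eval, hR.reg, show x.idx ≠ d by omega]
    have h4 : IsWord w 0 := isWord_nat (k := 0) (by positivity)
    refine ⟨(s.setReg d 0).setReg d (h.v x), Exec.seq (t' := 1) (.const _ _ _ h4) ?_, rfl,
      by simp, ?_⟩
    · have := Exec.arith (w := w) d .add x.idx d (s.setReg d 0)
        (by rw [← h3]; exact isWord_nat (hW.lt (by simpa [Ex.deg] using hb.1 x)))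
      rwa [← h3] at this
    · intro r hr
      simp [show r ≠ d by omega]
  | c k =>
    intro d s hd hW _ hR
    refine ⟨s.setReg d k, .const _ _ _ (isWord_nat (hW.lt (Ex.ev_le hX hb (.c k)))), rfl, by simp,
      fun r hr => by simp [show r ≠ d by omega]⟩
  | add a b iha ihb =>
    intro d s hd hW hok hR
    exact bin .add a b _ d s hd hW (by simp [Op.eval]) (Ex.ev_le hX hb (.add a b)) hR
      (fun d s hd hR => iha d s hd (hW.mono hX (by simp [deg])) hok.1 hR)
      (fun d s hd hR => ihb d s hd (hW.mono hX (by simp [deg])) hok.2 hR)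
  | sub a b iha ihb =>
    intro d s hd hW hok hR
    exact bin .sub a b _ d s hd hW (by simp [Op.eval, Nat.cast_sub hok.2.2])
      (Ex.ev_le hX hb (.sub a b)) hR
      (fun d s hd hR => iha d s hd (hW.mono hX (by simp [deg])) hok.1 hR)
      (fun d s hd hR => ihb d s hd (hW.mono hX (by simp [deg])) hok.2.1 hR)
  | mul a b iha ihb =>
    intro d s hd hW hok hR
    exact bin .mul a b _ d s hd hW (by simp [Op.eval]) (Ex.ev_le hX hb (.mul a b)) hR
      (fun d s hd hR => iha d s hd (hW.mono hX (by simp [deg])) hok.1 hR)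
      (fun d s hd hR => ihb d s hd (hW.mono hX (by simp [deg])) hok.2 hR)
  | div a b iha ihb =>
    intro d s hd hW hok hR
    exact bin .div a b _ d s hd hW (by simp [Op.eval]) (Ex.ev_le hX hb (.div a b)) hR
      (fun d s hd hR => iha d s hd (hW.mono hX (by simp [deg])) hok.1 hR)
      (fun d s hd hR => ihb d s hd (hW.mono hX (by simp [deg])) hok.2 hR)
  | mod a b iha ihb =>
    intro d s hd hW hok hR
    exact bin .mod a b _ d s hd hW (by simp [Op.eval]) (Ex.ev_le hX hb (.mod a b)) hR
      (fun d s hd hR => iha d s hd (hW.mono hX (by simp [deg])) hok.1 hR)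
      (fun d s hd hR => ihb d s hd (hW.mono hX (by simp [deg])) hok.2 hR)
  | ld r e ih =>
    intro d s hd hW hok hR
    have hW' : Wide w X e.deg := hW.mono hX (by simp [deg])
    obtain ⟨s1, e1, m1, r1, q1⟩ := ih d s hd hW' hok hR
    obtain ⟨w1, w2, w3, w4⟩ := addr_word hW' r (Ex.ev_le hX hb e)
    refine ⟨_, .seq e1 (.seq (.const _ _ _ w3) (.seq (.arith _ _ _ _ _ ?_)
      (.seq (.const _ _ _ w4) (.seq (.arith _ _ _ _ _ ?_) (.load _ _ _))))), ?_, ?_, ?_⟩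
    · simpa [Op.eval, r1] using w2
    · simpa [Op.eval, r1, addr] using w1
    · simp [m1]
    · simp only [State.setReg_reg, State.setReg_mem, Op.eval, if_true]
      simp only [show d ≠ d + 1 by omega, if_false, r1, m1]
      exact hR.arr r _
    · intro r' hr'
      simp [show r' ≠ d by omega, show r' ≠ d + 1 by omega, q1 r' hr']

/-- Conditions; `rlt` compares two raw cells. -/
inductive Cd where
  | lt (a b : Ex)
  | le (a b : Ex)
  | eq (a b : Ex)
  | rlt (a b : Ex)

namespace Cd

@[simp] def holds (h : St) : Cd → Prop
  | lt a b => a.ev h < b.ev h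
  | le a b => a.ev h ≤ b.ev h
  | eq a b => a.ev h = b.ev h
  | rlt a b => h.raw (a.ev h) < h.raw (b.ev h)

@[simp] def ok (h : St) : Cd → Prop
  | lt a b => a.ok h ∧ b.ok h
  | le a b => a.ok h ∧ b.ok h
  | eq a b => a.ok h ∧ b.ok h
  | rlt a b => a.ok h ∧ b.ok h

def cmp : Cd → Cmp
  | lt _ _ => .lt
  | le _ _ => .le
  | eq _ _ => .eq
  | rlt _ _ => .lt

def deg : Cd → ℕ
  | lt a b => a.deg + b.deg
  | le a b => a.deg + b.deg
  | eq a b => a.deg + b.deg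
  | rlt a b => a.deg + b.deg

/-- Evaluation of both sides into the registers `64` and `65`. -/
def comp : Cd → Prog
  | lt a b => .seq (a.comp 64) (b.comp 65)
  | le a b => .seq (a.comp 64) (b.comp 65)
  | eq a b => .seq (a.comp 64) (b.comp 65)
  | rlt a b => .seq (.seq (a.comp 64) (b.comp 65)) (.seq (.load 64 64) (.load 65 65))

def cost : Cd → ℕ
  | lt a b => a.cost + b.cost
  | le a b => a.cost + b.cost
  | eq a b => a.cost + b.cost
  | rlt a b => a.cost + b.cost + 2

theorem pair_exec {w X : ℕ} {h : St} (hX : 2 ≤ X) (hb : h.Bdd X) (a b : Ex) {s : State}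
    (hW : Wide w X (a.deg + b.deg)) (ha : a.ok h) (hb' : b.ok h) (hR : Rep s h) :
    ∃ s', Exec w (.seq (a.comp 64) (b.comp 65)) s (a.cost + b.cost) s' ∧ Rep s' h ∧
      s'.reg 64 = a.ev h ∧ s'.reg 65 = b.ev h := by
  obtain ⟨s1, e1, m1, r1, q1⟩ := a.comp_exec hX hb 64 s le_rfl (hW.mono hX (by omega)) ha hR
  have hR1 : Rep s1 h := hR.congr m1 fun r hr => q1 r (by omega)
  obtain ⟨s2, e2, m2, r2, q2⟩ := b.comp_exec hX hb 65 s1 (by omega) (hW.mono hX (by omega)) hb' hR1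
  exact ⟨s2, .seq e1 e2, hR1.congr m2 fun r hr => q2 r (by omega),
    by rw [q2 _ (by omega), r1], r2⟩

theorem comp_exec {w X : ℕ} {h : St} (hX : 2 ≤ X) (hb : h.Bdd X) (c : Cd) {s : State}
    (hW : Wide w X c.deg) (hok : c.ok h) (hR : Rep s h) :
    ∃ s', Exec w c.comp s c.cost s' ∧ Rep s' h ∧
      (c.cmp.Holds (s'.reg 64) (s'.reg 65) ↔ c.holds h) := by
  cases c with
  | lt a b =>
    obtain ⟨s', h1, h2, h3, h4⟩ := pair_exec hX hb a b hW hok.1 hok.2 hR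
    exact ⟨s', h1, h2, by simp [cmp, Cmp.Holds, h3, h4]⟩
  | le a b =>
    obtain ⟨s', h1, h2, h3, h4⟩ := pair_exec hX hb a b hW hok.1 hok.2 hR
    exact ⟨s', h1, h2, by simp [cmp, Cmp.Holds, h3, h4]⟩
  | eq a b =>
    obtain ⟨s', h1, h2, h3, h4⟩ := pair_exec hX hb a b hW hok.1 hok.2 hR
    exact ⟨s', h1, h2, by simp [cmp, Cmp.Holds, h3, h4]⟩
  | rlt a b =>
    obtain ⟨s', h1, h2, h3, h4⟩ := pair_exec hX hb a b hW hok.1 hok.2 hR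
    refine ⟨_, .seq h1 (.seq (.load _ _ _) (.load _ _ _)), h2.congr rfl ?_, ?_⟩
    · intro r hr
      simp [show r ≠ 64 by omega, show r ≠ 65 by omega]
    · simp [cmp, Cmp.Holds, h3, h4, h2.raw]

end Cd

/-- Commands. -/
inductive Cm where
  | skip
  | asg (x : Var) (e : Ex)
  | sto (r : Arr) (i e : Ex)
  | rst (i e : Ex)
  | seq (P Q : Cm)
  | ite (c : Cd) (P Q : Cm)
  | whl (c : Cd) (P : Cm)

/-- Runs of commands during which all assigned values are at most `X`. -/
inductive HX (X : ℕ) : Cm → St → St → Prop where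
  | skip (h : St) : HX X .skip h h.tick
  | asg {x : Var} {e : Ex} {h : St} (h1 : e.ok h) (h2 : e.ev h ≤ X) :
      HX X (.asg x e) h (h.set x (e.ev h))
  | sto {r : Arr} {i e : Ex} {h : St} (h1 : i.ok h) (h2 : e.ok h) (h3 : e.ev h ≤ X) :
      HX X (.sto r i e) h (h.sto r (i.ev h) (e.ev h))
  | rst {i e : Ex} {h : St} (h1 : i.ok h) (h2 : e.ok h) :
      HX X (.rst i e) h (h.rst (i.ev h) (e.ev h))
  | seq {P Q : Cm} {h h1 h2 : St} (hP : HX X P h h1) (hQ : HX X Q h1 h2) : HX X (.seq P Q) h h2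
  | iteT {c : Cd} {P Q : Cm} {h h1 : St} (hc : c.ok h) (hh : c.holds h) (hP : HX X P h.tick h1) :
      HX X (.ite c P Q) h h1
  | iteF {c : Cd} {P Q : Cm} {h h1 : St} (hc : c.ok h) (hh : ¬ c.holds h)
      (hQ : HX X Q h.tick h1) : HX X (.ite c P Q) h h1
  | whlT {c : Cd} {P : Cm} {h h1 h2 : St} (hc : c.ok h) (hh : c.holds h) (hP : HX X P h.tick h1)
      (hW : HX X (.whl c P) h1 h2) : HX X (.whl c P) h h2
  | whlF {c : Cd} {P : Cm} {h : St} (hc : c.ok h) (hh : ¬ c.holds h) : HX X (.whl c P) h h.tick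

/-! ### Compilation of commands and the simulation -/

namespace Cm

def deg : Cm → ℕ
  | skip => 0
  | asg _ e => e.deg
  | sto _ i e => i.deg + e.deg
  | rst i e => i.deg + e.deg
  | seq P Q => deg P + deg Q
  | ite c P Q => c.deg + deg P + deg Q
  | whl c P => c.deg + deg P

def comp : Cm → Prog
  | skip => .skip
  | asg x e => .seq (e.comp 64) (.seq (.const 65 0) (.arith x.idx .add 64 65))
  | sto r i e => .seq (.seq (i.comp 64) (e.comp 65)) (.seq (.const 66 (-32))
      (.seq (.arith 64 .mul 64 66) (.seq (.const 66 (r.idx + 1)) (.seq (.arith 64 .sub 64 66)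
        (.store 64 65)))))
  | rst i e => .seq (.seq (i.comp 64) (e.comp 65)) (.store 64 65)
  | seq P Q => .seq (comp P) (comp Q)
  | ite c P Q => .seq c.comp (.ifThenElse c.cmp 64 65 (comp P) (comp Q))
  | whl c P => .seq c.comp (.whileDo c.cmp 64 65 (.seq (comp P) c.comp))

/-- Bound for the number of machine steps per step of the small language. -/
def fac : Cm → ℕ
  | skip => 1
  | asg _ e => e.cost + 2
  | sto _ i e => i.cost + e.cost + 5
  | rst i e => i.cost + e.cost + 1
  | seq P Q => fac P + fac Q
  | ite c P Q => c.cost + 1 + fac P + fac Q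
  | whl c P => c.cost + 1 + fac P

end Cm

theorem HX.bdd {X : ℕ} {c : Cm} {h h' : St} (H : HX X c h h') (hb : h.Bdd X) : h'.Bdd X := by
  induction H with
  | skip h => exact hb
  | asg h1 h2 =>
    refine ⟨fun y => ?_, hb.2⟩
    simp only [St.set_v]
    split_ifs
    · exact h2
    · exact hb.1 y
  | sto h1 h2 h3 =>
    refine ⟨hb.1, fun r j => ?_⟩
    simp only [St.sto_a]
    split_ifs
    · simp only [Function.update_apply]
      split_ifs
      · exact h3
      · exact hb.2 _ _
    · exact hb.2 _ _
  | rst h1 h2 => exact hb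
  | seq hP hQ ih1 ih2 => exact ih2 (ih1 hb)
  | iteT hc hh hP ih => exact ih hb
  | iteF hc hh hQ ih => exact ih hb
  | whlT hc hh hP hW ih1 ih2 => exact ih2 (ih1 hb)
  | whlF hc hh => exact hb

/-- Compiled commands simulate the small language. -/
theorem HX.sim {w X : ℕ} (hX : 2 ≤ X) {c : Cm} {h h' : St} (H : HX X c h h') (hb : h.Bdd X) :
    ∀ (F : ℕ) (s : State), Wide w X c.deg → c.fac ≤ F → Rep s h →
      ∃ s' t, Exec w c.comp s t s' ∧ Rep s' h' ∧ t + F * h.time ≤ F * h'.time := by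
  -- The step count is kept as a potential inequality: each tick of the small language pays for F
  -- machine steps, and the inequalities of consecutive commands add up.
  induction H with
  | skip h =>
    intro F s hW hF hR
    refine ⟨s, 1, .skip s, ⟨hR.reg, hR.arr, hR.raw⟩, ?_⟩
    simp only [Cm.fac, St.tick_time] at *
    nlinarith
  | @asg x e h h1 h2 =>
    intro F s hW hF hR
    obtain ⟨s1, e1, m1, r1, q1⟩ := e.comp_exec hX hb 64 s le_rfl hW h1 hR
    have hx := x.idx_lt
    have h3 : (e.ev h : ℤ) = Op.eval .add ((s1.setReg 65 0).reg 64) ((s1.setReg 65 0).reg 65) := by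
      simp [Op.eval, r1]
    have h4 : IsWord w 0 := isWord_nat (k := 0) (by positivity)
    refine ⟨(s1.setReg 65 0).setReg x.idx (e.ev h), _,
      .seq e1 (Exec.seq (t' := 1) (.const _ _ _ h4) ?_), ?_, ?_⟩
    · have := Exec.arith (w := w) x.idx .add 64 65 (s1.setReg 65 0)
        (by rw [← h3]; exact isWord_nat (hW.lt (Ex.ev_le hX hb e)))
      rwa [← h3] at this
    · refine ⟨fun y => ?_, fun r i => ?_, fun i => ?_⟩
      · have hy := y.idx_lt
        simp only [State.setReg_reg, St.set_v]
        by_cases hxy : y = x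
        · simp [hxy]
        · rw [if_neg (fun hh => hxy (Var.idx_inj hh)), if_neg (by omega), if_neg hxy,
            q1 _ hy, hR.reg]
      · simp [m1, hR.arr]
      · simp [m1, hR.raw]
    · simp only [Cm.fac, St.set_time] at *
      nlinarith
  | @sto r i e h h1 h2 h3 =>
    intro F s hW hF hR
    obtain ⟨s1, e1, R1, a1, a2⟩ := Cd.pair_exec hX hb i e hW h1 h2 hR
    obtain ⟨w1, w2, w3, w4⟩ := addr_word (hW.mono hX (by simp [Cm.deg])) r (Ex.ev_le hX hb i)
    refine ⟨_, _, .seq e1 (.seq (.const _ _ _ w3) (.seq (.arith _ _ _ _ _ ?_)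
      (.seq (.const _ _ _ w4) (.seq (.arith _ _ _ _ _ ?_) (.store _ _ _))))), ?_, ?_⟩
    · simpa [Op.eval, a1] using w2
    · simpa [Op.eval, a1, addr] using w1
    · have e3 : -((i.ev h : ℤ) * 32) - ((r.idx : ℤ) + 1) = addr r (i.ev h) := by unfold addr; ring
      refine ⟨fun y => ?_, fun r' j => ?_, fun j => ?_⟩
      · have hy := y.idx_lt
        simp [show y.idx ≠ 64 by omega, show y.idx ≠ 66 by omega, R1.reg]
      · simp only [State.setMem_mem, State.setReg_reg, State.setReg_mem, Op.eval, St.sto_a]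
        norm_num
        rw [a1, a2, e3]
        by_cases hr : r' = r
        · subst hr
          by_cases hj : j = i.ev h
          · simp [hj]
          · rw [if_neg (fun hh => hj (addr_inj hh).2)]
            simp [hj, R1.arr]
        · rw [if_neg (fun hh => hr (addr_inj hh).1), if_neg hr, R1.arr]
      · simp only [State.setMem_mem, State.setReg_reg, State.setReg_mem, Op.eval, St.sto_raw]
        norm_num
        rw [a1, e3, if_neg, R1.raw]
        have := addr_neg r (i.ev h)
        omega
    · simp only [Cm.fac, St.sto_time] at *
      nlinarith
  | @rst i e h h1 h2 =>
    intro F s hW hF hR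
    obtain ⟨s1, e1, R1, a1, a2⟩ := Cd.pair_exec hX hb i e hW h1 h2 hR
    refine ⟨_, _, .seq e1 (.store _ _ _), ⟨R1.reg, fun r j => ?_, fun j => ?_⟩, ?_⟩
    · rw [State.setMem_mem, a1, if_neg, R1.arr]
      · rfl
      · have := addr_neg r j
        omega
    · rw [State.setMem_mem, a1, a2, St.rst_raw, Function.update_apply, R1.raw]
      simp
    · simp only [Cm.fac, St.rst_time] at *
      nlinarith
  | seq hP hQ ih1 ih2 =>
    intro F s hW hF hR
    simp only [Cm.deg, Cm.fac] at hW hF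
    obtain ⟨s1, t1, e1, R1, l1⟩ := ih1 hb F s (hW.mono hX (by omega)) (by omega) hR
    obtain ⟨s2, t2, e2, R2, l2⟩ := ih2 (hP.bdd hb) F s1 (hW.mono hX (by omega)) (by omega) R1
    exact ⟨s2, t1 + t2, .seq e1 e2, R2, by omega⟩
  | @iteT c P Q h h' hc hh hP ih =>
    intro F s hW hF hR
    simp only [Cm.deg, Cm.fac] at hW hF
    obtain ⟨s1, e1, R1, c1⟩ := c.comp_exec hX hb (hW.mono hX (by omega)) hc hR
    obtain ⟨s2, t2, e2, R2, l2⟩ := ih hb F s1 (hW.mono hX (by omega)) (by omega)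
      ⟨R1.reg, R1.arr, R1.raw⟩
    refine ⟨s2, _, .seq e1 (.ifTrue (c1.2 hh) e2), R2, ?_⟩
    simp only [St.tick_time] at l2
    nlinarith
  | @iteF c P Q h h' hc hh hP ih =>
    intro F s hW hF hR
    simp only [Cm.deg, Cm.fac] at hW hF
    obtain ⟨s1, e1, R1, c1⟩ := c.comp_exec hX hb (hW.mono hX (by omega)) hc hR
    obtain ⟨s2, t2, e2, R2, l2⟩ := ih hb F s1 (hW.mono hX (by omega)) (by omega)
      ⟨R1.reg, R1.arr, R1.raw⟩
    refine ⟨s2, _, .seq e1 (.ifFalse (fun h => hh (c1.1 h)) e2), R2, ?_⟩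
    simp only [St.tick_time] at l2
    nlinarith
  | @whlT c P h h1 h2 hc hh hP hW' ih1 ih2 =>
    intro F s hW hF hR
    have hW0 := hW
    have hF0 := hF
    simp only [Cm.deg, Cm.fac] at hW hF
    obtain ⟨s1, e1, R1, c1⟩ := c.comp_exec hX hb (hW.mono hX (by omega)) hc hR
    obtain ⟨s2, t2, e2, R2, l2⟩ := ih1 hb F s1 (hW.mono hX (by omega)) (by omega)
      ⟨R1.reg, R1.arr, R1.raw⟩
    obtain ⟨s3, t3, e3, R3, l3⟩ := ih2 (hP.bdd hb) F s2 hW0 hF0 R2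
    -- The induction hypothesis runs the compiled remaining loop, which begins by evaluating the
    -- condition. That run is split so that the evaluation becomes the end of the current loop body.
    obtain _ | _ | _ | _ | _ | ⟨e4, e5⟩ := e3
    refine ⟨s3, _, .seq e1 (.whileTrue (c1.2 hh) (.seq e2 e4) e5), R3, ?_⟩
    simp only [St.tick_time] at l2
    nlinarith
  | @whlF c P h hc hh =>
    intro F s hW hF hR
    simp only [Cm.deg, Cm.fac] at hW hF
    obtain ⟨s1, e1, R1, c1⟩ := c.comp_exec hX hb (hW.mono hX (by omega)) hc hR
    refine ⟨s1, _, .seq e1 (.whileFalse (fun h => hh (c1.1 h))), ⟨R1.reg, R1.arr, R1.raw⟩, ?_⟩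
    simp only [St.tick_time]
    nlinarith

/-! ### Frames and proof rules -/

infixr:50 " ;; " => LCIS.Cm.seq
infix:60 " ≔ " => LCIS.Cm.asg

namespace Cm

/-- The command may assign to the variable. -/
def wv : Cm → Var → Bool
  | asg x _, y => decide (y = x)
  | seq P Q, y => wv P y || wv Q y
  | ite _ P Q, y => wv P y || wv Q y
  | whl _ P, y => wv P y
  | _, _ => false

/-- The command may write to the array. -/
def wa : Cm → Arr → Bool
  | sto r _ _, r' => decide (r' = r)
  | seq P Q, y => wa P y || wa Q y
  | ite _ P Q, y => wa P y || wa Q y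
  | whl _ P, y => wa P y
  | _, _ => false

/-- The command may write to the raw cells. -/
def wr : Cm → Bool
  | rst _ _ => true
  | seq P Q => wr P || wr Q
  | ite _ P Q => wr P || wr Q
  | whl _ P => wr P
  | _ => false

end Cm

/-- Everything that `c` does not write is unchanged. -/
structure Fr (c : Cm) (h h' : St) : Prop where
  v : ∀ x, c.wv x = false → h'.v x = h.v x
  a : ∀ r, c.wa r = false → h'.a r = h.a r
  raw : c.wr = false → h'.raw = h.raw

theorem Fr.refl (c : Cm) (h : St) : Fr c h h := ⟨fun _ _ => rfl, fun _ _ => rfl, fun _ => rfl⟩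

theorem Fr.trans {c : Cm} {h h1 h2 : St} (H : Fr c h h1) (H' : Fr c h1 h2) : Fr c h h2 :=
  ⟨fun x hx => (H'.v x hx).trans (H.v x hx), fun x hx => (H'.a x hx).trans (H.a x hx),
    fun hx => (H'.raw hx).trans (H.raw hx)⟩

theorem Fr.tick_left {c : Cm} {h h' : St} (H : Fr c h.tick h') : Fr c h h' := ⟨H.v, H.a, H.raw⟩

theorem Fr.tick {c : Cm} {h h' : St} (H : Fr c h h') : Fr c h h'.tick := ⟨H.v, H.a, H.raw⟩

theorem Fr.sub {c c' : Cm} {h h' : St} (H : Fr c h h') (hv : ∀ x, c'.wv x = false → c.wv x = false)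
    (ha : ∀ x, c'.wa x = false → c.wa x = false) (hr : c'.wr = false → c.wr = false) : Fr c' h h' :=
  ⟨fun x hx => H.v x (hv x hx), fun x hx => H.a x (ha x hx), fun hx => H.raw (hr hx)⟩

theorem HX.fr {X : ℕ} {c : Cm} {h h' : St} (H : HX X c h h') : Fr c h h' := by
  induction H with
  | skip h => exact (Fr.refl _ _).tick
  | asg h1 h2 => exact ⟨fun y hy => by simp [Cm.wv] at hy; simp [hy], fun _ _ => rfl, fun _ => rfl⟩
  | sto h1 h2 h3 =>
    exact ⟨fun _ _ => rfl, fun y hy => by simp [Cm.wa] at hy; simp [hy], fun _ => rfl⟩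
  | rst h1 h2 => exact ⟨fun _ _ => rfl, fun _ _ => rfl, fun h => by simp [Cm.wr] at h⟩
  | seq hP hQ ih1 ih2 =>
    refine Fr.trans (ih1.sub ?_ ?_ ?_) (ih2.sub ?_ ?_ ?_) <;> simp +contextual [Cm.wv, Cm.wa, Cm.wr]
  | iteT hc hh hP ih =>
    refine Fr.tick_left (ih.sub ?_ ?_ ?_) <;> simp +contextual [Cm.wv, Cm.wa, Cm.wr]
  | iteF hc hh hQ ih =>
    refine Fr.tick_left (ih.sub ?_ ?_ ?_) <;> simp +contextual [Cm.wv, Cm.wa, Cm.wr]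
  | whlT hc hh hP hW ih1 ih2 =>
    refine Fr.trans (Fr.tick_left (ih1.sub ?_ ?_ ?_)) ih2 <;>
      simp +contextual [Cm.wv, Cm.wa, Cm.wr]
  | whlF hc hh => exact (Fr.refl _ _).tick

/-- Command `c`, started in `h`, terminates in a state with property `Q`. -/
def Tr (X : ℕ) (c : Cm) (h : St) (Q : St → Prop) : Prop := ∃ h', HX X c h h' ∧ Q h'

section rules

variable {X : ℕ} {h : St} {Q : St → Prop}

theorem Tr.mono {c : Cm} {Q' : St → Prop} (H : Tr X c h Q) (H' : ∀ h', Fr c h h' → Q h' → Q' h') :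
    Tr X c h Q' := by
  obtain ⟨h', h1, h2⟩ := H
  exact ⟨h', h1, H' h' h1.fr h2⟩

theorem Tr_skip : Tr X .skip h Q ↔ Q h.tick :=
  ⟨fun ⟨_, H, hq⟩ => by cases H; exact hq, fun hq => ⟨_, .skip h, hq⟩⟩

theorem Tr_asg {x : Var} {e : Ex} :
    Tr X (x ≔ e) h Q ↔ e.ok h ∧ e.ev h ≤ X ∧ Q (h.set x (e.ev h)) :=
  ⟨fun ⟨_, H, hq⟩ => by cases H with | asg h1 h2 => exact ⟨h1, h2, hq⟩,
    fun ⟨h1, h2, hq⟩ => ⟨_, .asg h1 h2, hq⟩⟩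

theorem Tr_sto {r : Arr} {i e : Ex} :
    Tr X (.sto r i e) h Q ↔ i.ok h ∧ e.ok h ∧ e.ev h ≤ X ∧ Q (h.sto r (i.ev h) (e.ev h)) :=
  ⟨fun ⟨_, H, hq⟩ => by cases H with | sto h1 h2 h3 => exact ⟨h1, h2, h3, hq⟩,
    fun ⟨h1, h2, h3, hq⟩ => ⟨_, .sto h1 h2 h3, hq⟩⟩

theorem Tr_rst {i e : Ex} :
    Tr X (.rst i e) h Q ↔ i.ok h ∧ e.ok h ∧ Q (h.rst (i.ev h) (e.ev h)) :=
  ⟨fun ⟨_, H, hq⟩ => by cases H with | rst h1 h2 => exact ⟨h1, h2, hq⟩,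
    fun ⟨h1, h2, hq⟩ => ⟨_, .rst h1 h2, hq⟩⟩

theorem Tr_seq {c d : Cm} : Tr X (c ;; d) h Q ↔ Tr X c h fun h1 => Tr X d h1 Q :=
  ⟨fun ⟨_, H, hq⟩ => by cases H with | seq h1 h2 => exact ⟨_, h1, _, h2, hq⟩,
    fun ⟨_, h1, _, h2, hq⟩ => ⟨_, .seq h1 h2, hq⟩⟩

theorem Tr_ite {c : Cd} {P R : Cm} :
    Tr X (.ite c P R) h Q ↔ c.ok h ∧ (c.holds h → Tr X P h.tick Q) ∧
      (¬ c.holds h → Tr X R h.tick Q) := by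
  constructor
  · rintro ⟨h', H, hq⟩
    cases H with
    | iteT hc hh hP => exact ⟨hc, fun _ => ⟨_, hP, hq⟩, fun h => absurd hh h⟩
    | iteF hc hh hP => exact ⟨hc, fun h => absurd h hh, fun _ => ⟨_, hP, hq⟩⟩
  · rintro ⟨hc, h1, h2⟩
    by_cases hh : c.holds h
    · obtain ⟨h', hP, hq⟩ := h1 hh
      exact ⟨h', .iteT hc hh hP, hq⟩
    · obtain ⟨h', hP, hq⟩ := h2 hh
      exact ⟨h', .iteF hc hh hP, hq⟩

/-- While loops, with a measure that also bounds the number of iterations. -/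
theorem Tr_whl {c : Cd} {P : Cm} (I : St → Prop) (μ : St → ℕ) (C : ℕ) (h0 : I h)
    (hs : ∀ h1, Fr (.whl c P) h h1 → I h1 → c.ok h1 ∧ (c.holds h1 → Tr X P h1.tick fun h2 =>
      I h2 ∧ μ h2 < μ h1 ∧ h2.time ≤ h1.time + C))
    (hq : ∀ h2, Fr (.whl c P) h h2 → I h2 → ¬ c.holds h2 → h2.time ≤ h.time + C * μ h → Q h2.tick) :
    Tr X (.whl c P) h Q := by
  -- Strong induction on the measure. The time plus C times the measure never increases, so its
  -- value at the entry bounds the whole run.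
  have key : ∀ (k : ℕ) (h1 : St), μ h1 = k → Fr (.whl c P) h h1 → I h1 →
      h1.time + C * μ h1 ≤ h.time + C * μ h → Tr X (.whl c P) h1 Q := by
    intro k
    induction k using Nat.strong_induction_on with
    | _ k ih =>
      intro h1 hk hf hI ht
      obtain ⟨hok, hb⟩ := hs h1 hf hI
      by_cases hc : c.holds h1
      · obtain ⟨h2, H2, I2, μ2, t2⟩ := hb hc
        have f2 : Fr (.whl c P) h1 h2 := Fr.tick_left (H2.fr.sub (by simp [Cm.wv]) (by simp [Cm.wa])
          (by simp [Cm.wr]))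
        obtain ⟨h3, H3, q3⟩ := ih (μ h2) (hk ▸ μ2) h2 rfl (hf.trans f2) I2 (by nlinarith)
        exact ⟨h3, .whlT hok hc H2 H3, q3⟩
      · exact ⟨_, .whlF hok hc, hq h1 hf hI hc (by omega)⟩
  exact key _ h rfl (Fr.refl _ _) h0 le_rfl

end rules

/-- `for x < lim do c`. -/
def Cm.loop (x lim : Var) (c : Cm) : Cm :=
  (x ≔ 0) ;; Cm.whl (.lt x lim) (c ;; x ≔ x + 1)

/-- C pays for the loop test and the body; the increment of the counter costs one more. The body
must not assign to the counter or the limit, so limit minus counter is a valid measure. -/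
theorem Tr_loop {X : ℕ} {h : St} {Q : St → Prop} {x lim : Var} {c : Cm} (I : ℕ → St → Prop)
    (C N : ℕ) (hN : h.v lim = N) (hX : N ≤ X) (hxl : lim ≠ x) (hx : c.wv x = false)
    (hl : c.wv lim = false) (h0 : I 0 (h.set x 0))
    (hs : ∀ j h1, j < N → Fr (.loop x lim c) h h1 → h1.v x = j → I j h1 →
      Tr X c h1.tick fun h2 => I (j + 1) (h2.set x (j + 1)) ∧ h2.time ≤ h1.time + C)
    (hq : ∀ h2, Fr (.loop x lim c) h h2 → I N h2 → h2.time ≤ h.time + 1 + (C + 1) * N →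
      Q h2.tick) : Tr X (.loop x lim c) h Q := by
  have hsub : ∀ h1, Fr (Cm.whl (.lt x lim) (c ;; x ≔ x + 1)) (h.set x 0) h1 →
      Fr (.loop x lim c) h h1 := by
    intro h1 H
    refine Fr.trans (h1 := h.set x 0) ⟨fun y hy => ?_, fun _ _ => rfl, fun _ => rfl⟩
      (H.sub ?_ ?_ ?_)
    · simp [Cm.loop, Cm.wv] at hy
      simp [hy]
    · simp +contextual [Cm.loop, Cm.wv]
    · simp +contextual [Cm.loop, Cm.wa]
    · simp +contextual [Cm.loop, Cm.wr]
  have hlim : ∀ h1, Fr (.loop x lim c) h h1 → h1.v lim = N := by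
    intro h1 H
    rw [H.v lim (by simp [Cm.loop, Cm.wv, hl, hxl]), hN]
  have e0 : (0 : Ex).ev h = 0 := rfl
  rw [Cm.loop, Tr_seq, Tr_asg]
  refine ⟨trivial, by simp, ?_⟩
  rw [e0]
  refine Tr_whl (fun h1 => h1.v x ≤ N ∧ I (h1.v x) h1) (fun h1 => N - h1.v x) (C + 1) ?_ ?_ ?_
  · simpa using h0
  · rintro h1 F ⟨hle, hI⟩
    refine ⟨⟨trivial, trivial⟩, fun hc => ?_⟩
    have hc' : h1.v x < N := by simpa [hlim h1 (hsub h1 F)] using hc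
    rw [Tr_seq]
    refine (hs (h1.v x) h1 hc' (hsub h1 F) rfl hI).mono fun h2 F2 hI2 => ?_
    have e2 : h2.v x = h1.v x := F2.v x hx
    rw [Tr_asg]
    have e3 : Ex.ev h2 (x + 1) = h1.v x + 1 := by
      show h2.v x + 1 = _
      rw [e2]
    refine ⟨⟨trivial, trivial⟩, by rw [e3]; omega, ?_⟩
    rw [e3]
    refine ⟨?_, ?_, ?_⟩
    · simpa using ⟨hc', hI2.1⟩
    · simp; omega
    · simp; omega
  · rintro h2 F ⟨hle, hI⟩ hc ht
    have hc' : ¬ h2.v x < N := by simpa [hlim h2 (hsub h2 F)] using hc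
    have hN' : h2.v x = N := by omega
    refine hq h2 (hsub h2 F) (by rwa [← hN']) ?_
    simpa using ht

/-! ### Parameters -/

/-- The parameters of the algorithm: input lengths, block parameter, binary logarithm. -/
structure Pm where
  n : ℕ
  m : ℕ
  q : ℕ
  l : ℕ

namespace Pm

def M (g : Pm) : ℕ := g.n + g.m
def b (g : Pm) : ℕ := g.q * g.q
def s (g : Pm) : ℕ := g.M / g.q + 1
def nb (g : Pm) : ℕ := g.m / g.b + 1
def kk (g : Pm) : ℕ := 2 * g.q + 2
def St (g : Pm) : ℕ := 2 * g.M + 8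
def C (g : Pm) : ℕ := g.b ^ g.b

/-- The choice of the parameters. -/
structure Good (g : Pm) : Prop where
  l1 : 2 ^ g.l ≤ g.M + 1
  l2 : g.M + 1 < 2 ^ (g.l + 1)
  q1 : 1 ≤ g.q
  q2 : g.q = 1 ∨ 4 * ((g.q * g.q) * (g.q * g.q)) ≤ g.l
  q3 : g.l < 4 * (((g.q + 1) * (g.q + 1)) * ((g.q + 1) * (g.q + 1)))

variable {g : Pm}

theorem Good.b_pos (H : g.Good) : 1 ≤ g.b := Nat.mul_pos H.q1 H.q1

/-- This is where the size of q matters: b ≤ 2^b gives C ≤ 2^(b·b), and 4·b·b = 4q⁴ ≤ l unless q =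
1. The fourth power leaves room for tables indexed by two codes, with extra factors for offset and
block length. -/
theorem Good.C_pow (H : g.Good) : g.C ^ 4 ≤ g.M + 1 := by
  rcases H.q2 with h | h
  · simp [C, b, h]
  · refine le_trans ?_ ((Nat.pow_le_pow_right (by norm_num) h).trans H.l1)
    have h1 : g.b ≤ 2 ^ g.b := Nat.lt_two_pow_self.le
    calc g.C ^ 4 ≤ ((2 ^ g.b) ^ g.b) ^ 4 := Nat.pow_le_pow_left (Nat.pow_le_pow_left h1 _) _
      _ = 2 ^ (4 * (g.b * g.b)) := by rw [← pow_mul, ← pow_mul]; ring_nf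
      _ = _ := by rw [b]

theorem Good.C_pos (H : g.Good) : 1 ≤ g.C := Nat.pow_pos H.b_pos

theorem Good.b_le_C (H : g.Good) : g.b ≤ g.C :=
  Nat.le_self_pow (by have := H.b_pos; omega) _

theorem Good.C_le (H : g.Good) : g.C ≤ g.M + 1 :=
  (Nat.le_self_pow (by norm_num) _).trans H.C_pow

/-- The factor 2 is needed only for b = 1, where C = 1. -/
theorem Good.two_pow_le (H : g.Good) : 2 ^ g.b ≤ 2 * g.C := by
  rcases Nat.lt_or_ge g.b 2 with h | h
  · have : g.b = 1 := by have := H.b_pos; omega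
    simp [C, this]
  · exact (Nat.pow_le_pow_left h _).trans (by simp [C]; omega)

theorem Good.q_le_b (H : g.Good) : g.q ≤ g.b := Nat.le_mul_of_pos_left _ H.q1

theorem Good.C_sq (H : g.Good) : g.C * g.C * (g.C * g.C) ≤ g.M + 1 := by
  have := H.C_pow
  nlinarith

theorem Good.l_le (H : g.Good) : g.l ≤ g.M := by
  have := H.l1
  have := @Nat.lt_two_pow_self g.l
  omega

theorem Good.M_le (H : g.Good) : g.M ≤ g.q * g.s := by
  have h1 := Nat.div_add_mod g.M g.q
  have h2 := Nat.mod_lt g.M H.q1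
  unfold s
  nlinarith

end Pm

/-- The initial part of the program: logarithm and block parameter. -/
def logC : Cm :=
  .M ≔ Var.n + Var.m ;;
  .l ≔ 0 ;; .pw ≔ 2 ;;
  .whl (.le Var.pw (Var.M + 1)) (.pw ≔ Var.pw * 2 ;; .l ≔ Var.l + 1) ;;
  .q ≔ 1 ;;
  .whl (.le (4 * (((Var.q + 1) * (Var.q + 1)) * ((Var.q + 1) * (Var.q + 1)))) Var.l)
    (.q ≔ Var.q + 1)

/-- Parameters that are given by formulas. -/
def constC : Cm :=
  .q1 ≔ Var.q + 1 ;; .L ≔ Var.l + 1 ;;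
  .b ≔ Var.q * Var.q ;; .s ≔ Var.M / Var.q + 1 ;; .nb ≔ Var.m / Var.b + 1 ;;
  .kk ≔ 2 * Var.q + 2 ;; .St ≔ 2 * Var.M + 8 ;;
  .Cc ≔ 1 ;; .P2 ≔ 1

/-- Powers. -/
def powC : Cm :=
  .loop .t .b (.sto .POWB Var.t Var.Cc ;; .sto .POW2 Var.t Var.P2 ;;
    .Cc ≔ Var.Cc * Var.b ;; .P2 ≔ Var.P2 * 2) ;;
  .B2 ≔ 2 * Var.b ;; .sz1 ≔ Var.Cc * Var.Cc * Var.B2 ;; .sz2 ≔ Var.Cc * Var.P2 * 2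

theorem logC_spec {X : ℕ} {h : St} (hX : (2 * (h.v .n + h.v .m) + 8) ^ 2 ≤ X) :
    Tr X logC h fun h' => ∃ g : Pm, g.Good ∧ g.n = h.v .n ∧ g.m = h.v .m ∧ h'.v .n = g.n ∧
      h'.v .m = g.m ∧ h'.v .M = g.M ∧ h'.v .l = g.l ∧ h'.v .q = g.q ∧
      h'.time ≤ h.time + 10 * (g.M + 1) := by
  set M := h.v .n + h.v .m with hM
  have hX1 : 16 * M + 64 ≤ X := by nlinarith
  unfold logC
  simp only [Tr_seq, Tr_asg]
  refine ⟨by simp, by simp; omega, by simp, by simp, by simp, by simp; omega, ?_⟩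
  refine Tr_whl (fun h1 => h1.v .pw = 2 ^ (h1.v .l + 1) ∧ 2 ^ (h1.v .l) ≤ M + 1)
    (fun h1 => M + 1 - h1.v .l) 3 (by simp) ?_ ?_
  · rintro h1 F ⟨e1, e2⟩
    have eM : h1.v .M = M := by rw [F.v .M rfl]; simp [hM]
    refine ⟨by simp, fun hc => ?_⟩
    have hc' : 2 ^ (h1.v .l + 1) ≤ M + 1 := by simpa [eM, e1] using hc
    have : h1.v .l + 1 < 2 ^ (h1.v .l + 1) := Nat.lt_two_pow_self
    simp only [Tr_seq, Tr_asg]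
    refine ⟨by simp, ?_, by simp, ?_, ?_, ?_, ?_⟩
    · simp [e1]; omega
    · simp; omega
    · simp [e1, pow_succ] at *; exact hc'
    · simp; omega
    · simp
  rintro h2 F2 ⟨e1, e2⟩ hc2 ht2
  have eM : h2.v .M = M := by rw [F2.v .M rfl]; simp [hM]
  have hc2' : M + 1 < 2 ^ (h2.v .l + 1) := by simpa [eM, e1] using hc2
  set l := h2.v .l with hl
  have hlM : l ≤ M := by
    have : l < 2 ^ l := Nat.lt_two_pow_self
    omega
  refine ⟨by simp, by simp; omega, ?_⟩
  -- The value q = 1 is never tested, whence the first alternative; every larger value has passed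
  -- the loop test. Increasing q one by one is affordable since q stays below M + 2.
  refine Tr_whl (fun h1 => 1 ≤ h1.v .q ∧ (h1.v .q = 1 ∨
    4 * ((h1.v .q * h1.v .q) * (h1.v .q * h1.v .q)) ≤ l)) (fun h1 => M + 1 - h1.v .q) 2 (by simp)
    ?_ ?_
  · rintro h1 F ⟨e3, e4⟩
    have el : h1.v .l = l := by rw [F.v .l rfl]; simp [hl]
    refine ⟨by simp, fun hc => ?_⟩
    have hc' : 4 * (((h1.v .q + 1) * (h1.v .q + 1)) * ((h1.v .q + 1) * (h1.v .q + 1))) ≤ l := by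
      simpa [el] using hc
    have : h1.v .q + 1 ≤ (h1.v .q + 1) * (h1.v .q + 1) := by nlinarith
    have : (h1.v .q + 1) * (h1.v .q + 1) ≤
      ((h1.v .q + 1) * (h1.v .q + 1)) * ((h1.v .q + 1) * (h1.v .q + 1)) := by nlinarith
    simp only [Tr_asg]
    refine ⟨by simp, ?_, ?_, ?_, ?_⟩
    · simp; omega
    · simp; exact Or.inr hc'
    · simp; omega
    · simp
  rintro h3 F3 ⟨e3, e4⟩ hc3 ht3
  have el3 : h3.v .l = l := by rw [F3.v .l rfl]; simp [hl]
  have hc3' : l < 4 * (((h3.v .q + 1) * (h3.v .q + 1)) * ((h3.v .q + 1) * (h3.v .q + 1))) := by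
    simpa [el3] using hc3
  have n3 : h3.v .n = h.v .n := by rw [F3.v .n rfl]; simp; rw [F2.v .n rfl]; simp
  have m3 : h3.v .m = h.v .m := by rw [F3.v .m rfl]; simp; rw [F2.v .m rfl]; simp
  have M3 : h3.v .M = M := by rw [F3.v .M rfl]; simp; rw [F2.v .M rfl]; simp [hM]
  refine ⟨⟨h.v .n, h.v .m, h3.v .q, l⟩, ⟨e2, hc2', e3, e4, hc3'⟩, rfl, rfl, n3, m3, M3, el3, rfl,
    ?_⟩
  simp [Pm.M, ← hM] at ht2 ht3 ⊢
  omega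

theorem constC_spec {X : ℕ} {h : St} {g : Pm} (G : g.Good) (hX : g.St ^ 2 ≤ X)
    (en : h.v .n = g.n) (em : h.v .m = g.m) (eM : h.v .M = g.M) (el : h.v .l = g.l)
    (eq : h.v .q = g.q) :
    Tr X constC h fun h' => h'.v .n = g.n ∧ h'.v .m = g.m ∧ h'.v .M = g.M ∧ h'.v .L = g.l + 1 ∧
      h'.v .q = g.q ∧ h'.v .q1 = g.q + 1 ∧ h'.v .b = g.b ∧ h'.v .s = g.s ∧ h'.v .nb = g.nb ∧
      h'.v .kk = g.kk ∧ h'.v .St = g.St ∧ h'.v .Cc = 1 ∧ h'.v .P2 = 1 ∧ h'.time = h.time + 9 := by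
  have hX1 : 16 * g.M + 64 ≤ X := by unfold Pm.St at hX; nlinarith
  have hlM := G.l_le
  have hC := G.C_le
  have hb := G.b_le_C
  have hqb := G.q_le_b
  have d1 : g.M / g.q ≤ g.M := Nat.div_le_self _ _
  have d2 : g.m / g.b ≤ g.M := (Nat.div_le_self _ _).trans (by unfold Pm.M; omega)
  have hbq : g.q * g.q = g.b := by rw [Pm.b]
  simp only [constC, Tr_seq, Tr_asg]
  simp [en, em, eM, el, eq, hbq]
  simp only [Pm.s, Pm.nb, Pm.kk, Pm.St, and_true]
  omega

theorem powC_spec {X : ℕ} {h : St} {g : Pm} (G : g.Good) (hX : g.St ^ 2 ≤ X)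
    (eb : h.v .b = g.b) (e1 : h.v .Cc = 1) (e2 : h.v .P2 = 1) :
    Tr X powC h fun h' => h'.v .Cc = g.C ∧ h'.v .P2 = 2 ^ g.b ∧ h'.v .B2 = 2 * g.b ∧
      h'.v .sz1 = g.C * g.C * (2 * g.b) ∧ h'.v .sz2 = g.C * 2 ^ g.b * 2 ∧
      (∀ t < g.b, h'.a .POWB t = g.b ^ t) ∧ (∀ t < g.b, h'.a .POW2 t = 2 ^ t) ∧
      h'.time ≤ h.time + 5 + 6 * g.b := by
  have hX1 : 16 * g.M + 64 ≤ X := by unfold Pm.St at hX; nlinarith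
  have hC := G.C_le
  have hb := G.b_le_C
  have hb1 := G.b_pos
  have hC4 := G.C_sq
  have h2b := G.two_pow_le
  have hsz1 : g.C * g.C * (2 * g.b) ≤ 2 * (g.M + 1) := by
    have : g.C * g.C * g.b ≤ g.C * g.C * (g.C * g.C) := Nat.mul_le_mul le_rfl (by nlinarith)
    nlinarith
  have hsz2 : g.C * 2 ^ g.b * 2 ≤ 4 * (g.M + 1) := by
    have : g.C * 2 ^ g.b ≤ g.C * (2 * g.C) := Nat.mul_le_mul le_rfl h2b
    have : g.C * g.C ≤ g.C * g.C * (g.C * g.C) :=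
      Nat.le_mul_of_pos_right _ (by nlinarith [G.C_pos])
    nlinarith
  simp only [powC, Tr_seq, Tr_asg]
  refine Tr_loop (fun j h1 => h1.v .Cc = g.b ^ j ∧ h1.v .P2 = 2 ^ j ∧
    (∀ t < j, h1.a .POWB t = g.b ^ t) ∧ ∀ t < j, h1.a .POW2 t = 2 ^ t) 5 g.b eb
    (by omega) (by decide) rfl rfl (by simp [e1, e2]) ?_ ?_
  · rintro j h1 hj F hjv ⟨i1, i2, i3, i4⟩
    have eb : h1.v .b = g.b := by rw [F.v .b rfl]; simp [eb]
    have b1 : g.b ^ (j + 1) ≤ g.C := Nat.pow_le_pow_right hb1 hj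
    have b2 : 2 ^ (j + 1) ≤ 2 ^ g.b := Nat.pow_le_pow_right (by norm_num) hj
    have b3 : g.b ^ j ≤ g.C := Nat.pow_le_pow_right hb1 hj.le
    have b4 : 2 ^ j ≤ 2 ^ g.b := Nat.pow_le_pow_right (by norm_num) hj.le
    simp only [Tr_seq, Tr_asg, Tr_sto]
    refine ⟨by simp, by simp, by simp [i1]; omega, by simp, by simp, by simp [i2]; omega,
      by simp, ?_, by simp, ?_, ⟨?_, ?_, ?_, ?_⟩, ?_⟩
    · simp [i1, eb, ← pow_succ]; omega
    · simp [i2, ← pow_succ]; omega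
    · simp [i1, eb, pow_succ]
    · simp [i2, pow_succ]
    · intro t ht
      simp [hjv, Function.update_apply, i1]
      split_ifs with h5
      · rw [h5]
      · exact i3 t (by omega)
    · intro t ht
      simp [hjv, Function.update_apply, i2]
      split_ifs with h5
      · rw [h5]
      · exact i4 t (by omega)
    · simp
  rintro h4 F4 ⟨i1, i2, i3, i4⟩ ht4
  have eb : h4.v .b = g.b := by rw [F4.v .b rfl]; simp [eb]
  have i1' : h4.v .Cc = g.C := i1
  simp [eb, i1', i2]
  exact ⟨by omega, by omega, by omega, i3, i4, by omega⟩

def paramC : Cm := logC ;; constC ;; powC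

/-- The state holds the parameters. -/
structure Par (g : Pm) (h : St) : Prop where
  en : h.v .n = g.n
  em : h.v .m = g.m
  eM : h.v .M = g.M
  eL : h.v .L = g.l + 1
  eq : h.v .q = g.q
  eq1 : h.v .q1 = g.q + 1
  eb : h.v .b = g.b
  es : h.v .s = g.s
  enb : h.v .nb = g.nb
  ekk : h.v .kk = g.kk
  eSt : h.v .St = g.St
  eC : h.v .Cc = g.C
  eP2 : h.v .P2 = 2 ^ g.b
  eB2 : h.v .B2 = 2 * g.b
  esz1 : h.v .sz1 = g.C * g.C * (2 * g.b)
  esz2 : h.v .sz2 = g.C * 2 ^ g.b * 2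
  powb : ∀ t < g.b, h.a .POWB t = g.b ^ t
  pow2 : ∀ t < g.b, h.a .POW2 t = 2 ^ t

theorem Par.fr {g : Pm} {h h' : St} {c : Cm} (P : Par g h) (F : Fr c h h')
    (hv : ∀ x ∈ [Var.n, .m, .M, .L, .q, .q1, .b, .s, .nb, .kk, .St, .Cc, .P2, .B2, .sz1, .sz2],
      c.wv x = false := by decide)
    (ha : ∀ x ∈ [Arr.POWB, .POW2], c.wa x = false := by decide) : Par g h' := by
  have e1 : ∀ x ∈ [Var.n, .m, .M, .L, .q, .q1, .b, .s, .nb, .kk, .St, .Cc, .P2, .B2, .sz1, .sz2],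
    h'.v x = h.v x := fun x hx => F.v x (hv x hx)
  have e2 : ∀ x ∈ [Arr.POWB, .POW2], h'.a x = h.a x := fun x hx => F.a x (ha x hx)
  obtain ⟨⟩ := P
  constructor <;> first
    | (rw [e1 _ (by decide)]; assumption)
    | (rw [e2 _ (by decide)]; assumption)

theorem Par.tick {g : Pm} {h : St} (P : Par g h) : Par g h.tick := by
  obtain ⟨⟩ := P; constructor <;> assumption

theorem Par.set {g : Pm} {h : St} (P : Par g h) (x : Var) (k : ℕ)
    (hx : x ∉ [Var.n, .m, .M, .L, .q, .q1, .b, .s, .nb, .kk, .St, .Cc, .P2, .B2, .sz1, .sz2] := by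
      decide) : Par g (h.set x k) :=
  P.fr (c := x ≔ .c k) ⟨fun y hy => by simp [Cm.wv] at hy; simp [hy], fun _ _ => rfl, fun _ => rfl⟩
    (fun y hy => decide_eq_false fun e => hx (e ▸ hy)) (fun _ _ => rfl)

theorem paramC_spec {X : ℕ} {h : St} (hX : (2 * (h.v .n + h.v .m) + 8) ^ 2 ≤ X) :
    Tr X paramC h fun h' => ∃ g : Pm, g.Good ∧ g.n = h.v .n ∧ g.m = h.v .m ∧ Par g h' ∧
      h'.time ≤ h.time + 40 * (g.M + 1) := by
  simp only [paramC, Tr_seq]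
  refine (logC_spec hX).mono ?_
  rintro h1 F1 ⟨g, G, gn, gm, a1, a2, a3, a4, a5, t1⟩
  have hX' : g.St ^ 2 ≤ X := by rw [Pm.St, Pm.M, gn, gm]; exact hX
  refine (constC_spec G hX' a1 a2 a3 a4 a5).mono ?_
  rintro h2 F2 ⟨b1, b2, b3, b4, b5, b6, b7, b8, b9, b10, b11, b12, b13, t2⟩
  refine (powC_spec G hX' b7 b12 b13).mono ?_
  rintro h3 F3 ⟨c1, c2, c3, c4, c5, c6, c7, t3⟩
  refine ⟨g, G, gn, gm, ?_, ?_⟩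
  · constructor <;> first | assumption | (rw [F3.v _ rfl]; assumption)
  · have := G.C_le
    have := G.b_le_C
    omega

/-! ### Merge sort -/

/-- The runs of length `w` of the first `M` entries of `S` are sorted. -/
def RunSorted (key : ℕ → ℤ) (S : ℕ → ℕ) (M w : ℕ) : Prop :=
  ∀ c t t', c * w ≤ t → t < t' → t' < (c + 1) * w → t' < M → key (S t) ≤ key (S t')

/-- Progress of the merge of `[lo, mid)` and `[mid, hi)`: `o` entries are written. -/
structure MergeInv (key : ℕ → ℤ) (M w : ℕ) (S S2 : ℕ → ℕ) (c o i mid j hi : ℕ) : Prop where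
  mid_eq : mid = min (c * (2 * w) + w) M
  hi_eq : hi = min (c * (2 * w) + 2 * w) M
  loi : c * (2 * w) ≤ i
  imid : i ≤ mid
  midj : mid ≤ j
  jhi : j ≤ hi
  sum : i + j = o + mid
  sorted : RunSorted key S2 o (2 * w)
  lt : ∀ t < o, S2 t < M
  le1 : ∀ t, c * (2 * w) ≤ t → t < o → ∀ u, i ≤ u → u < mid → key (S2 t) ≤ key (S u)
  le2 : ∀ t, c * (2 * w) ≤ t → t < o → ∀ u, j ≤ u → u < hi → key (S2 t) ≤ key (S u)
  cov : ∀ u, u < i ∨ (mid ≤ u ∧ u < j) → ∃ t < o, S2 t = S u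

/-- The appended entry falls into run c, so only entries from c·2w on can share a run with it. -/
theorem RunSorted.update {key : ℕ → ℤ} {w : ℕ} {S2 : ℕ → ℕ} {c o v : ℕ}
    (h : RunSorted key S2 o (2 * w)) (h1 : c * (2 * w) ≤ o) (h2 : o < c * (2 * w) + 2 * w)
    (h3 : ∀ t, c * (2 * w) ≤ t → t < o → key (S2 t) ≤ key v) :
    RunSorted key (Function.update S2 o v) (o + 1) (2 * w) := by
  intro c' t t' a1 a2 a3 a4
  rw [Function.update_of_ne (by omega : t ≠ o)]
  rcases Nat.lt_or_ge t' o with h5 | h5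
  · rw [Function.update_of_ne (by omega)]
    exact h c' t t' a1 a2 a3 h5
  · obtain rfl : t' = o := by omega
    rw [Function.update_self]
    refine h3 t ?_ a2
    have : c < c' + 1 := Nat.lt_of_mul_lt_mul_right (a := 2 * w) (by omega)
    exact (Nat.mul_le_mul_right _ (by omega)).trans a1

/-- The head S i is a minimum of all unread entries: its own run is sorted, and it is at most the
head of the other run if that run is not exhausted. Thus everything written to the current output
run stays below everything unread. -/
theorem MergeInv.step_left {key : ℕ → ℤ} {M w : ℕ} {S S2 : ℕ → ℕ} {c o i mid j hi : ℕ}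
    (H : MergeInv key M w S S2 c o i mid j hi) (hS : RunSorted key S M w) (hM : ∀ t < M, S t < M)
    (hi' : i < mid) (hle : hi ≤ j ∨ key (S i) ≤ key (S j)) :
    MergeInv key M w S (Function.update S2 o (S i)) c (o + 1) (i + 1) mid j hi := by
  obtain ⟨e1, e2, e3, e4, e5, e6, e7, e8, e9, e10, e11, e12⟩ := H
  -- Output run c is merged from the input runs 2c and 2c + 1.
  have k1 : 2 * c * w = c * (2 * w) := by ring
  have k2 : (2 * c + 1) * w = c * (2 * w) + w := by ring
  have k3 : (2 * c + 1 + 1) * w = c * (2 * w) + 2 * w := by ring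
  have mono1 : ∀ u, i ≤ u → u < mid → key (S i) ≤ key (S u) := by
    intro u h1 h2
    rcases h1.eq_or_lt with rfl | h1
    · exact le_rfl
    · exact hS (2 * c) i u (by omega) h1 (by rw [k2]; omega) (by omega)
  have mono2 : ∀ u, j ≤ u → u < hi → key (S i) ≤ key (S u) := by
    intro u h1 h2
    rcases hle with h | h
    · omega
    rcases h1.eq_or_lt with rfl | h1
    · exact h
    · exact h.trans (hS (2 * c + 1) j u (by rw [k2]; omega) h1 (by rw [k3]; omega) (by omega))
  refine ⟨e1, e2, by omega, by omega, e5, e6, by omega, ?_, ?_, ?_, ?_, ?_⟩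
  · exact e8.update (c := c) (by omega) (by omega) fun t h1 h2 => e10 t h1 h2 i le_rfl hi'
  · intro t ht
    rw [Function.update_apply]
    split_ifs
    · exact hM _ (by omega)
    · exact e9 t (by omega)
  · intro t h1 h2 u h3 h4
    rw [Function.update_apply]
    split_ifs
    · exact mono1 u (by omega) h4
    · exact e10 t h1 (by omega) u (by omega) h4
  · intro t h1 h2 u h3 h4
    rw [Function.update_apply]
    split_ifs
    · exact mono2 u h3 h4
    · exact e11 t h1 (by omega) u h3 h4
  · intro u hu
    by_cases h : u = i
    · exact ⟨o, by omega, by simp [h]⟩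
    · obtain ⟨t, h1, h2⟩ := e12 u (by omega)
      exact ⟨t, by omega, by rw [Function.update_of_ne (by omega), h2]⟩

theorem MergeInv.step_right {key : ℕ → ℤ} {M w : ℕ} {S S2 : ℕ → ℕ} {c o i mid j hi : ℕ}
    (H : MergeInv key M w S S2 c o i mid j hi) (hS : RunSorted key S M w) (hM : ∀ t < M, S t < M)
    (hj : j < hi) (hle : mid ≤ i ∨ key (S j) ≤ key (S i)) :
    MergeInv key M w S (Function.update S2 o (S j)) c (o + 1) i mid (j + 1) hi := by
  obtain ⟨e1, e2, e3, e4, e5, e6, e7, e8, e9, e10, e11, e12⟩ := H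
  have k1 : 2 * c * w = c * (2 * w) := by ring
  have k2 : (2 * c + 1) * w = c * (2 * w) + w := by ring
  have k3 : (2 * c + 1 + 1) * w = c * (2 * w) + 2 * w := by ring
  have mono1 : ∀ u, i ≤ u → u < mid → key (S j) ≤ key (S u) := by
    intro u h1 h2
    rcases hle with h | h
    · omega
    rcases h1.eq_or_lt with rfl | h1
    · exact h
    · exact h.trans (hS (2 * c) i u (by omega) h1 (by rw [k2]; omega) (by omega))
  have mono2 : ∀ u, j ≤ u → u < hi → key (S j) ≤ key (S u) := by
    intro u h1 h2
    rcases h1.eq_or_lt with rfl | h1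
    · exact le_rfl
    · exact hS (2 * c + 1) j u (by rw [k2]; omega) h1 (by rw [k3]; omega) (by omega)
  refine ⟨e1, e2, e3, e4, by omega, by omega, by omega, ?_, ?_, ?_, ?_, ?_⟩
  · exact e8.update (c := c) (by omega) (by omega) fun t h1 h2 => e11 t h1 h2 j le_rfl hj
  · intro t ht
    rw [Function.update_apply]
    split_ifs
    · exact hM _ (by omega)
    · exact e9 t (by omega)
  · intro t h1 h2 u h3 h4
    rw [Function.update_apply]
    split_ifs
    · exact mono1 u h3 h4
    · exact e10 t h1 (by omega) u h3 h4
  · intro t h1 h2 u h3 h4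
    rw [Function.update_apply]
    split_ifs
    · exact mono2 u (by omega) h4
    · exact e11 t h1 (by omega) u (by omega) h4
  · intro u hu
    by_cases h : u = j
    · exact ⟨o, by omega, by simp [h]⟩
    · obtain ⟨t, h1, h2⟩ := e12 u (by omega)
      exact ⟨t, by omega, by rw [Function.update_of_ne (by omega), h2]⟩

/-- State of a merging pass between two steps. -/
structure PassInv (key : ℕ → ℤ) (M w : ℕ) (S S2 : ℕ → ℕ) (o i mid j hi : ℕ) : Prop where
  sorted : RunSorted key S2 o (2 * w)
  lt : ∀ t < o, S2 t < M
  prog : (hi = o ∧ (∀ u < o, ∃ t < o, S2 t = S u) ∧ ((∃ c, o = c * (2 * w)) ∨ o = M)) ∨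
    (o < hi ∧ ∃ c, MergeInv key M w S S2 c o i mid j hi)

/-- A pair of runs is exhausted exactly when o reaches hi, and then o is the start of the next pair
or the end of the array. This allows a whole pass to be a single loop over o. -/
theorem MergeInv.pass {key : ℕ → ℤ} {M w : ℕ} {S S2 : ℕ → ℕ} {c o i mid j hi : ℕ}
    (H : MergeInv key M w S S2 c o i mid j hi) : PassInv key M w S S2 o i mid j hi := by
  refine ⟨H.sorted, H.lt, ?_⟩
  have h1 := H.sum
  have h2 := H.imid
  have h3 := H.midj
  have h4 := H.jhi
  rcases Nat.lt_or_ge o hi with h | h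
  · exact Or.inr ⟨h, c, H⟩
  · have h5 := H.hi_eq
    refine Or.inl ⟨by omega, fun u hu => H.cov u (by omega), ?_⟩
    by_cases h6 : c * (2 * w) + 2 * w ≤ M
    · exact Or.inl ⟨c + 1, by rw [add_mul]; omega⟩
    · exact Or.inr (by omega)

/-- One step of a merging pass. -/
def mergeStep : Cm :=
  .ite (.eq Var.hi Var.o)
    (.i ≔ Var.o ;; .ite (.le Var.M (Var.o + Var.w)) (.mid ≔ Var.M) (.mid ≔ Var.o + Var.w) ;;
      .j ≔ Var.mid ;;
      .ite (.le Var.M (Var.o + 2 * Var.w)) (.hi ≔ Var.M) (.hi ≔ Var.o + 2 * Var.w))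
    .skip ;;
  .ite (.le Var.hi Var.j) (.sto .S2 Var.o (Arr.S Var.i) ;; .i ≔ Var.i + 1)
    (.ite (.le Var.mid Var.i) (.sto .S2 Var.o (Arr.S Var.j) ;; .j ≔ Var.j + 1)
      (.ite (.rlt (Arr.S Var.j) (Arr.S Var.i)) (.sto .S2 Var.o (Arr.S Var.j) ;; .j ≔ Var.j + 1)
        (.sto .S2 Var.o (Arr.S Var.i) ;; .i ≔ Var.i + 1)))

theorem mergeStep_spec {X : ℕ} {h : St} {M w o : ℕ} (eM : h.v .M = M) (ew : h.v .w = w)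
    (eo : h.v .o = o) (ho : o < M) (hw : 1 ≤ w) (hX : 16 * M + 64 ≤ X)
    (hS : RunSorted h.raw (h.a .S) M w) (hM : ∀ t < M, h.a .S t < M)
    (hI : PassInv h.raw M w (h.a .S) (h.a .S2) o (h.v .i) (h.v .mid) (h.v .j) (h.v .hi)) :
    Tr X mergeStep h fun h' =>
      PassInv h.raw M w (h.a .S) (h'.a .S2) (o + 1) (h'.v .i) (h'.v .mid) (h'.v .j) (h'.v .hi) ∧
        h'.time ≤ h.time + 12 := by
  unfold mergeStep
  rw [Tr_seq]
  -- When o has reached hi, the next pair of runs is opened. None of its entries is written yet, so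
  -- the comparison clauses of the invariant hold vacuously.
  have first : Tr X (.ite (.eq Var.hi Var.o)
      (.i ≔ Var.o ;; .ite (.le Var.M (Var.o + Var.w)) (.mid ≔ Var.M) (.mid ≔ Var.o + Var.w) ;;
        .j ≔ Var.mid ;;
        .ite (.le Var.M (Var.o + 2 * Var.w)) (.hi ≔ Var.M) (.hi ≔ Var.o + 2 * Var.w))
      .skip) h fun h' => (∃ c, MergeInv h.raw M w (h.a .S) (h.a .S2) c o (h'.v .i) (h'.v .mid)
        (h'.v .j) (h'.v .hi)) ∧ o < h'.v .hi ∧ h'.time ≤ h.time + 7 := by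
    simp only [Tr_ite, Tr_seq, Tr_asg, Tr_skip]
    refine ⟨by simp, fun hc => ?_, fun hc => ?_⟩
    · have hc' : h.v .hi = o := by simpa [eo] using hc
      obtain ⟨hp, c, hc2⟩ : (∀ u < o, ∃ t < o, h.a .S2 t = h.a .S u) ∧ ∃ c, o = c * (2 * w) := by
        rcases hI.prog with ⟨h1, h2, h3 | h3⟩ | h1
        · exact ⟨h2, h3⟩
        · omega
        · omega
      have key : ∀ mid hi, mid = min (o + w) M → hi = min (o + 2 * w) M →
          MergeInv h.raw M w (h.a .S) (h.a .S2) c o o mid mid hi := by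
        intro mid hi e1 e2
        exact ⟨by omega, by omega, by omega, by omega, by omega, by omega, by omega, hI.sorted,
          hI.lt, fun t h1 h2 => by omega, fun t h1 h2 => by omega,
          fun u hu => hp u (by omega)⟩
      simp [eo, eM, ew]
      refine ⟨by omega, ?_, ?_⟩ <;> intro h1 <;> refine ⟨by omega, fun h2 => ?_, fun h2 => ?_⟩
      · exact ⟨by omega, ⟨c, key _ _ (by omega) (by omega)⟩, by omega⟩
      · exact ⟨by omega, ⟨c, key _ _ (by omega) (by omega)⟩, by omega⟩
      · exact ⟨by omega, ⟨c, key _ _ (by omega) (by omega)⟩, by omega⟩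
      · exact ⟨by omega, ⟨c, key _ _ (by omega) (by omega)⟩, by omega⟩
    · have hc' : ¬ h.v .hi = o := by simpa [eo] using hc
      rcases hI.prog with ⟨h1, _⟩ | ⟨h1, c, H⟩
      · omega
      · exact ⟨⟨c, H⟩, h1, by simp⟩
  refine first.mono ?_
  rintro h1 F ⟨⟨c, H⟩, hlt, ht⟩
  have eS : h1.a .S = h.a .S := F.a _ rfl
  have eS2 : h1.a .S2 = h.a .S2 := F.a _ rfl
  have eo1 : h1.v .o = o := by rw [F.v _ rfl, eo]
  have er : h1.raw = h.raw := F.raw rfl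
  have b1 := H.sum
  have b2 := H.imid
  have b3 := H.midj
  have b4 := H.jhi
  have b5 := H.hi_eq
  have b6 := H.mid_eq
  have left : h1.v .i < h1.v .mid → (h1.v .hi ≤ h1.v .j ∨
      h.raw (h.a .S (h1.v .i)) ≤ h.raw (h.a .S (h1.v .j))) →
      PassInv h.raw M w (h.a .S) (Function.update (h.a .S2) o (h.a .S (h1.v .i))) (o + 1)
        (h1.v .i + 1) (h1.v .mid) (h1.v .j) (h1.v .hi) ∧ h.a .S (h1.v .i) < M ∧ h1.v .i < M :=
    fun a1 a2 => ⟨(H.step_left hS hM a1 a2).pass, hM _ (by omega), by omega⟩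
  have right : h1.v .j < h1.v .hi → (h1.v .mid ≤ h1.v .i ∨
      h.raw (h.a .S (h1.v .j)) ≤ h.raw (h.a .S (h1.v .i))) →
      PassInv h.raw M w (h.a .S) (Function.update (h.a .S2) o (h.a .S (h1.v .j))) (o + 1)
        (h1.v .i) (h1.v .mid) (h1.v .j + 1) (h1.v .hi) ∧ h.a .S (h1.v .j) < M ∧ h1.v .j < M :=
    fun a1 a2 => ⟨(H.step_right hS hM a1 a2).pass, hM _ (by omega), by omega⟩
  simp only [Tr_ite, Tr_seq, Tr_asg, Tr_sto]
  simp [eS, eS2, eo1, er]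
  refine ⟨fun a1 => ?_, fun a1 => ⟨fun a2 => ?_, fun a2 => ⟨fun a3 => ?_, fun a3 => ?_⟩⟩⟩
  · obtain ⟨p1, p2, p3⟩ := left (by omega) (Or.inl a1)
    exact ⟨by omega, by omega, p1, by omega⟩
  · obtain ⟨p1, p2, p3⟩ := right (by omega) (Or.inl a2)
    exact ⟨by omega, by omega, p1, by omega⟩
  · obtain ⟨p1, p2, p3⟩ := right (by omega) (Or.inr a3.le)
    exact ⟨by omega, by omega, p1, by omega⟩
  · obtain ⟨p1, p2, p3⟩ := left (by omega) (Or.inr a3)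
    exact ⟨by omega, by omega, p1, by omega⟩

/-- Sorting of the positions of the raw cells below `M` by their contents. -/
def sortC : Cm :=
  .loop .t .M (.sto .S Var.t Var.t) ;;
  .w ≔ 1 ;;
  .loop .r .L (.hi ≔ 0 ;; .loop .o .M mergeStep ;; .loop .t .M (.sto .S Var.t (Arr.S2 Var.t)) ;;
    .w ≔ Var.w * 2)

/-- `S` enumerates the positions below `M` in the order of their keys. -/
structure Sorts (key : ℕ → ℤ) (M : ℕ) (S : ℕ → ℕ) : Prop where
  lt : ∀ t < M, S t < M
  surj : ∀ p < M, ∃ t < M, S t = p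
  mono : ∀ t t', t ≤ t' → t' < M → key (S t) ≤ key (S t')

theorem sortC_spec {X : ℕ} {h : St} {g : Pm} (G : g.Good) (hX : g.St ^ 2 ≤ X) (P : Par g h) :
    Tr X sortC h fun h' => Sorts h.raw g.M (h'.a .S) ∧
      h'.time ≤ h.time + 24 * (g.l + 2) * (g.M + 1) := by
  have hX1 : 16 * g.M + 64 ≤ X := by unfold Pm.St at hX; nlinarith
  have hlM := G.l_le
  unfold sortC
  rw [Tr_seq]
  refine Tr_loop (fun j h1 => ∀ t < j, h1.a .S t = t) 2 g.M P.eM (by omega) (by decide) rfl rfl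
    (by simp) ?_ ?_
  · intro j h1 hj F hjv hI
    rw [Tr_sto]
    simp [hjv]
    refine ⟨by omega, fun t ht => ?_⟩
    rw [Function.update_apply]
    split_ifs with h2
    · exact h2.symm
    · exact hI t (by omega)
  rintro h1 F1 hI1 ht1
  simp only [Tr_seq, Tr_asg]
  refine ⟨by simp, by simp; omega, ?_⟩
  have P1 : Par g h1 := P.fr F1
  -- After j passes the runs of length 2^j are sorted, and l + 1 passes suffice because M + 1 <
  -- 2^(l+1). A pass costs 14 per merged and 3 per copied entry.
  refine Tr_loop (fun j h2 => h2.v .w = 2 ^ j ∧ (∀ t < g.M, h2.a .S t < g.M) ∧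
    (∀ p < g.M, ∃ t < g.M, h2.a .S t = p) ∧ RunSorted h.raw (h2.a .S) g.M (2 ^ j))
    (17 * g.M + 12) (g.l + 1) ?_ (by omega) (by decide) rfl rfl ⟨by simp, ?_, ?_, ?_⟩ ?_ ?_
  · simpa using P1.eL
  · intro t ht
    simp [hI1 t ht, ht]
  · intro p hp
    exact ⟨p, hp, by simp [hI1 p hp]⟩
  · intro c t t' a1 a2 a3 a4
    omega
  · rintro j h2 hj F2 hjv ⟨ew, i1, i2, i3⟩
    have P2 : Par g h2 := (P1.tick.set _ _).fr F2
    have r2 : h2.raw = h.raw := by rw [F2.raw rfl]; simp; rw [F1.raw rfl]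
    have hwX : 2 ^ (j + 1) ≤ 2 * (g.M + 1) :=
      (Nat.pow_le_pow_right (by norm_num) (show j + 1 ≤ g.l + 1 by omega)).trans
        (by rw [pow_succ]; have := G.l1; omega)
    simp only [Tr_seq, Tr_asg]
    refine ⟨by simp, by simp, ?_⟩
    refine Tr_loop (fun o h3 => PassInv h.raw g.M (2 ^ j) (h2.a .S) (h3.a .S2) o (h3.v .i)
      (h3.v .mid) (h3.v .j) (h3.v .hi)) 13 g.M (by simpa using P2.eM) (by omega) (by decide) rfl
      rfl ?_ ?_ ?_
    · refine ⟨fun c t t' _ _ _ h => by omega, fun t h => by omega,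
        Or.inl ⟨by simp, fun u h => by omega, Or.inl ⟨0, by simp⟩⟩⟩
    · rintro o h3 ho F3 hov hI
      have r3 : h3.raw = h.raw := by rw [F3.raw rfl]; simpa using r2
      have s3 : h3.a .S = h2.a .S := by rw [F3.a _ rfl]; simp
      refine (mergeStep_spec (h := h3.tick) (M := g.M) (w := 2 ^ j) (o := o) ?_ ?_ hov ho
        Nat.one_le_two_pow hX1 ?_ ?_ ?_).mono ?_
      · simp; rw [F3.v _ rfl]; simpa using P2.eM
      · simp; rw [F3.v _ rfl]; simpa using ew
      · simpa [r3, s3] using i3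
      · simpa [s3] using i1
      · simpa [r3, s3] using hI
      · rintro h4 F4 ⟨hI4, ht4⟩
        simp [r3, s3] at hI4 ht4 ⊢
        exact ⟨hI4, by omega⟩
    rintro h3 F3 hI3 ht3
    have P3 : h3.v .M = g.M := by rw [F3.v _ rfl]; simpa using P2.eM
    obtain ⟨q1, q2, q3⟩ : RunSorted h.raw (h3.a .S2) g.M (2 * 2 ^ j) ∧ (∀ t < g.M, h3.a .S2 t < g.M) ∧
        ∀ u < g.M, ∃ t < g.M, h3.a .S2 t = h2.a .S u := by
      refine ⟨hI3.sorted, hI3.lt, ?_⟩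
      rcases hI3.prog with ⟨_, p, _⟩ | ⟨p, c, H⟩
      · exact p
      · have := H.hi_eq
        omega
    refine Tr_loop (fun k h4 => ∀ t < k, h4.a .S t = h3.a .S2 t) 2 g.M (by simpa using P3) (by omega)
      (by decide) rfl rfl (by simp) ?_ ?_
    · intro k h4 hk F4 hkv hI
      have e4 : h4.a .S2 = h3.a .S2 := by rw [F4.a _ rfl]; simp
      rw [Tr_sto]
      have := q2 k hk
      simp [hkv, e4]
      refine ⟨by omega, fun t ht => ?_⟩
      rw [Function.update_apply]
      split_ifs with h2
      · rw [h2]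
      · exact hI t (by omega)
    rintro h4 F4 hI4 ht4
    have w4 : h4.v .w = 2 ^ j := by rw [F4.v _ rfl]; simp; rw [F3.v _ rfl]; simpa using ew
    have hw1 : h4.v .w * 2 = 2 ^ (j + 1) := by rw [w4, pow_succ]
    refine ⟨by simp, by simp; omega, ⟨?_, ?_, ?_, ?_⟩, ?_⟩
    · simpa using hw1
    · intro t ht
      simpa [hI4 t ht] using q2 t ht
    · intro p hp
      obtain ⟨u, hu, rfl⟩ := i2 p hp
      obtain ⟨t, ht, e⟩ := q3 u hu
      exact ⟨t, ht, by simpa [hI4 t ht] using e⟩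
    · intro c t t' a1 a2 a3 a4
      have := q1 c t t' (by rwa [mul_comm 2, ← pow_succ]) a2 (by rwa [mul_comm 2, ← pow_succ]) a4
      simpa [hI4 t (by omega), hI4 t' a4] using this
    · simp at ht3 ht4 ⊢
      omega
  rintro h2 F2 ⟨ew, i1, i2, i3⟩ ht2
  refine ⟨⟨i1, i2, fun t t' h1 h2 => ?_⟩, ?_⟩
  · rcases h1.eq_or_lt with rfl | h1
    · exact le_rfl
    · exact i3 0 t t' (by simp) h1 (by have := G.l2; omega) h2
  · simp at ht1 ht2 ⊢
    nlinarith

/-! ### Ranks, pivots and groups -/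

theorem Sorts.inj {key : ℕ → ℤ} {M : ℕ} {S : ℕ → ℕ} (H : Sorts key M S) {t t' : ℕ} (ht : t < M)
    (ht' : t' < M) (h : S t = S t') : t = t' := by
  let f : Fin M → Fin M := fun t => ⟨S t, H.lt t t.2⟩
  have hf : Function.Surjective f := fun p => by
    obtain ⟨t, h1, h2⟩ := H.surj p p.2
    exact ⟨⟨t, h1⟩, Fin.ext h2⟩
  have := Finite.injective_iff_surjective.2 hf (a₁ := ⟨t, ht⟩) (a₂ := ⟨t', ht'⟩) (Fin.ext h)
  simpa using this

/-- `rk` replaces each key by the first index of an equal key in the sorted order. -/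
structure Ranked (key : ℕ → ℤ) (M : ℕ) (S rk : ℕ → ℕ) : Prop where
  sorts : Sorts key M S
  le : ∀ t < M, rk (S t) ≤ t
  key_eq : ∀ t < M, key (S (rk (S t))) = key (S t)
  key_lt : ∀ t < M, ∀ u < rk (S t), key (S u) < key (S t)

namespace Ranked

variable {key : ℕ → ℤ} {M : ℕ} {S rk : ℕ → ℕ}

/-- Ranks compare like keys, and since both orders are total they also agree on equality. From here
on symbols may be treated as numbers below M. -/
theorem lt_iff (H : Ranked key M S rk) {p p' : ℕ} (hp : p < M) (hp' : p' < M) :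
    rk p < rk p' ↔ key p < key p' := by
  obtain ⟨t, ht, rfl⟩ := H.sorts.surj p hp
  obtain ⟨t', ht', rfl⟩ := H.sorts.surj p' hp'
  constructor
  · intro h
    have := H.key_lt t' ht' _ h
    rwa [H.key_eq t ht] at this
  · intro h
    by_contra hc
    push Not at hc
    have := H.sorts.mono _ _ hc ((H.le t ht).trans_lt ht)
    rw [H.key_eq t ht, H.key_eq t' ht'] at this
    omega

theorem lt (H : Ranked key M S rk) {p : ℕ} (hp : p < M) : rk p < M := by
  obtain ⟨t, ht, rfl⟩ := H.sorts.surj p hp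
  exact (H.le t ht).trans_lt ht

theorem mono (H : Ranked key M S rk) {t t' : ℕ} (h : t ≤ t') (h' : t' < M) :
    rk (S t) ≤ rk (S t') := by
  by_contra hc
  push Not at hc
  have := (H.lt_iff (H.sorts.lt _ h') (H.sorts.lt t (by omega))).1 hc
  have := H.sorts.mono t t' h h'
  omega

theorem self (H : Ranked key M S rk) {p : ℕ} (hp : p < M) : rk (S (rk p)) = rk p := by
  obtain ⟨t, ht, rfl⟩ := H.sorts.surj p hp
  have h1 : S (rk (S t)) < M := H.sorts.lt _ (H.lt hp)
  have h2 := H.key_eq t ht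
  have h3 := H.lt_iff h1 hp
  have h4 := H.lt_iff hp h1
  omega

end Ranked

def rankC : Cm :=
  .cur ≔ 0 ;;
  .loop .t .M (
    .ite (.eq Var.t 0) .skip
      (.ite (.rlt (Arr.S (Var.t - 1)) (Arr.S Var.t)) (.cur ≔ Var.t) .skip) ;;
    .sto .RK (Arr.S Var.t) Var.cur)

theorem rankC_spec {X : ℕ} {h : St} {g : Pm} (hX : g.St ^ 2 ≤ X) (P : Par g h)
    (hS : Sorts h.raw g.M (h.a .S)) :
    Tr X rankC h fun h' => Ranked h.raw g.M (h.a .S) (h'.a .RK) ∧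
      h'.time ≤ h.time + 7 * (g.M + 1) := by
  have hX1 : 16 * g.M + 64 ≤ X := by unfold Pm.St at hX; nlinarith
  set S := h.a .S with hSd
  set key := h.raw with hkey
  unfold rankC
  rw [Tr_seq, Tr_asg]
  refine ⟨by simp, by simp, ?_⟩
  -- `cur` is the first sorted index whose key equals that of index j - 1; it moves to j only when
  -- the key jumps there.
  refine Tr_loop (fun j h1 => (h1.v .cur ≤ j ∧ (j ≠ 0 → h1.v .cur ≤ j - 1 ∧
      key (S (h1.v .cur)) = key (S (j - 1)) ∧ ∀ u < h1.v .cur, key (S u) < key (S (j - 1)))) ∧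
    ∀ t < j, h1.a .RK (S t) ≤ t ∧ key (S (h1.a .RK (S t))) = key (S t) ∧
      ∀ u < h1.a .RK (S t), key (S u) < key (S t)) 6 g.M (by simpa using P.eM) (by omega)
    (by decide) rfl rfl (by simp) ?_ ?_
  · rintro j h1 hj F hjv ⟨⟨i0, i1⟩, i2⟩
    have eS : h1.a .S = S := by rw [F.a _ rfl]; simp [hSd]
    have ek : h1.raw = key := by rw [F.raw rfl]; simp [hkey]
    rw [Tr_seq]
    have first : Tr X (.ite (.eq Var.t 0) .skip
        (.ite (.rlt (Arr.S (Var.t - 1)) (Arr.S Var.t)) (.cur ≔ Var.t) .skip)) h1.tick fun h2 =>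
        h2.v .cur ≤ j ∧ key (S (h2.v .cur)) = key (S j) ∧
          (∀ u < h2.v .cur, key (S u) < key (S j)) ∧ h2.time ≤ h1.time + 4 := by
      simp only [Tr_ite, Tr_asg, Tr_skip]
      simp [hjv, eS, ek]
      refine ⟨fun h0 => ?_, fun h0 => ⟨by omega, fun h2 => ⟨by omega, fun u hu => ?_⟩,
        fun h2 => ?_⟩⟩
      · subst h0
        have : h1.v .cur = 0 := by omega
        simp [this]
      · exact (hS.mono u (j - 1) (by omega) (by omega)).trans_lt h2
      · obtain ⟨i3, i4, i5⟩ := i1 h0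
        have e : key (S (j - 1)) = key (S j) := le_antisymm (hS.mono _ _ (by omega) hj) h2
        exact ⟨by omega, by rw [i4, e], fun u hu => by rw [← e]; exact i5 u hu⟩
    refine first.mono ?_
    rintro h2 F2 ⟨b1, b2, b3, b4⟩
    have eS2 : h2.a .S = S := by rw [F2.a _ rfl]; simpa using eS
    have et : h2.v .t = j := by rw [F2.v _ rfl]; simpa using hjv
    have eR : h2.a .RK = h1.a .RK := by rw [F2.a _ rfl]; simp
    rw [Tr_sto]
    simp [eS2, et, eR]
    refine ⟨by omega, ⟨⟨by omega, b1, b2, b3⟩, fun t ht => ?_⟩, by omega⟩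
    rw [Function.update_apply]
    split_ifs with h3
    · obtain rfl : t = j := hS.inj (by omega) hj h3
      exact ⟨b1, b2, b3⟩
    · exact i2 t (by
        rcases (show t ≤ j by omega).lt_or_eq with h4 | h4
        · exact h4
        · exact absurd (by rw [h4]) h3)
  · rintro h2 F2 ⟨_, i2⟩ ht
    refine ⟨⟨hS, fun t ht => (i2 t ht).1, fun t ht => (i2 t ht).2.1, fun t ht => (i2 t ht).2.2⟩, ?_⟩
    simp at ht ⊢
    omega

/-- Parameters, ranks of the symbols, and pivots. -/
structure Env where
  g : Pm
  rk : ℕ → ℕ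
  H : ℕ → ℕ

namespace Env

variable (E : Env)

/-- The symbols of the first sequence. -/
def a (i : ℕ) : ℕ := E.rk i

/-- The symbols of the second sequence, continued by a symbol that does not occur. -/
def bb (p : ℕ) : ℕ := if p < E.g.m then E.rk (E.g.n + p) else E.g.M + 1

def cls (v : ℕ) : ℕ := (v + E.g.s - 1) / E.g.s

def Heavy (v : ℕ) : Prop := E.H (E.cls v) = v

instance (v : ℕ) : Decidable (E.Heavy v) := inferInstanceAs (Decidable (_ = _))

/-- The group of a symbol. -/
def grp (v : ℕ) : ℕ := 2 * E.cls v + if E.Heavy v then 1 else 0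

structure OK : Prop where
  good : E.g.Good
  rk_lt : ∀ p < E.g.M, E.rk p < E.g.M
  mono : ∀ p < E.g.M, ∀ p' < E.g.M, E.rk p ≤ E.rk p' → E.grp (E.rk p) ≤ E.grp (E.rk p')
  pos : ∀ p < E.g.M, ¬ E.Heavy (E.rk p) → 1 ≤ E.cls (E.rk p)
  few : ∀ (c : ℕ) (F : Finset ℕ), (∀ p ∈ F, p < E.g.M ∧ E.cls (E.rk p) = c ∧ ¬ E.Heavy (E.rk p)) →
    F.card ≤ E.g.s

variable {E}

theorem s_pos : 1 ≤ E.g.s := Nat.le_add_left 1 _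

theorem cls_le (G : E.g.Good) {v : ℕ} (hv : v < E.g.M) : E.cls v ≤ E.g.q := by
  have h1 := G.M_le
  have h2 : 1 ≤ E.g.s := s_pos
  unfold cls
  rw [Nat.div_le_iff_le_mul_add_pred h2, mul_comm]
  omega

theorem le_cls_mul (v : ℕ) : v ≤ E.cls v * E.g.s := by
  have h2 : 1 ≤ E.g.s := s_pos
  have h3 := Nat.div_add_mod (v + E.g.s - 1) E.g.s
  have h4 := Nat.mod_lt (v + E.g.s - 1) h2
  unfold cls
  rw [mul_comm]
  omega

theorem cls_mul_lt (v : ℕ) : E.cls v * E.g.s < v + E.g.s := by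
  have h2 : 1 ≤ E.g.s := s_pos
  have h3 := Nat.div_mul_le_self (v + E.g.s - 1) E.g.s
  unfold cls
  omega

theorem cls_mono {v v' : ℕ} (h : v ≤ v') : E.cls v ≤ E.cls v' :=
  Nat.div_le_div_right (by omega)

theorem heavy_inj {v v' : ℕ} (h : E.Heavy v) (h' : E.grp v = E.grp v') : v = v' := by
  unfold grp at h'
  rw [if_pos h] at h'
  split_ifs at h' with h2
  · have : E.cls v = E.cls v' := by omega
    unfold Heavy at h h2
    rw [← h, ← h2, this]
  · omega

theorem grp_le (G : E.g.Good) {v : ℕ} (hv : v < E.g.M) : E.grp v ≤ 2 * E.g.q + 1 := by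
  have := E.cls_le G hv
  unfold grp
  split_ifs <;> omega

/-- Class c holds the ranks v with (c - 1)s < v ≤ cs. Entries with rank v fill an interval of sorted
indices starting at v, and v is heavy iff this interval reaches the cut c·s. Light symbols of class
c therefore lie among the s indices before the cut, and they precede the heavy symbol of the class.
Class 0 contains only rank 0, which is heavy. A class whose cut is beyond the array gets the pivot
M, which is not a rank. -/
theorem OK.of_ranked {key : ℕ → ℤ} {S : ℕ → ℕ} (G : E.g.Good) (R : Ranked key E.g.M S E.rk)
    (hH : ∀ c ≤ E.g.q, E.H c = if c * E.g.s < E.g.M then E.rk (S (c * E.g.s)) else E.g.M) :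
    E.OK := by
  have hcase : ∀ v < E.g.M, E.H (E.cls v) =
      if E.cls v * E.g.s < E.g.M then E.rk (S (E.cls v * E.g.s)) else E.g.M :=
    fun v hv => hH _ (E.cls_le G hv)
  refine ⟨G, fun p hp => R.lt hp, ?_, ?_, ?_⟩
  · intro p hp p' hp' hle
    have h1 := E.cls_mono hle
    rcases h1.eq_or_lt with h2 | h2
    · unfold grp
      rw [h2]
      by_cases h3 : E.Heavy (E.rk p)
      · have h4 : E.rk p' ≤ E.H (E.cls (E.rk p')) := by
          rw [hcase _ (R.lt hp')]
          split_ifs with h5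
          · have := R.mono (E.le_cls_mul (E.rk p')) h5
            rwa [R.self hp'] at this
          · exact (R.lt hp').le
        have h5 : E.rk p = E.rk p' := by
          have h6 : E.H (E.cls (E.rk p)) = E.rk p := h3
          rw [h2] at h6
          omega
        rw [h5]
      · rw [if_neg h3]
        omega
    · unfold grp
      split_ifs <;> omega
  · intro p hp hl
    by_contra h0
    have h1 : E.cls (E.rk p) = 0 := by omega
    have h2 := E.le_cls_mul (E.rk p)
    rw [h1] at h2
    have h3 : E.rk p = 0 := by omega
    apply hl
    unfold Heavy
    rw [hcase _ (R.lt hp), h1, if_pos (by omega), h3]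
    have := R.le 0 (by omega)
    simp only [zero_mul]
    omega
  · intro c F hF
    -- f maps a position to its sorted index, injectively; light symbols of class c land in the
    -- interval of length at most s before the cut.
    choose! f hf using R.sorts.surj
    have hs : 1 ≤ E.g.s := s_pos
    refine (Finset.card_le_card_of_injOn f (t := Finset.Ico (c * E.g.s - E.g.s) (c * E.g.s)) ?_ ?_).trans
      (by simp; omega)
    · intro p hp
      obtain ⟨hpM, hc, hl⟩ := hF p hp
      obtain ⟨f1, f2⟩ := hf p hpM
      have h1 := R.le _ f1
      rw [f2] at h1
      have h2 := E.le_cls_mul (E.rk p)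
      have h3 := E.cls_mul_lt (E.rk p)
      have h4 := hcase _ (R.lt hpM)
      rw [hc] at h2 h3 h4
      simp only [Finset.coe_Ico, Set.mem_Ico]
      refine ⟨by omega, ?_⟩
      by_contra h5
      push Not at h5
      apply hl
      unfold Heavy
      rw [hc, h4, if_pos (by omega)]
      have h6 := R.mono h5 f1
      have h7 := R.mono h2 (by omega)
      rw [R.self hpM] at h7
      rw [f2] at h6
      omega
    · intro p hp p' hp' he
      rw [← (hf p (hF p hp).1).2, he, (hf p' (hF p' hp').1).2]

end Env

def pivC : Cm :=
  .loop .c .q1 (.ite (.lt (Var.c * Var.s) Var.M) (.sto .H Var.c (Arr.RK (Arr.S (Var.c * Var.s))))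
    (.sto .H Var.c Var.M))

theorem pivC_spec {X : ℕ} {h : St} {g : Pm} {key : ℕ → ℤ} (G : g.Good) (hX : g.St ^ 2 ≤ X)
    (P : Par g h) (R : Ranked key g.M (h.a .S) (h.a .RK)) :
    Tr X pivC h fun h' => (∀ c ≤ g.q, h'.a .H c =
      if c * g.s < g.M then h.a .RK (h.a .S (c * g.s)) else g.M) ∧
      h'.time ≤ h.time + 12 * (g.M + 1) := by
  have hX1 : 16 * g.M + 64 ≤ X := by unfold Pm.St at hX; nlinarith
  have b1 := G.q_le_b
  have b2 := G.b_le_C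
  have b3 := G.C_le
  refine Tr_loop (fun j h1 => ∀ c < j, h1.a .H c =
      if c * g.s < g.M then h.a .RK (h.a .S (c * g.s)) else g.M) 3 (g.q + 1) P.eq1 (by omega)
      (by decide) rfl rfl (by simp) ?_ ?_
  · rintro j h1 hj F hjv hI
    have P1 := P.fr F
    have eS : h1.a .S = h.a .S := F.a _ rfl
    have eR : h1.a .RK = h.a .RK := F.a _ rfl
    simp only [Tr_ite, Tr_sto]
    simp [hjv, eS, eR, P1.es, P1.eM]
    refine ⟨fun h2 => ⟨?_, fun c hc => ?_⟩, fun h2 => ⟨by omega, fun c hc => ?_⟩⟩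
    · have := R.lt (R.sorts.lt _ h2)
      omega
    · rw [Function.update_apply]
      split_ifs with h3 h4 h4
      · rw [h3]
      · exact absurd (h3 ▸ h2) h4
      · rw [hI c (by omega), if_pos h4]
      · rw [hI c (by omega), if_neg h4]
    · rw [Function.update_apply]
      split_ifs with h3 h4 h4
      · subst h3; omega
      · rfl
      · rw [hI c (by omega), if_pos h4]
      · rw [hI c (by omega), if_neg h4]
  · rintro h2 F hI ht
    refine ⟨fun c hc => by simpa using hI c (by omega), ?_⟩
    simp at ht ⊢
    omega

/-! ### Digits -/

/-- The number with digits `f 0, …, f (k - 1)`. -/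
def enc (base k : ℕ) (f : ℕ → ℕ) : ℕ := ∑ t ∈ Finset.range k, f t * base ^ t

theorem enc_succ' (base k : ℕ) (f : ℕ → ℕ) :
    enc base (k + 1) f = enc base k (fun t => f (t + 1)) * base + f 0 := by
  unfold enc
  rw [Finset.sum_range_succ', Finset.sum_mul]
  simp [pow_succ, mul_assoc]

theorem enc_succ (base k : ℕ) (f : ℕ → ℕ) : enc base (k + 1) f = enc base k f + f k * base ^ k := by
  unfold enc
  rw [Finset.sum_range_succ]

theorem dig_enc {base : ℕ} : ∀ {k : ℕ} {f : ℕ → ℕ}, (∀ t < k, f t < base) → ∀ {t : ℕ}, t < k →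
    enc base k f / base ^ t % base = f t
  | 0, _, _, _, ht => by omega
  | k + 1, f, hf, t, ht => by
    have h0 := hf 0 (by omega)
    rw [enc_succ']
    cases t with
    | zero =>
      rw [pow_zero, Nat.div_one, Nat.add_mod, Nat.mul_mod_left, zero_add, Nat.mod_mod,
        Nat.mod_eq_of_lt h0]
    | succ t =>
      rw [pow_succ', ← Nat.div_div_eq_div_mul, mul_comm _ base, Nat.mul_add_div (by omega),
        Nat.div_eq_of_lt h0, add_zero]
      exact dig_enc (f := fun t => f (t + 1)) (fun t ht => hf _ (by omega)) (by omega)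

theorem enc_lt {base : ℕ} (hb : 1 ≤ base) {k : ℕ} {f : ℕ → ℕ} (hf : ∀ t < k, f t < base) :
    enc base k f < base ^ k := by
  induction k with
  | zero => simp [enc]
  | succ k ih =>
    rw [enc_succ, pow_succ]
    have h1 := ih fun t ht => hf t (by omega)
    have h2 := hf k (by omega)
    have : 1 ≤ base ^ k := Nat.pow_pos hb
    nlinarith

theorem enc_congr {base k : ℕ} {f f' : ℕ → ℕ} (h : ∀ t < k, f t = f' t) :
    enc base k f = enc base k f' :=
  Finset.sum_congr rfl fun t ht => by rw [h t (Finset.mem_range.1 ht)]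

theorem enc_add_pow {base k : ℕ} {f f' : ℕ → ℕ} {t : ℕ} (ht : t < k) (h1 : f' t = f t + 1)
    (h2 : ∀ u < k, u ≠ t → f' u = f u) : enc base k f' = enc base k f + base ^ t := by
  unfold enc
  rw [← Finset.add_sum_erase _ (fun t => f' t * base ^ t) (Finset.mem_range.2 ht),
    ← Finset.add_sum_erase _ (fun t => f t * base ^ t) (Finset.mem_range.2 ht), h1]
  rw [Finset.sum_congr rfl (g := fun t => f t * base ^ t)]
  · ring
  · intro u hu
    rw [Finset.mem_erase, Finset.mem_range] at hu
    simp only [h2 u hu.2 hu.1]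

theorem enc_zero {base k : ℕ} {f : ℕ → ℕ} (h : ∀ t < k, f t = 0) : enc base k f = 0 :=
  Finset.sum_eq_zero fun t ht => by rw [h t (Finset.mem_range.1 ht), zero_mul]

open Classical in
/-- The word whose bits are the truth values of `P` in the block `β`. -/
noncomputable def mask (b : ℕ) (P : ℕ → Prop) (β : ℕ) : ℕ :=
  enc 2 b fun t => if P (β * b + t) then 1 else 0

theorem mask_lt (b : ℕ) (P : ℕ → Prop) (β : ℕ) : mask b P β < 2 ^ b :=
  enc_lt (by norm_num) fun t _ => by split_ifs <;> omega

theorem mask_congr {b β : ℕ} {P P' : ℕ → Prop} (h : ∀ t < b, P (β * b + t) ↔ P' (β * b + t)) :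
    mask b P β = mask b P' β := by
  classical
  unfold mask
  exact enc_congr fun t ht => if_congr (h t ht) rfl rfl

theorem mask_eq_zero {b β : ℕ} {P : ℕ → Prop} (h : ∀ t < b, ¬ P (β * b + t)) : mask b P β = 0 :=
  enc_zero fun t ht => by simp [h t ht]

theorem mask_insert {b p : ℕ} (hb : 1 ≤ b) {P P' : ℕ → Prop} (h : ¬ P p)
    (hP : ∀ p', P' p' ↔ P p' ∨ p' = p) (β : ℕ) :
    mask b P' β = if β = p / b then mask b P β + 2 ^ (p % b) else mask b P β := by
  have e := Nat.div_add_mod p b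
  have l := Nat.mod_lt p hb
  rw [mul_comm] at e
  split_ifs with hβ
  · subst hβ
    unfold mask
    refine enc_add_pow l ?_ ?_
    · rw [if_pos (by rw [e]; exact (hP p).2 (Or.inr rfl)), if_neg (by rwa [e])]
    · intro u hu hne
      have : p / b * b + u ≠ p := by omega
      classical exact if_congr (by simp [hP, this]) rfl rfl
  · refine mask_congr fun t ht => ?_
    have : β * b + t ≠ p := by
      rintro rfl
      apply hβ
      rw [mul_comm, Nat.mul_add_div (by omega), Nat.div_eq_of_lt ht, add_zero]
    simp [hP, this]

/-! ### Two-dimensional indices, lists of light positions, masks of heavy positions -/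

theorem pair_inj {w i j i' j' : ℕ} (hj : j < w) (hj' : j' < w) (h : i * w + j = i' * w + j') :
    i = i' ∧ j = j' := by
  have h1 : (i * w + j) / w = i := by
    rw [mul_comm, Nat.mul_add_div (by omega), Nat.div_eq_of_lt hj, add_zero]
  have h2 : (i' * w + j') / w = i' := by
    rw [mul_comm, Nat.mul_add_div (by omega), Nat.div_eq_of_lt hj', add_zero]
  have : i = i' := by rw [← h1, h, h2]
  subst this
  exact ⟨rfl, by omega⟩

/-- Lists of the positions below `j` with rare symbols, by classes. -/
structure Lists (E : Env) (j : ℕ) (CNT LST : ℕ → ℕ) : Prop where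
  mem : ∀ c z, z < CNT c → LST (c * E.g.St + z) < j ∧
    E.cls (E.bb (LST (c * E.g.St + z))) = c ∧ ¬ E.Heavy (E.bb (LST (c * E.g.St + z)))
  mono : ∀ c z z', z < z' → z' < CNT c → LST (c * E.g.St + z) < LST (c * E.g.St + z')
  all : ∀ p < j, ¬ E.Heavy (E.bb p) → ∃ z < CNT (E.cls (E.bb p)),
    LST (E.cls (E.bb p) * E.g.St + z) = p
  cnt : ∀ c, CNT c ≤ j

/-- The masks of the positions below `j` with frequent symbols. -/
def HeavyMasks (E : Env) (j : ℕ) (MASK : ℕ → ℕ) : Prop :=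
  ∀ c β, β < E.g.St → MASK ((2 * c + 1) * E.g.St + β) =
    mask E.g.b (fun p => p < j ∧ E.Heavy (E.bb p) ∧ E.cls (E.bb p) = c) β

theorem Env.bb_of_lt {E : Env} {p : ℕ} (hp : p < E.g.m) : E.bb p = E.rk (E.g.n + p) := if_pos hp

theorem Env.add_lt {E : Env} {p : ℕ} (hp : p < E.g.m) : E.g.n + p < E.g.M := by
  unfold Pm.M; omega

/-- Shifted by n, the entries of a list are distinct positions of the concatenated input with light
symbols of one class, so `few` applies. This is why scanning a list costs O(s). -/
theorem Lists.cnt_le {E : Env} (K : E.OK) {CNT LST : ℕ → ℕ} (H : Lists E E.g.m CNT LST) (c : ℕ) :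
    CNT c ≤ E.g.s := by
  classical
  have h1 : Set.InjOn (fun z => E.g.n + LST (c * E.g.St + z)) (Finset.range (CNT c) : Set ℕ) := by
    intro z hz z' hz' he
    simp only [Finset.coe_range, Set.mem_Iio] at hz hz' he
    rcases lt_trichotomy z z' with h | h | h
    · have := H.mono c z z' h hz'
      omega
    · exact h
    · have := H.mono c z' z h hz
      omega
  have h2 := K.few c ((Finset.range (CNT c)).image fun z => E.g.n + LST (c * E.g.St + z)) ?_
  · rwa [Finset.card_image_of_injOn h1, Finset.card_range] at h2
  · intro p hp
    obtain ⟨z, hz, rfl⟩ := Finset.mem_image.1 hp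
    obtain ⟨a1, a2, a3⟩ := H.mem c z (Finset.mem_range.1 hz)
    rw [Env.bb_of_lt a1] at a2 a3
    exact ⟨Env.add_lt a1, a2, a3⟩

theorem Lists.push {E : Env} {j : ℕ} {CNT LST : ℕ → ℕ} (H : Lists E j CNT LST)
    (hj : j < E.g.St) (hl : ¬ E.Heavy (E.bb j)) :
    Lists E (j + 1)
      (Function.update CNT (E.cls (E.bb j)) (CNT (E.cls (E.bb j)) + 1))
      (Function.update LST (E.cls (E.bb j) * E.g.St + CNT (E.cls (E.bb j))) j) := by
  set c0 := E.cls (E.bb j) with hc0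
  have old : ∀ c z, z < CNT c →
      Function.update LST (c0 * E.g.St + CNT c0) j (c * E.g.St + z) = LST (c * E.g.St + z) := by
    intro c z hz
    refine Function.update_of_ne (fun he => ?_) _ _
    have h1 := H.cnt c
    have h2 := H.cnt c0
    obtain ⟨rfl, rfl⟩ := pair_inj (by omega) (by omega) he
    omega
  have new : Function.update LST (c0 * E.g.St + CNT c0) j (c0 * E.g.St + CNT c0) = j :=
    Function.update_self ..
  have cases : ∀ c z, z < Function.update CNT c0 (CNT c0 + 1) c →
      z < CNT c ∨ (c = c0 ∧ z = CNT c0) := by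
    intro c z hz
    by_cases h : c = c0
    · subst h
      rw [Function.update_self] at hz
      omega
    · rw [Function.update_of_ne h] at hz
      exact Or.inl hz
  have up : ∀ c z, z < CNT c → z < Function.update CNT c0 (CNT c0 + 1) c := by
    intro c z hz
    by_cases h : c = c0
    · subst h
      rw [Function.update_self]
      omega
    · rwa [Function.update_of_ne h]
  refine ⟨?_, ?_, ?_, ?_⟩
  · intro c z hz
    rcases cases c z hz with h | ⟨rfl, rfl⟩
    · rw [old c z h]
      have := H.mem c z h
      exact ⟨by omega, this.2⟩
    · rw [new]
      exact ⟨by omega, hc0.symm, hl⟩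
  · intro c z z' hlt hz
    rcases cases c z' hz with h | ⟨rfl, rfl⟩
    · rw [old c z' h, old c z (by omega)]
      exact H.mono c z z' hlt h
    · rw [new, old _ z hlt]
      exact (H.mem _ z hlt).1
  · intro p hp hl'
    by_cases h : p = j
    · subst h
      refine ⟨CNT c0, ?_, new⟩
      show CNT c0 < Function.update CNT c0 (CNT c0 + 1) c0
      rw [Function.update_self]
      omega
    · obtain ⟨z, hz, e⟩ := H.all p (by omega) hl'
      exact ⟨z, up _ _ hz, by rw [old _ _ hz, e]⟩
  · intro c
    have := H.cnt c
    have := H.cnt c0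
    rw [Function.update_apply]
    split_ifs <;> omega

theorem Lists.skip {E : Env} {j : ℕ} {CNT LST : ℕ → ℕ} (H : Lists E j CNT LST)
    (hl : E.Heavy (E.bb j)) : Lists E (j + 1) CNT LST := by
  refine ⟨fun c z hz => ?_, H.mono, fun p hp h => ?_, fun c => ?_⟩
  · have := H.mem c z hz
    exact ⟨by omega, this.2⟩
  · refine H.all p ?_ h
    by_contra hc
    obtain rfl : p = j := by omega
    exact h hl
  · have := H.cnt c
    omega

theorem HeavyMasks.skip {E : Env} {j : ℕ} {MASK : ℕ → ℕ} (H : HeavyMasks E j MASK)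
    (hl : ¬ E.Heavy (E.bb j)) : HeavyMasks E (j + 1) MASK := by
  intro c β hβ
  rw [H c β hβ]
  refine mask_congr fun t ht => ?_
  constructor
  · rintro ⟨h1, h2⟩
    exact ⟨by omega, h2⟩
  · rintro ⟨h1, h2⟩
    refine ⟨?_, h2⟩
    by_contra hc
    rw [show β * E.g.b + t = j by omega] at h2
    exact hl h2.1

theorem HeavyMasks.push {E : Env} {j : ℕ} {MASK : ℕ → ℕ} (hb : 1 ≤ E.g.b) (H : HeavyMasks E j MASK)
    (hj : j < E.g.St) (hl : E.Heavy (E.bb j)) :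
    HeavyMasks E (j + 1) (Function.update MASK ((2 * E.cls (E.bb j) + 1) * E.g.St + j / E.g.b)
      (MASK ((2 * E.cls (E.bb j) + 1) * E.g.St + j / E.g.b) + 2 ^ (j % E.g.b))) := by
  intro c β hβ
  have hjb : j / E.g.b < E.g.St := (Nat.div_le_self _ _).trans_lt hj
  by_cases hc : c = E.cls (E.bb j)
  · have key := mask_insert (b := E.g.b) (p := j) hb
      (P := fun p => p < j ∧ E.Heavy (E.bb p) ∧ E.cls (E.bb p) = c)
      (P' := fun p => p < j + 1 ∧ E.Heavy (E.bb p) ∧ E.cls (E.bb p) = c) (by simp)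
      (fun p => by
        constructor
        · rintro ⟨h1, h2⟩
          by_cases h : p = j
          · exact Or.inr h
          · exact Or.inl ⟨by omega, h2⟩
        · rintro (⟨h1, h2⟩ | rfl)
          · exact ⟨by omega, h2⟩
          · exact ⟨by omega, hl, hc.symm⟩) β
    rw [key]
    split_ifs with h
    · rw [h, ← hc, Function.update_self, H c _ hjb]
    · rw [Function.update_of_ne, H c β hβ]
      intro he
      exact h (pair_inj hβ hjb he).2
  · rw [Function.update_of_ne, H c β hβ]
    · refine mask_congr fun t ht => ?_
      constructor
      · rintro ⟨h1, h2⟩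
        exact ⟨by omega, h2⟩
      · rintro ⟨h1, h2⟩
        refine ⟨?_, h2⟩
        by_contra hc'
        rw [show β * E.g.b + t = j by omega] at h2
        exact hc h2.2.symm
    · intro he
      have := (pair_inj hβ hjb he).1
      omega

def listC : Cm :=
  .loop .p .m (
    .x ≔ Arr.RK (Var.n + Var.p) ;; .c ≔ (Var.x + Var.s - 1) / Var.s ;;
    .ite (.eq (Arr.H Var.c) Var.x)
      (.sto .MASK ((2 * Var.c + 1) * Var.St + Var.p / Var.b)
        (Arr.MASK ((2 * Var.c + 1) * Var.St + Var.p / Var.b) + Arr.POW2 (Var.p % Var.b)))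
      (.sto .LST (Var.c * Var.St + Arr.CNT Var.c) Var.p ;;
        .sto .CNT Var.c (Arr.CNT Var.c + 1)))

theorem listC_spec {X : ℕ} {h : St} {E : Env} (K : E.OK) (hX : E.g.St ^ 2 ≤ X) (P : Par E.g h)
    (hR : h.a .RK = E.rk) (hH : h.a .H = E.H) (h1 : ∀ i, h.a .CNT i = 0)
    (h2 : ∀ i, h.a .MASK i = 0) :
    Tr X listC h fun h' => Lists E E.g.m (h'.a .CNT) (h'.a .LST) ∧
      HeavyMasks E E.g.m (h'.a .MASK) ∧ h'.time ≤ h.time + 9 * (E.g.M + 1) := by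
  have hX1 : 16 * E.g.M + 64 ≤ X := by unfold Pm.St at hX; nlinarith
  have hm : E.g.m ≤ E.g.M := by unfold Pm.M; omega
  have hSt : E.g.M < E.g.St := by unfold Pm.St; omega
  have hb := K.good.b_pos
  have h2b := K.good.two_pow_le
  have hC := K.good.C_le
  refine Tr_loop (fun j h1 => Lists E j (h1.a .CNT) (h1.a .LST) ∧ HeavyMasks E j (h1.a .MASK))
    6 E.g.m P.em (by omega) (by decide) rfl rfl ?_ ?_ ?_
  · refine ⟨⟨fun c z hz => ?_, fun c z z' _ hz => ?_, fun p hp => by omega, fun c => ?_⟩, ?_⟩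
    · simp [h1] at hz
    · simp [h1] at hz
    · simp [h1]
    · intro c β hβ
      rw [mask_eq_zero fun t _ => by simp]
      simp [h2]
  · rintro j h3 hj F hjv ⟨I1, I2⟩
    have P3 := P.fr F
    have eR : h3.a .RK = E.rk := by rw [F.a _ rfl, hR]
    have eH : h3.a .H = E.H := by rw [F.a _ rfl, hH]
    have ebb : E.rk (E.g.n + j) = E.bb j := (Env.bb_of_lt hj).symm
    have hlt : E.bb j < E.g.M := by rw [← ebb]; exact K.rk_lt _ (Env.add_lt hj)
    have hs : 1 ≤ E.g.s := Env.s_pos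
    have ecls : (E.bb j + E.g.s - 1) / E.g.s = E.cls (E.bb j) := rfl
    have hcl := E.cls_le K.good hlt
    have hq := K.good.q_le_b
    have hbC := K.good.b_le_C
    have hcnt := I1.cnt (E.cls (E.bb j))
    simp only [Tr_seq, Tr_asg, Tr_ite, Tr_sto]
    simp [hjv, eR, eH, P3.en, P3.es, P3.eSt, P3.eb, ebb, ecls]
    refine ⟨by omega, by omega, by omega, fun h4 => ⟨?_, ?_, ?_⟩, fun h4 => ⟨by omega, ?_, ?_, ?_⟩⟩
    · have e1 := I2 (E.cls (E.bb j)) (j / E.g.b) ((Nat.div_le_self _ _).trans_lt (by omega))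
      have e2 := mask_lt E.g.b (fun p => p < j ∧ E.Heavy (E.bb p) ∧ E.cls (E.bb p) = E.cls (E.bb j))
        (j / E.g.b)
      rw [← e1] at e2
      have hmod := Nat.mod_lt j hb
      rw [P3.pow2 _ hmod]
      have := Nat.pow_le_pow_right (show 0 < 2 by norm_num) hmod.le
      omega
    · exact I1.skip h4
    · rw [P3.pow2 _ (Nat.mod_lt j hb)]
      exact I2.push hb (by omega) h4
    · omega
    · exact I1.push (by omega) h4
    · exact I2.skip h4
  · rintro h3 F ⟨I1, I2⟩ ht
    refine ⟨I1, I2, ?_⟩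
    simp at ht ⊢
    omega

/-! ### The recurrence -/

section dp

open Classical in
/-- Prefix maximum of `e` over the positions whose symbol satisfies `P`. -/
noncomputable def pmax (bb e : ℕ → ℕ) (P : ℕ → Prop) : ℕ → ℕ
  | 0 => 0
  | p + 1 => max (pmax bb e P p) (if P (bb p) then e p else 0)

variable {bb e e' : ℕ → ℕ} {P P' : ℕ → Prop}

theorem pmax_le_iff {p V : ℕ} : pmax bb e P p ≤ V ↔ ∀ p' < p, P (bb p') → e p' ≤ V := by
  induction p with
  | zero => simp [pmax]
  | succ p ih =>
    rw [pmax, max_le_iff, ih]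
    constructor
    · rintro ⟨h1, h2⟩ p' hp' hP
      rcases (show p' ≤ p by omega).lt_or_eq with h | rfl
      · exact h1 p' h hP
      · rwa [if_pos hP] at h2
    · intro h
      refine ⟨fun p' hp' hP => h p' (by omega) hP, ?_⟩
      split_ifs with h1
      · exact h p (by omega) h1
      · exact Nat.zero_le _

theorem le_pmax {p p' : ℕ} (h : p' < p) (hP : P (bb p')) : e p' ≤ pmax bb e P p :=
  pmax_le_iff.1 le_rfl p' h hP

theorem pmax_mono {p p' : ℕ} (he : ∀ u < p, e u ≤ e' u)
    (hP : ∀ u < p, P (bb u) → P' (bb u)) (h : p ≤ p') : pmax bb e P p ≤ pmax bb e' P' p' :=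
  pmax_le_iff.2 fun u hu h1 => (he u hu).trans (le_pmax (by omega) (hP u hu h1))

theorem pmax_succ_of_pos {p : ℕ} (h : P (bb p)) :
    pmax bb e P (p + 1) = max (pmax bb e P p) (e p) := by rw [pmax, if_pos h]

theorem pmax_succ_of_neg {p : ℕ} (h : ¬ P (bb p)) : pmax bb e P (p + 1) = pmax bb e P p := by
  rw [pmax, if_neg h, Nat.max_zero]

/-- Length of a longest common increasing subsequence that ends with position `p` of the second
sequence and uses the first `i` symbols of the first one. -/
noncomputable def dpE (a bb : ℕ → ℕ) : ℕ → ℕ → ℕ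
  | 0, _ => 0
  | i + 1, p => if a i = bb p then 1 + pmax bb (dpE a bb i) (· < a i) p else dpE a bb i p

/-- Length of a longest common increasing subsequence of prefixes with symbols in `P`. -/
noncomputable def dpG (a bb : ℕ → ℕ) (P : ℕ → Prop) (i p : ℕ) : ℕ := pmax bb (dpE a bb i) P p

variable {a : ℕ → ℕ} {i i' p p' : ℕ}

theorem dpE_succ_of_eq (h : a i = bb p) :
    dpE a bb (i + 1) p = 1 + dpG a bb (· < a i) i p := by rw [dpE, if_pos h]; rfl

theorem dpE_succ_of_ne (h : a i ≠ bb p) : dpE a bb (i + 1) p = dpE a bb i p := by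
  rw [dpE, if_neg h]

/-- The two claims support each other. At a match the new value is 1 plus the best chain with
smaller symbols, and the first claim says that the old value was no larger; monotonicity then
carries the first claim to the next row. -/
theorem dpE_le_and_mono (a bb : ℕ → ℕ) (i : ℕ) : (∀ p, dpE a bb i p ≤ 1 + dpG a bb (· < bb p) i p) ∧
    ∀ p, dpE a bb i p ≤ dpE a bb (i + 1) p := by
  induction i with
  | zero => exact ⟨fun p => by simp [dpE], fun p => by simp [dpE]⟩
  | succ i ih =>
    have h1 : ∀ p, dpE a bb (i + 1) p ≤ 1 + dpG a bb (· < bb p) (i + 1) p := by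
      intro p
      have h2 : dpG a bb (· < bb p) i p ≤ dpG a bb (· < bb p) (i + 1) p :=
        pmax_mono (fun u _ => ih.2 u) (fun _ _ h => h) le_rfl
      by_cases h : a i = bb p
      · rw [dpE_succ_of_eq h, h]
        omega
      · rw [dpE_succ_of_ne h]
        have := ih.1 p
        omega
    refine ⟨h1, fun p => ?_⟩
    by_cases h : a (i + 1) = bb p
    · rw [dpE_succ_of_eq h, h]
      exact h1 p
    · rw [dpE_succ_of_ne h]

theorem dpE_le (a bb : ℕ → ℕ) (i p : ℕ) : dpE a bb i p ≤ 1 + dpG a bb (· < bb p) i p :=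
  (dpE_le_and_mono a bb i).1 p

theorem dpE_mono (h : i ≤ i') (p : ℕ) : dpE a bb i p ≤ dpE a bb i' p :=
  monotone_nat_of_le_succ (f := fun i => dpE a bb i p) (fun i => (dpE_le_and_mono a bb i).2 p) h

theorem dpG_mono (hi : i ≤ i') (hp : p ≤ p') (hP : ∀ u < p, P (bb u) → P' (bb u)) :
    dpG a bb P i p ≤ dpG a bb P' i' p' :=
  pmax_mono (fun u _ => dpE_mono hi u) hP hp

theorem dpG_congr (hP : ∀ u < p, P (bb u) ↔ P' (bb u)) : dpG a bb P i p = dpG a bb P' i p :=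
  le_antisymm (dpG_mono le_rfl le_rfl fun u hu => (hP u hu).1)
    (dpG_mono le_rfl le_rfl fun u hu => (hP u hu).2)

/-- `P` is closed downwards among the symbols of `bb`. -/
def LowerIn (bb : ℕ → ℕ) (P : ℕ → Prop) : Prop := ∀ u u', bb u < bb u' → P (bb u') → P (bb u)

/-- Removing the last match of a chain ending in column p leaves a chain with smaller symbols, which
still satisfy P. So the function grows by at most 1 per column, and a block of b values can be
encoded with digits below b. -/
theorem dpG_succ_right_le (hP : LowerIn bb P) : dpG a bb P i (p + 1) ≤ dpG a bb P i p + 1 := by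
  unfold dpG
  by_cases h : P (bb p)
  · rw [pmax_succ_of_pos h]
    have h1 := dpE_le a bb i p
    have h2 : dpG a bb (· < bb p) i p ≤ dpG a bb P i p :=
      dpG_mono le_rfl le_rfl fun u _ h' => hP u p h' h
    unfold dpG at h1 h2
    omega
  · rw [pmax_succ_of_neg h]
    omega

theorem dpG_add_right_le (hP : LowerIn bb P) (t : ℕ) :
    dpG a bb P i (p + t) ≤ dpG a bb P i p + t := by
  induction t with
  | zero => simp
  | succ t ih =>
    have := dpG_succ_right_le (a := a) (i := i) (p := p + t) hP
    rw [← add_assoc]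
    omega

theorem dpG_succ_of_not (h : ¬ P (a i)) : dpG a bb P (i + 1) p = dpG a bb P i p := by
  refine le_antisymm (pmax_le_iff.2 fun u hu h1 => ?_) (dpG_mono (by omega) le_rfl fun _ _ h => h)
  rw [dpE_succ_of_ne]
  · exact le_pmax hu h1
  · intro h2
    rw [← h2] at h1
    exact h h1

theorem dpG_zero : dpG a bb P 0 p = 0 := by
  have : dpG a bb P 0 p ≤ 0 := pmax_le_iff.2 fun u _ _ => by simp [dpE]
  omega

theorem dpG_zero_right : dpG a bb P i 0 = 0 := rfl

open Classical in
/-- Prefix maximum of `1 + base` over the marked positions. -/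
noncomputable def hmax (base : ℕ → ℕ) (msk : ℕ → Prop) : ℕ → ℕ
  | 0 => 0
  | p + 1 => if msk p then max (hmax base msk p) (1 + base p) else hmax base msk p

/-- As `base` is monotone, marks exceed it by at most one. This is what limits the carry between
blocks to 0 or 1. -/
theorem hmax_le {base : ℕ → ℕ} {msk : ℕ → Prop} (hb : Monotone base) (p : ℕ) :
    hmax base msk p ≤ base p + 1 := by
  induction p with
  | zero => simp [hmax]
  | succ p ih =>
    have := hb (show p ≤ p + 1 by omega)
    rw [hmax]
    split_ifs <;> omega

/-- Only columns with symbol a i change, and there the new value 1 + dpG (· < a i) is at least the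
old one. In a marked column it equals 1 + `base`; in an unmarked match it is at most `base`, hence
already reached by the function of P. Including `base` in the maximum is harmless by `hle`, and it
tames `hmax`, which alone could jump within a block. The term added to dpG P does not involve P, so
one function updates all stored ones. -/
theorem dpG_row {base : ℕ → ℕ} {msk : ℕ → Prop} (hb : Monotone base) (hPx : P (a i))
    (hle : ∀ p, base p ≤ dpG a bb P i p)
    (h1 : ∀ p, msk p → a i = bb p ∧ base p = dpG a bb (· < a i) i p)
    (h2 : ∀ p, a i = bb p → msk p ∨ 1 + dpG a bb (· < a i) i p ≤ base p) (p : ℕ) :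
    dpG a bb P (i + 1) p = max (dpG a bb P i p) (max (base p) (hmax base msk p)) := by
  induction p with
  | zero =>
    have := hle 0
    have := dpG_zero_right (a := a) (bb := bb) (P := P) (i := i)
    have := dpG_zero_right (a := a) (bb := bb) (P := P) (i := i + 1)
    simp only [hmax]
    omega
  | succ p ih =>
    have l1 := hle p
    have l2 := hle (p + 1)
    have l3 := hb (show p ≤ p + 1 by omega)
    by_cases hx : a i = bb p
    · have hP : P (bb p) := hx ▸ hPx
      have e1 : dpG a bb P (i + 1) (p + 1) = max (dpG a bb P (i + 1) p) (dpE a bb (i + 1) p) :=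
        pmax_succ_of_pos hP
      have e2 : dpG a bb P i (p + 1) = max (dpG a bb P i p) (dpE a bb i p) := pmax_succ_of_pos hP
      have e3 := dpE_le a bb i p
      rw [← hx] at e3
      rw [dpE_succ_of_eq hx] at e1
      rw [hmax]
      rcases h2 p hx with h | h
      · have := (h1 p h).2
        rw [if_pos h]
        omega
      · by_cases hm : msk p
        · have := (h1 p hm).2
          rw [if_pos hm]
          omega
        · rw [if_neg hm]
          omega
    · have hm : ¬ msk p := fun h => hx (h1 p h).1
      rw [hmax, if_neg hm]
      by_cases hP : P (bb p)
      · have e1 : dpG a bb P (i + 1) (p + 1) = max (dpG a bb P (i + 1) p) (dpE a bb (i + 1) p) :=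
          pmax_succ_of_pos hP
        have e2 : dpG a bb P i (p + 1) = max (dpG a bb P i p) (dpE a bb i p) := pmax_succ_of_pos hP
        rw [dpE_succ_of_ne hx] at e1
        omega
      · have e1 : dpG a bb P (i + 1) (p + 1) = dpG a bb P (i + 1) p := pmax_succ_of_neg hP
        have e2 : dpG a bb P i (p + 1) = dpG a bb P i p := pmax_succ_of_neg hP
        omega

/-- The recurrence is an upper bound for the length of common increasing subsequences. -/
theorem chain_le {n m : ℕ} (l : List (ℕ × ℕ)) (hl : ∀ x ∈ l, x.1 < n ∧ x.2 < m ∧ a x.1 = bb x.2 ∧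
    P (bb x.2)) (hc : l.IsChain fun x y => x.1 < y.1 ∧ x.2 < y.2 ∧ a x.1 < a y.1) :
    l.length ≤ dpG a bb P n m := by
  -- `dpE` is indexed by the last match, so the induction removes matches from the end of the list.
  have key : ∀ (l : List (ℕ × ℕ)) (x : ℕ × ℕ), (∀ y ∈ l ++ [x], a y.1 = bb y.2) →
      (l ++ [x]).IsChain (fun x y => x.1 < y.1 ∧ x.2 < y.2 ∧ a x.1 < a y.1) →
      (l ++ [x]).length ≤ dpE a bb (x.1 + 1) x.2 := by
    intro l
    induction l using List.reverseRecOn with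
    | nil =>
      intro x hx _
      rw [dpE_succ_of_eq (hx x (by simp))]
      simp
    | append_singleton l y ih =>
      intro x hx hch
      have hx0 := hx x (by simp)
      have h1 := ih y (fun z hz => hx z (by simp at hz ⊢; tauto)) (List.isChain_append.1 hch).1
      have h2 := (List.isChain_append.1 hch).2.2 y (by simp) x (by simp)
      rw [dpE_succ_of_eq hx0]
      have h3 : dpE a bb x.1 y.2 ≤ dpG a bb (· < a x.1) x.1 x.2 :=
        le_pmax h2.2.1 (by rw [← hx y (by simp)]; exact h2.2.2)
      have h4 : dpE a bb (y.1 + 1) y.2 ≤ dpE a bb x.1 y.2 := dpE_mono h2.1 _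
      rw [List.length_append, List.length_singleton]
      omega
  rcases List.eq_nil_or_concat l with rfl | ⟨l', x, rfl⟩
  · simp
  · rw [List.concat_eq_append] at *
    have hx := hl x (by simp)
    refine (key l' x (fun y hy => (hl y hy).2.2.1) hc).trans ?_
    exact (dpE_mono hx.1 _).trans (le_pmax hx.2.1 hx.2.2.2)

end dp

/-! ### The recurrence restricted to groups of symbols -/

namespace Env

variable {E : Env}

/-- Symbols of the groups up to `k`. -/
def Upto (E : Env) (k : ℕ) (v : ℕ) : Prop := v ≤ E.g.M ∧ E.grp v ≤ k

/-- The functions that the algorithm stores. -/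
noncomputable def G (E : Env) (k i p : ℕ) : ℕ := dpG E.a E.bb (E.Upto k) i p

/-- Length of a longest chain in the first `i` rows that ends in column `p`. -/
noncomputable def e (E : Env) (i p : ℕ) : ℕ := dpE E.a E.bb i p

/-- Length of a longest chain with symbols smaller than the one of row `i`. -/
noncomputable def below (E : Env) (i p : ℕ) : ℕ := dpG E.a E.bb (· < E.a i) i p

theorem bb_le {p : ℕ} (h : E.bb p ≤ E.g.M) : p < E.g.m := by
  by_contra hc
  rw [bb, if_neg hc] at h
  omega

theorem OK.bb_lt (K : E.OK) {p : ℕ} (h : p < E.g.m) : E.bb p < E.g.M := by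
  rw [bb_of_lt h]
  exact K.rk_lt _ (add_lt h)

theorem OK.a_lt (K : E.OK) {i : ℕ} (h : i < E.g.n) : E.a i < E.g.M :=
  K.rk_lt i (by unfold Pm.M; omega)

theorem OK.mono_bb (K : E.OK) {p p' : ℕ} (hp : p < E.g.m) (hp' : p' < E.g.m)
    (h : E.bb p ≤ E.bb p') : E.grp (E.bb p) ≤ E.grp (E.bb p') := by
  rw [bb_of_lt hp, bb_of_lt hp'] at *
  exact K.mono _ (add_lt hp) _ (add_lt hp') h

theorem OK.mono_a_bb (K : E.OK) {i p : ℕ} (hi : i < E.g.n) (hp : p < E.g.m)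
    (h : E.a i ≤ E.bb p) : E.grp (E.a i) ≤ E.grp (E.bb p) := by
  rw [bb_of_lt hp] at *
  exact K.mono _ (by unfold Pm.M; omega) _ (add_lt hp) h

theorem OK.mono_bb_a (K : E.OK) {i p : ℕ} (hi : i < E.g.n) (hp : p < E.g.m)
    (h : E.bb p ≤ E.a i) : E.grp (E.bb p) ≤ E.grp (E.a i) := by
  rw [bb_of_lt hp] at *
  exact K.mono _ (add_lt hp) _ (by unfold Pm.M; omega) h

theorem OK.lowerIn (K : E.OK) (k : ℕ) : LowerIn E.bb (E.Upto k) := by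
  intro u u' h h'
  have hu' := bb_le h'.1
  have hu : u < E.g.m := bb_le (by have := h'.1; omega)
  exact ⟨by have := h'.1; omega, (K.mono_bb hu hu' h.le).trans h'.2⟩

theorem G_mono_p (k i : ℕ) : Monotone (E.G k i) := fun _ _ h => dpG_mono le_rfl h fun _ _ h => h

theorem G_mono {k k' i i' p p' : ℕ} (hk : k ≤ k') (hi : i ≤ i') (hp : p ≤ p') :
    E.G k i p ≤ E.G k' i' p' :=
  dpG_mono hi hp fun _ _ h => ⟨h.1, h.2.trans hk⟩

theorem OK.G_add_le (K : E.OK) (k i p t : ℕ) : E.G k i (p + t) ≤ E.G k i p + t :=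
  dpG_add_right_le (K.lowerIn k) t

theorem OK.G_le (K : E.OK) (k i p : ℕ) : E.G k i p ≤ p := by
  have := K.G_add_le k i 0 p
  rw [zero_add] at this
  have h : E.G k i 0 = 0 := rfl
  omega

/-- The positions that are marked in row `i`. -/
def Mark (E : Env) (i p : ℕ) : Prop :=
  E.a i = E.bb p ∧ (E.Heavy (E.a i) ∨ E.below i p = E.G (E.grp (E.a i)) i p)

/-- The index of the function from which row `i` is computed. -/
def bas (E : Env) (i : ℕ) : ℕ := 2 * E.cls (E.a i)

/-- A heavy symbol is alone in its group, and groups are monotone in the symbol, so the smaller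
symbols are exactly those of the groups before it. -/
theorem OK.below_eq (K : E.OK) {i : ℕ} (hi : i < E.g.n) (h : E.Heavy (E.a i)) (p : ℕ) :
    E.below i p = E.G (E.bas i) i p := by
  have hg : E.grp (E.a i) = E.bas i + 1 := by rw [grp, if_pos h, bas]
  refine dpG_congr fun u _ => ⟨fun hu => ?_, fun hu => ?_⟩
  · have hM := K.a_lt hi
    have hum : u < E.g.m := bb_le (by omega)
    refine ⟨by omega, ?_⟩
    have h1 := K.mono_bb_a hi hum hu.le
    by_contra hc
    have := heavy_inj h (v' := E.bb u) (by omega)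
    omega
  · by_contra hc
    have := K.mono_a_bb hi (bb_le hu.1) (by omega)
    have := hu.2
    omega

/-- The functions of the next row from those of the current one. -/
theorem OK.G_succ (K : E.OK) {i k : ℕ} (hi : i < E.g.n) (hk : E.grp (E.a i) ≤ k) (p : ℕ) :
    E.G k (i + 1) p = max (E.G k i p)
      (max (E.G (E.bas i) i p) (hmax (E.G (E.bas i) i) (E.Mark i) p)) := by
  have hbas : E.bas i ≤ E.grp (E.a i) := by unfold bas grp; omega
  have hM := K.a_lt hi
  refine dpG_row (G_mono_p _ _) ⟨hM.le, hk⟩ (fun p => G_mono (by omega) le_rfl le_rfl) ?_ ?_ p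
  · rintro p ⟨h1, h2⟩
    refine ⟨h1, ?_⟩
    by_cases h : E.Heavy (E.a i)
    · exact (K.below_eq hi h p).symm
    · rcases h2 with h2 | h2
      · exact absurd h2 h
      · rw [grp, if_neg h] at h2
        exact h2.symm
  · intro p h1
    by_cases h : E.Heavy (E.a i)
    · exact Or.inl ⟨h1, Or.inl h⟩
    · have h3 : E.below i p ≤ E.G (E.grp (E.a i)) i p := by
        refine dpG_mono le_rfl le_rfl fun u _ hu => ?_
        have hum : u < E.g.m := bb_le (by omega)
        exact ⟨by omega, K.mono_bb_a hi hum hu.le⟩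
      -- At a light match with strict inequality, extending a chain through the match gains nothing
      -- over the group function itself, so the match can stay unmarked.
      rcases h3.lt_or_eq with h4 | h4
      · right
        rw [grp, if_neg h, add_zero] at h4
        show 1 + E.below i p ≤ E.G (E.bas i) i p
        unfold bas
        omega
      · exact Or.inl ⟨h1, Or.inr h4⟩

theorem G_succ_of_lt {i k : ℕ} (hk : k < E.grp (E.a i)) (p : ℕ) :
    E.G k (i + 1) p = E.G k i p :=
  dpG_succ_of_not fun h => by have := h.2; omega

theorem OK.hmax_le (i p : ℕ) :
    hmax (E.G (E.bas i) i) (E.Mark i) p ≤ E.G (E.bas i) i p + 1 := LCIS.hmax_le (G_mono_p _ _) p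

end Env

/-! ### Tables -/

/-- Digit `t` of `x` in base `b`. -/
def dg (b t x : ℕ) : ℕ := x / b ^ t % b

theorem dg_lt {b : ℕ} (hb : 1 ≤ b) (t x : ℕ) : dg b t x < b := Nat.mod_lt _ hb

/-- Digits of the pointwise maximum of two blocks whose offsets differ by `δ - b`. -/
def maxD (b x1 x2 δ t : ℕ) : ℕ := max (δ + dg b t x1) (b + dg b t x2) - max δ b

/-- The running maximum in a block: `e`, and the successors of the marked values. -/
def runMax (b x mk e : ℕ) : ℕ → ℕ
  | 0 => e
  | t + 1 => if mk / 2 ^ t % 2 = 1 then max (runMax b x mk e t) (dg b t x + 1)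
      else runMax b x mk e t

def runD (b x mk e t : ℕ) : ℕ := max (dg b t x) (runMax b x mk e t) - e

theorem maxD_lt {b : ℕ} (hb : 1 ≤ b) (x1 x2 δ t : ℕ) : maxD b x1 x2 δ t < b := by
  have := dg_lt hb t x1
  have := dg_lt hb t x2
  unfold maxD
  omega

theorem runMax_le {b : ℕ} (hb : 1 ≤ b) (x mk : ℕ) {e : ℕ} (he : e ≤ 1) (t : ℕ) :
    e ≤ runMax b x mk e t ∧ runMax b x mk e t ≤ b := by
  induction t with
  | zero => simp only [runMax]; omega
  | succ t ih =>
    have := dg_lt hb t x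
    rw [runMax]
    split_ifs <;> omega

theorem runD_le {b : ℕ} (hb : 1 ≤ b) (x mk : ℕ) {e : ℕ} (he : e ≤ 1) (t : ℕ) :
    runD b x mk e t ≤ b := by
  have := dg_lt hb t x
  have := runMax_le hb x mk he t
  unfold runD
  omega

/-- The tables are filled for all indices, including codes and masks that never occur together, and
then a digit may equal b. The bound is therefore weaker than `enc_lt`, but it still shows that the
entries fit. -/
theorem enc_le {b k : ℕ} (hb : 1 ≤ b) {f : ℕ → ℕ} (hf : ∀ t < k, f t ≤ b) :
    enc b k f ≤ k * b ^ k := by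
  induction k with
  | zero => simp [enc]
  | succ k ih =>
    rw [enc_succ, pow_succ]
    have h1 := ih fun t ht => hf t (by omega)
    have h2 := hf k (by omega)
    have h3 : 1 ≤ b ^ k := Nat.pow_pos hb
    have h4 : k * b ^ k ≤ k * (b ^ k * b) := Nat.mul_le_mul le_rfl (Nat.le_mul_of_pos_right _ hb)
    have h5 : f k * b ^ k ≤ b ^ k * b := by rw [mul_comm]; exact Nat.mul_le_mul le_rfl h2
    nlinarith

/-- Decoding of a table index. -/
def maxTabPre : Cm :=
  .x1 ≔ Var.t / Var.B2 / Var.Cc ;; .x2 ≔ Var.t / Var.B2 % Var.Cc ;; .d ≔ Var.t % Var.B2 ;;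
  .acc ≔ 0 ;; .ite (.le Var.d Var.b) (.mk ≔ Var.b) (.mk ≔ Var.d)

/-- Computation of a digit of a table entry. -/
def maxTabStep : Cm :=
  .ux ≔ Var.d + Var.x1 % Var.b ;; .ua ≔ Var.b + Var.x2 % Var.b ;;
  .ite (.le Var.ux Var.ua) (.ux ≔ Var.ua) .skip ;;
  .acc ≔ Var.acc + (Var.ux - Var.mk) * Arr.POWB Var.u ;;
  .x1 ≔ Var.x1 / Var.b ;; .x2 ≔ Var.x2 / Var.b

def maxTabC : Cm :=
  .loop .t .sz1 (maxTabPre ;; .loop .u .b maxTabStep ;; .sto .T1 Var.t Var.acc)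

/-- Contents of the table of pointwise maxima. -/
def MaxTab (g : Pm) (T : ℕ → ℕ) : Prop :=
  ∀ j < g.C * g.C * (2 * g.b), T j =
    enc g.b g.b (maxD g.b (j / (2 * g.b) / g.C) (j / (2 * g.b) % g.C) (j % (2 * g.b)))

theorem Pm.Good.sz1_le {g : Pm} (G : g.Good) : g.C * g.C * (2 * g.b) ≤ 2 * (g.M + 1) := by
  have hC4 := G.C_sq
  have hb := G.b_le_C
  have hC := G.C_pos
  have : g.C * g.C * g.b ≤ g.C * g.C * (g.C * g.C) := Nat.mul_le_mul le_rfl (by nlinarith)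
  nlinarith

theorem Pm.Good.sz2_le {g : Pm} (G : g.Good) : g.C * 2 ^ g.b * 2 ≤ 4 * (g.M + 1) := by
  have hC4 := G.C_sq
  have h2b := G.two_pow_le
  have hC := G.C_pos
  have h1 : g.C * 2 ^ g.b ≤ g.C * (2 * g.C) := Nat.mul_le_mul le_rfl h2b
  have h2 : g.C * g.C ≤ g.C * g.C * (g.C * g.C) := Nat.le_mul_of_pos_right _ (by nlinarith)
  nlinarith

/-- A table entry is computed digit by digit in O(b) steps, so the size times b has to be linear in
M. -/
theorem Pm.Good.sz1_mul_le {g : Pm} (G : g.Good) : g.C * g.C * (2 * g.b) * g.b ≤ 2 * (g.M + 1) := by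
  have hC4 := G.C_sq
  have hb := G.b_le_C
  have : g.C * g.C * (g.b * g.b) ≤ g.C * g.C * (g.C * g.C) :=
    Nat.mul_le_mul le_rfl (Nat.mul_le_mul hb hb)
  nlinarith

theorem Pm.Good.sz2_mul_le {g : Pm} (G : g.Good) : g.C * 2 ^ g.b * 2 * g.b ≤ 4 * (g.M + 1) := by
  have hC4 := G.C_sq
  have h2b := G.two_pow_le
  have hb := G.b_le_C
  have hC := G.C_pos
  have h1 : g.C * 2 ^ g.b * g.b ≤ g.C * (2 * g.C) * g.C :=
    Nat.mul_le_mul (Nat.mul_le_mul le_rfl h2b) hb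
  have h2 : g.C * g.C * g.C ≤ g.C * g.C * (g.C * g.C) := Nat.mul_le_mul le_rfl (by nlinarith)
  nlinarith

theorem div_pow_succ (x b j : ℕ) : x / b ^ (j + 1) = x / b ^ j / b := by
  rw [pow_succ, Nat.div_div_eq_div_mul]

theorem maxTabC_spec {X : ℕ} {h : St} {g : Pm} (G : g.Good) (hX : g.St ^ 2 ≤ X) (P : Par g h) :
    Tr X maxTabC h fun h' => MaxTab g (h'.a .T1) ∧ h'.time ≤ h.time + 64 * (g.M + 1) := by
  have hX1 : 16 * g.M + 64 ≤ X := by unfold Pm.St at hX; nlinarith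
  have hC := G.C_le
  have hb := G.b_pos
  have hbC := G.b_le_C
  have hsz := G.sz1_le
  have hsz2 := G.sz1_mul_le
  refine Tr_loop (fun j h1 => ∀ i < j, h1.a .T1 i = enc g.b g.b (maxD g.b (i / (2 * g.b) / g.C)
    (i / (2 * g.b) % g.C) (i % (2 * g.b)))) (9 * g.b + 14) (g.C * g.C * (2 * g.b)) P.esz1 (by omega)
    (by decide) rfl rfl (by simp) ?_ ?_
  · intro j h1 hj F hjv hI
    have P1 := (P.fr F).tick
    obtain ⟨x1, hx1⟩ : ∃ x1, x1 = j / (2 * g.b) / g.C := ⟨_, rfl⟩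
    obtain ⟨x2, hx2⟩ : ∃ x2, x2 = j / (2 * g.b) % g.C := ⟨_, rfl⟩
    obtain ⟨δ, hδ⟩ : ∃ δ, δ = j % (2 * g.b) := ⟨_, rfl⟩
    have l0 : j / (2 * g.b) ≤ j := Nat.div_le_self _ _
    have l1 : x1 ≤ j := hx1 ▸ (Nat.div_le_self _ _).trans l0
    have l2 : x2 ≤ j := hx2 ▸ (Nat.mod_le _ _).trans l0
    have l3 : δ < 2 * g.b := hδ ▸ Nat.mod_lt _ (by omega)
    simp only [Tr_seq]
    have first : Tr X maxTabPre h1.tick fun h2 => h2.v .x1 = x1 ∧ h2.v .x2 = x2 ∧ h2.v .d = δ ∧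
        h2.v .acc = 0 ∧ h2.v .mk = max δ g.b ∧ h2.time ≤ h1.time + 7 := by
      have eB := P1.eB2
      have eC := P1.eC
      have eb := P1.eb
      simp only [St.tick_v] at eB eC eb
      simp only [maxTabPre, Tr_seq, Tr_asg, Tr_ite]
      simp [hjv, eB, eC, eb, ← hx1, ← hx2, ← hδ]
      omega
    refine first.mono ?_
    rintro h2 F2 ⟨a1, a2, a3, a4, a5, t2⟩
    have P2 := P1.fr F2
    refine Tr_loop (fun u h3 => h3.v .x1 = x1 / g.b ^ u ∧ h3.v .x2 = x2 / g.b ^ u ∧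
      h3.v .acc = enc g.b u (maxD g.b x1 x2 δ)) 8 g.b P2.eb (by omega) (by decide) rfl rfl
      (by simp [a1, a2, a4, enc]) ?_ ?_
    · rintro u h3 hu F3 huv ⟨b1, b2, b3⟩
      have P3 := P2.fr F3
      have eb := P3.eb
      have d3 : h3.v .d = δ := by rw [F3.v _ rfl, a3]
      have m3 : h3.v .mk = max δ g.b := by rw [F3.v _ rfl, a5]
      have pw := P3.powb u hu
      have hl1 := dg_lt hb u x1
      have hl2 := dg_lt hb u x2
      have e1 : x1 / g.b ^ u % g.b = dg g.b u x1 := rfl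
      have e2 : x2 / g.b ^ u % g.b = dg g.b u x2 := rfl
      have s1 : x1 / g.b ^ u ≤ x1 := Nat.div_le_self _ _
      have s2 : x2 / g.b ^ u ≤ x2 := Nat.div_le_self _ _
      have s3 : x1 / g.b ^ u / g.b ≤ x1 / g.b ^ u := Nat.div_le_self _ _
      have s4 : x2 / g.b ^ u / g.b ≤ x2 / g.b ^ u := Nat.div_le_self _ _
      have hacc : enc g.b u (maxD g.b x1 x2 δ) + maxD g.b x1 x2 δ u * g.b ^ u ≤ X := by
        rw [← enc_succ]
        have h4 := enc_lt hb (k := u + 1) (f := maxD g.b x1 x2 δ) fun t _ => maxD_lt hb _ _ _ _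
        have h5 : g.b ^ (u + 1) ≤ g.C := Nat.pow_le_pow_right hb hu
        omega
      have hmx : maxD g.b x1 x2 δ u =
        max (δ + dg g.b u x1) (g.b + dg g.b u x2) - max δ g.b := rfl
      simp only [maxTabStep, Tr_seq, Tr_asg, Tr_ite, Tr_skip]
      simp [huv, b1, b2, b3, eb, d3, m3, pw, e1, e2, div_pow_succ, enc_succ]
      refine ⟨by omega, by omega, fun h4 => ?_, fun h4 => ?_⟩
      · rw [max_eq_right h4] at hmx
        rw [hmx] at hacc ⊢
        exact ⟨by omega, by omega, hacc, by omega, by omega, Or.inl rfl⟩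
      · rw [max_eq_left h4.le] at hmx
        rw [hmx] at hacc ⊢
        exact ⟨by omega, hacc, by omega, by omega, Or.inl rfl⟩
    rintro h3 F3 ⟨b1, b2, b3⟩ t3
    have et : h3.v .t = j := by
      rw [F3.v _ rfl, F2.v _ rfl]
      exact hjv
    have eT : h3.a .T1 = h1.a .T1 := by
      rw [F3.a _ rfl, F2.a _ rfl]
      rfl
    have h4 := enc_lt hb (k := g.b) (f := maxD g.b x1 x2 δ) fun t _ => maxD_lt hb _ _ _ _
    have h5 : g.b ^ g.b = g.C := rfl
    simp only [Tr_sto]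
    simp [et, b3, eT]
    refine ⟨by omega, fun i hi => ?_, by omega⟩
    rw [Function.update_apply]
    split_ifs with h6
    · rw [h6, hx1, hx2, hδ]
    · exact hI i (by omega)
  · intro h2 F hI ht
    refine ⟨hI, ?_⟩
    simp at ht ⊢
    nlinarith

/-- Decoding of a table index. -/
def runTabPre : Cm :=
  .x1 ≔ Var.t / 2 / Var.P2 ;; .mk ≔ Var.t / 2 % Var.P2 ;; .e ≔ Var.t % 2 ;; .acc ≔ 0 ;; .cm ≔ Var.e

/-- Computation of a digit of a table entry. -/
def runTabStep : Cm :=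
  .ux ≔ Var.x1 % Var.b ;; .ite (.le Var.ux Var.cm) (.ua ≔ Var.cm) (.ua ≔ Var.ux) ;;
  .acc ≔ Var.acc + (Var.ua - Var.e) * Arr.POWB Var.u ;;
  .ite (.eq (Var.mk % 2) 1) (.ite (.le Var.cm (Var.ux + 1)) (.cm ≔ Var.ux + 1) .skip) .skip ;;
  .x1 ≔ Var.x1 / Var.b ;; .mk ≔ Var.mk / 2

def runTabC : Cm :=
  .loop .t .sz2 (runTabPre ;; .loop .u .b runTabStep ;; .sto .T2 Var.t Var.acc ;;
    .sto .T3 Var.t Var.cm)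

/-- Contents of the tables of running maxima. -/
def RunTab (g : Pm) (T2 T3 : ℕ → ℕ) : Prop :=
  ∀ j < g.C * 2 ^ g.b * 2,
    T2 j = enc g.b g.b (runD g.b (j / 2 / 2 ^ g.b) (j / 2 % 2 ^ g.b) (j % 2)) ∧
    T3 j = runMax g.b (j / 2 / 2 ^ g.b) (j / 2 % 2 ^ g.b) (j % 2) g.b

theorem runTabC_spec {X : ℕ} {h : St} {g : Pm} (G : g.Good) (hX : g.St ^ 2 ≤ X) (P : Par g h) :
    Tr X runTabC h fun h' => RunTab g (h'.a .T2) (h'.a .T3) ∧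
      h'.time ≤ h.time + 128 * (g.M + 1) := by
  have hX1 : 16 * g.M + 64 ≤ X := by unfold Pm.St at hX; nlinarith
  have hC := G.C_le
  have hb := G.b_pos
  have hbC := G.b_le_C
  have hsz := G.sz2_le
  have hsz2 := G.sz2_mul_le
  have hbCM : g.b * g.C ≤ g.M + 1 := by
    have h1 := G.C_sq
    have h2 := G.C_pos
    have h3 : g.C ≤ g.C * g.C := Nat.le_mul_of_pos_left _ h2
    have h4 : g.C * g.C ≤ g.C * g.C * (g.C * g.C) := Nat.le_mul_of_pos_right _ (by nlinarith)
    nlinarith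
  refine Tr_loop (fun j h1 => ∀ i < j,
    h1.a .T2 i = enc g.b g.b (runD g.b (i / 2 / 2 ^ g.b) (i / 2 % 2 ^ g.b) (i % 2)) ∧
    h1.a .T3 i = runMax g.b (i / 2 / 2 ^ g.b) (i / 2 % 2 ^ g.b) (i % 2) g.b) (11 * g.b + 14)
    (g.C * 2 ^ g.b * 2) P.esz2 (by omega) (by decide) rfl rfl (by simp) ?_ ?_
  · intro j h1 hj F hjv hI
    have P1 := (P.fr F).tick
    obtain ⟨x, hx⟩ : ∃ x, x = j / 2 / 2 ^ g.b := ⟨_, rfl⟩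
    obtain ⟨mk, hmk⟩ : ∃ mk, mk = j / 2 % 2 ^ g.b := ⟨_, rfl⟩
    obtain ⟨e, he⟩ : ∃ e, e = j % 2 := ⟨_, rfl⟩
    have l0 : j / 2 ≤ j := Nat.div_le_self _ _
    have l1 : x ≤ j := hx ▸ (Nat.div_le_self _ _).trans l0
    have l2 : mk ≤ j := hmk ▸ (Nat.mod_le _ _).trans l0
    have l3 : e ≤ 1 := by omega
    simp only [Tr_seq]
    have first : Tr X runTabPre h1.tick fun h2 => h2.v .x1 = x ∧ h2.v .mk = mk ∧ h2.v .e = e ∧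
        h2.v .acc = 0 ∧ h2.v .cm = e ∧ h2.time ≤ h1.time + 7 := by
      have eP := P1.eP2
      simp only [St.tick_v] at eP
      simp only [runTabPre, Tr_seq, Tr_asg, Tr_ite]
      simp [hjv, eP, ← hx, ← hmk, ← he]
      omega
    refine first.mono ?_
    rintro h2 F2 ⟨a1, a2, a3, a4, a5, t2⟩
    have P2 := P1.fr F2
    refine Tr_loop (fun u h3 => h3.v .x1 = x / g.b ^ u ∧ h3.v .mk = mk / 2 ^ u ∧
      h3.v .acc = enc g.b u (runD g.b x mk e) ∧ h3.v .cm = runMax g.b x mk e u) 10 g.b P2.eb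
      (by omega) (by decide) rfl rfl (by simp [a1, a2, a4, a5, enc, runMax]) ?_ ?_
    · rintro u h3 hu F3 huv ⟨b1, b2, b3, b4⟩
      have P3 := P2.fr F3
      have eb := P3.eb
      have e3 : h3.v .e = e := by rw [F3.v _ rfl, a3]
      have pw := P3.powb u hu
      have hl1 := dg_lt hb u x
      have e1 : x / g.b ^ u % g.b = dg g.b u x := rfl
      have s1 : x / g.b ^ u ≤ x := Nat.div_le_self _ _
      have s2 : mk / 2 ^ u ≤ mk := Nat.div_le_self _ _
      have s3 : x / g.b ^ u / g.b ≤ x / g.b ^ u := Nat.div_le_self _ _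
      have s4 : mk / 2 ^ u / 2 ≤ mk / 2 ^ u := Nat.div_le_self _ _
      have hr := runMax_le hb x mk l3 u
      have hacc : enc g.b u (runD g.b x mk e) + runD g.b x mk e u * g.b ^ u ≤ X := by
        rw [← enc_succ]
        have h4 := enc_le hb (k := u + 1) (f := runD g.b x mk e) fun t _ => runD_le hb _ _ l3 _
        have h5 : (u + 1) * g.b ^ (u + 1) ≤ g.b * g.C :=
          Nat.mul_le_mul hu (Nat.pow_le_pow_right hb hu)
        omega
      have hmx : runD g.b x mk e u = max (dg g.b u x) (runMax g.b x mk e u) - e := rfl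
      have hrs : runMax g.b x mk e (u + 1) = if mk / 2 ^ u % 2 = 1 then
        max (runMax g.b x mk e u) (dg g.b u x + 1) else runMax g.b x mk e u := rfl
      simp only [runTabStep, Tr_seq, Tr_asg, Tr_ite, Tr_skip]
      simp [huv, b1, b2, b3, b4, eb, e3, pw, e1, div_pow_succ, enc_succ, hrs]
      refine ⟨by omega, fun h4 => ?_, fun h4 => ?_⟩
      · rw [max_eq_right h4] at hmx
        rw [hmx] at hacc ⊢
        exact ⟨by omega, by omega, hacc, fun h5 => ⟨fun h6 => ⟨by omega, by omega, by omega, Or.inl rfl,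
          by rw [if_pos h5, max_eq_right h6]⟩, fun h6 => ⟨by omega, by omega, Or.inl rfl,
          fun _ => by omega⟩⟩, fun h5 => ⟨by omega, by omega, Or.inl rfl, fun h6 => by omega⟩⟩
      · rw [max_eq_left h4.le] at hmx
        rw [hmx] at hacc ⊢
        exact ⟨by omega, by omega, hacc, fun h5 => ⟨fun h6 => ⟨by omega, by omega, by omega, Or.inl rfl,
          by rw [if_pos h5, max_eq_right h6]⟩, fun h6 => ⟨by omega, by omega, Or.inl rfl,
          fun _ => by omega⟩⟩, fun h5 => ⟨by omega, by omega, Or.inl rfl, fun h6 => by omega⟩⟩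
    rintro h3 F3 ⟨b1, b2, b3, b4⟩ t3
    have et : h3.v .t = j := by
      rw [F3.v _ rfl, F2.v _ rfl]
      exact hjv
    have eT : h3.a .T2 = h1.a .T2 := by
      rw [F3.a _ rfl, F2.a _ rfl]
      rfl
    have eT3 : h3.a .T3 = h1.a .T3 := by
      rw [F3.a _ rfl, F2.a _ rfl]
      rfl
    have h4 := enc_le hb (k := g.b) (f := runD g.b x mk e) fun t _ => runD_le hb _ _ l3 _
    have h5 : g.b ^ g.b = g.C := rfl
    have hr := runMax_le hb x mk l3 g.b
    rw [h5] at h4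
    simp only [Tr_sto]
    simp [et, b3, b4, eT, eT3]
    refine ⟨by omega, by omega, fun i hi => ?_, by omega⟩
    rw [Function.update_apply, Function.update_apply]
    split_ifs with h6
    · rw [h6, hx, hmk, he]
      exact ⟨rfl, rfl⟩
    · exact hI i (by omega)
  · intro h2 F hI ht
    refine ⟨hI, ?_⟩
    simp at ht ⊢
    nlinarith

/-! ### Blocks -/

/-- `A` and the code `c` represent the function `f` on the block `β`. -/
structure Cell (g : Pm) (f : ℕ → ℕ) (β A c : ℕ) : Prop where
  lt : c < g.C
  fst : A = f (β * g.b)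
  dig : ∀ t < g.b, f (β * g.b + t) = A + dg g.b t c

theorem Cell.look {g : Pm} (G : g.Good) {f : ℕ → ℕ} {p A c : ℕ} (H : Cell g f (p / g.b) A c) :
    A + c / g.b ^ (p % g.b) % g.b = f p := by
  have h := H.dig _ (Nat.mod_lt p G.b_pos)
  rw [mul_comm, Nat.div_add_mod] at h
  exact h.symm

/-- Digits are below b, so a block that starts at least b higher dominates the other one throughout.
-/
theorem Cell.merge_left {g : Pm} (G : g.Good) {f f' : ℕ → ℕ} {β A A' c c' : ℕ} (H : Cell g f β A c)
    (H' : Cell g f' β A' c') (hA : A' + g.b ≤ A) : Cell g (fun p => max (f p) (f' p)) β A c := by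
  have hb := G.b_pos
  refine ⟨H.lt, ?_, fun t ht => ?_⟩
  · have := H.fst
    have := H'.fst
    show A = max _ _
    omega
  · have := H.dig t ht
    have := H'.dig t ht
    have := dg_lt hb t c'
    show max _ _ = _
    omega

theorem Cell.merge_comm {g : Pm} {f f' : ℕ → ℕ} {β A c : ℕ}
    (H : Cell g (fun p => max (f p) (f' p)) β A c) : Cell g (fun p => max (f' p) (f p)) β A c := by
  simpa only [max_comm] using H

/-- Measured from A' - b, the two blocks have the values δ + digit and b + digit with δ = A + b -
A', and their maximum starts at max δ b. The shift by b keeps δ a natural number whichever block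
starts higher. -/
theorem Cell.merge {g : Pm} (G : g.Good) {f f' : ℕ → ℕ} {β A A' c c' : ℕ} (H : Cell g f β A c)
    (H' : Cell g f' β A' c') (h1 : A' < A + g.b) :
    Cell g (fun p => max (f p) (f' p)) β (max A A') (enc g.b g.b (maxD g.b c c' (A + g.b - A'))) := by
  have hb := G.b_pos
  have hd : ∀ t < g.b, maxD g.b c c' (A + g.b - A') t < g.b := fun t _ => maxD_lt hb _ _ _ _
  refine ⟨enc_lt hb hd, ?_, fun t ht => ?_⟩
  · have := H.fst
    have := H'.fst
    show max _ _ = max _ _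
    omega
  · have := H.dig t ht
    have := H'.dig t ht
    show max _ _ = _
    rw [dg, dig_enc hd ht]
    unfold maxD
    omega

open Classical in
theorem mask_bit {b t : ℕ} (ht : t < b) (P : ℕ → Prop) (β : ℕ) :
    mask b P β / 2 ^ t % 2 = if P (β * b + t) then 1 else 0 :=
  dig_enc (fun t _ => by split_ifs <;> omega) ht

/-- Only the maximum of `hmax` with the start value A is followed. This makes the computation
independent of A, so a table indexed by code, mask and carry can do it. -/
theorem runMax_hmax {g : Pm} {f : ℕ → ℕ} {β A c e : ℕ} (H : Cell g f β A c) (P : ℕ → Prop)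
    (he : max (hmax f P (β * g.b)) A = A + e) : ∀ t ≤ g.b,
      max (hmax f P (β * g.b + t)) A = A + runMax g.b c (mask g.b P β) e t := by
  intro t
  induction t with
  | zero => exact fun _ => he
  | succ t ih =>
    intro ht
    have h1 := ih (by omega)
    have h2 := H.dig t ht
    rw [runMax, mask_bit ht, ← add_assoc, hmax]
    by_cases h : P (β * g.b + t)
    · simp only [if_pos h, if_true]
      omega
    · simp only [if_neg h, zero_ne_one, if_false]
      omega

/-- The value h passed between blocks need not be `hmax`: anything between `hmax` and its maximum
with f serves, because only the maximum with the monotone f matters. Since `hmax` ≤ f + 1, the carry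
e is 0 or 1, and the resulting block starts at A + e. -/
theorem Cell.run {g : Pm} (G : g.Good) {f : ℕ → ℕ} {β A c h : ℕ} (H : Cell g f β A c)
    (P : ℕ → Prop) (hf : Monotone f) (hf' : ∀ p t, f (p + t) ≤ f p + t)
    (h1 : hmax f P (β * g.b) ≤ h) (h2 : h ≤ max (hmax f P (β * g.b)) (f (β * g.b))) {e : ℕ}
    (he : e = if A < h then 1 else 0) :
    Cell g (fun p => max (f p) (hmax f P p)) β (A + e)
      (enc g.b g.b (runD g.b c (mask g.b P β) e)) ∧
    hmax f P ((β + 1) * g.b) ≤ A + runMax g.b c (mask g.b P β) e g.b ∧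
    A + runMax g.b c (mask g.b P β) e g.b ≤
      max (hmax f P ((β + 1) * g.b)) (f ((β + 1) * g.b)) := by
  have hb := G.b_pos
  have h3 := hmax_le hf (msk := P) (β * g.b)
  have h4 := H.fst
  have he' : max (hmax f P (β * g.b)) A = A + e := by
    rw [he]
    split_ifs <;> omega
  have key := runMax_hmax H P he'
  have hd : ∀ t < g.b, runD g.b c (mask g.b P β) e t < g.b := by
    intro t ht
    have k1 := key t ht.le
    have k2 := H.dig t ht
    have k3 := hf' (β * g.b) t
    have k4 := hmax_le hf (msk := P) (β * g.b + t)
    have k5 := dg_lt hb t c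
    unfold runD
    by_cases h0 : t = 0
    · subst h0
      rw [add_zero] at *
      omega
    · have k6 : e ≤ 1 := by rw [he]; split_ifs <;> omega
      by_cases h5 : e = 1
      · omega
      -- Without a carry one unit has to be saved: `hmax` at offset t sees only positions up to t -
      -- 1, where f has risen by at most t - 1. The digit is thus at most t, hence below b.
      · have k7 : hmax f P (β * g.b + t) ≤ f (β * g.b + (t - 1)) + 1 := by
          obtain ⟨t', rfl⟩ : ∃ t', t = t' + 1 := ⟨t - 1, by omega⟩
          have k8 := hmax_le hf (msk := P) (β * g.b + t')
          rw [← add_assoc, hmax]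
          show _ ≤ f (β * g.b + t') + 1
          split_ifs <;> omega
        have := hf' (β * g.b) (t - 1)
        omega
  refine ⟨⟨enc_lt hb hd, ?_, fun t ht => ?_⟩, ?_, ?_⟩
  · show _ = max _ _
    omega
  · show max _ _ = _
    rw [dg, dig_enc hd ht]
    have k1 := key t ht.le
    have k2 := H.dig t ht
    have k6 : e ≤ runMax g.b c (mask g.b P β) e t :=
      (runMax_le hb _ _ (by rw [he]; split_ifs <;> omega) _).1
    unfold runD
    omega
  · have := key g.b le_rfl
    rw [show (β + 1) * g.b = β * g.b + g.b by ring]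
    omega
  · have := key g.b le_rfl
    rw [show (β + 1) * g.b = β * g.b + g.b by ring]
    have := hf (show β * g.b ≤ β * g.b + g.b by omega)
    omega

/-! ### Computing `below` from stored functions -/

namespace Env

variable {E : Env}

/-- The index of the function that, together with the list of the class, determines `below`. -/
def pre (E : Env) (i : ℕ) : ℕ := if E.Heavy (E.a i) then 2 * E.cls (E.a i) else 2 * E.cls (E.a i) - 1

theorem OK.cls_pos (K : E.OK) {i : ℕ} (hi : i < E.g.n) (hl : ¬ E.Heavy (E.a i)) :
    1 ≤ E.cls (E.a i) := K.pos i (by unfold Pm.M; omega) hl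

theorem OK.pre_le_below (K : E.OK) {i : ℕ} (hi : i < E.g.n) (p : ℕ) :
    E.G (E.pre i) i p ≤ E.below i p := by
  refine dpG_mono le_rfl le_rfl fun u _ hu => ?_
  by_contra hc
  have h1 := K.mono_a_bb hi (bb_le hu.1) (by omega)
  have h2 := hu.2
  unfold pre at h2
  split_ifs at h2 with h
  · rw [grp, if_pos h] at h1
    omega
  · have := K.cls_pos hi h
    rw [grp, if_neg h] at h1
    omega

theorem e_le_below {i p p' : ℕ} (h : p' < p) (hb : E.bb p' < E.a i) : E.e i p' ≤ E.below i p :=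
  le_pmax h hb

/-- A symbol smaller than a light a i either belongs to a group up to `pre` or is light and in the
class of a i. The second kind is what the scan of the class list inspects. -/
theorem OK.below_le (K : E.OK) {i p V : ℕ} (hi : i < E.g.n) (hl : ¬ E.Heavy (E.a i))
    (h1 : E.G (E.pre i) i p ≤ V)
    (h2 : ∀ p' < p, ¬ E.Heavy (E.bb p') → E.cls (E.bb p') = E.cls (E.a i) → E.bb p' < E.a i →
      E.e i p' ≤ V) : E.below i p ≤ V := by
  have hM := K.a_lt hi
  have hc := K.cls_pos hi hl
  refine pmax_le_iff.2 fun u hu hub => ?_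
  have hum : u < E.g.m := bb_le (by omega)
  have hg := K.mono_bb_a hi hum hub.le
  rw [show E.grp (E.a i) = 2 * E.cls (E.a i) by rw [grp, if_neg hl, add_zero]] at hg
  by_cases h3 : E.grp (E.bb u) ≤ E.pre i
  · exact (le_pmax hu (P := E.Upto (E.pre i)) ⟨by omega, h3⟩).trans h1
  · rw [pre, if_neg hl] at h3
    have h4 : ¬ E.Heavy (E.bb u) := by
      intro h
      rw [grp, if_pos h] at hg h3
      omega
    rw [grp, if_neg h4] at hg h3
    exact h2 u hu h4 (by omega) hub

end Env

/-! ### Rare symbols -/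

/-- The precomputed data. -/
structure Fix (E : Env) (cnt lst : ℕ → ℕ) (h : St) : Prop where
  ppar : Par E.g h
  eRK : h.a .RK = E.rk
  eH : h.a .H = E.H
  eCNT : h.a .CNT = cnt
  eLST : h.a .LST = lst
  lists : Lists E E.g.m cnt lst
  max : MaxTab E.g (h.a .T1)
  run : RunTab E.g (h.a .T2) (h.a .T3)

theorem Fix.fr {E : Env} {cnt lst : ℕ → ℕ} {h h' : St} {c : Cm} (P : Fix E cnt lst h)
    (F : Fr c h h')
    (hv : ∀ x ∈ [Var.n, .m, .M, .L, .q, .q1, .b, .s, .nb, .kk, .St, .Cc, .P2, .B2, .sz1, .sz2],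
      c.wv x = false := by decide)
    (ha : ∀ x ∈ [Arr.POWB, .POW2, .RK, .H, .CNT, .LST, .T1, .T2, .T3], c.wa x = false := by decide) :
    Fix E cnt lst h' := by
  have e2 : ∀ x ∈ [Arr.POWB, .POW2, .RK, .H, .CNT, .LST, .T1, .T2, .T3], h'.a x = h.a x :=
    fun x hx => F.a x (ha x hx)
  have hp := P.ppar.fr F hv fun x hx => ha x (by fin_cases hx <;> decide)
  obtain ⟨⟩ := P
  constructor <;> first
    | exact hp
    | assumption
    | (rw [e2 _ (by decide)]; assumption)
    | (rw [e2 _ (by decide), e2 _ (by decide)]; assumption)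

theorem Fix.tick {E : Env} {cnt lst : ℕ → ℕ} {h : St} (P : Fix E cnt lst h) :
    Fix E cnt lst h.tick := by
  obtain ⟨h1⟩ := P
  exact ⟨h1.tick, by assumption, by assumption, by assumption, by assumption, by assumption,
    by assumption, by assumption⟩

/-- The stored blocks of the rows up to `i`. -/
def Cells (E : Env) (i : ℕ) (ABS CODE : ℕ → ℕ) : Prop :=
  ∀ i' ≤ i, ∀ k < E.g.kk, ∀ β < E.g.nb, Cell E.g (E.G k i') β
    (ABS ((i' * E.g.St + k) * E.g.St + β)) (CODE ((i' * E.g.St + k) * E.g.St + β))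

/-- Evaluation of a stored function. -/
def lookC (i k p : Var) : Cm :=
  .o ≔ (i * Var.St + k) * Var.St + p / Var.b ;;
  .val ≔ Arr.ABS Var.o + Arr.CODE Var.o / Arr.POWB (p % Var.b) % Var.b

theorem Pm.Good.kk_lt {g : Pm} (G : g.Good) : g.kk < g.St := by
  have := G.q_le_b
  have := G.b_le_C
  have := G.C_le
  unfold Pm.kk Pm.St
  omega

theorem Pm.Good.nb_lt {g : Pm} (G : g.Good) : g.nb < g.St := by
  have := Nat.div_le_self g.m g.b
  unfold Pm.nb Pm.St Pm.M
  omega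

/-- The stored blocks are indexed by row, group and block with stride `St`; this is what makes a
cubic bound on all values necessary. -/
theorem cube_le {S i k β X : ℕ} (hX : S ^ 3 ≤ X) (hi : i < S) (hk : k < S) (hβ : β < S) :
    (i * S + k) * S + β < X := by
  refine lt_of_lt_of_le ?_ hX
  have h1 : i * S + k + 1 ≤ S * S := by nlinarith
  have h2 : (i * S + k + 1) * S ≤ S * S * S := Nat.mul_le_mul h1 le_rfl
  have h3 : S ^ 3 = S * S * S := by ring
  nlinarith

theorem sq_le_of_cube {S X : ℕ} (hX : S ^ 3 ≤ X) : S ^ 2 ≤ X := by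
  refine le_trans ?_ hX
  rcases Nat.eq_zero_or_pos S with rfl | h
  · simp
  · exact Nat.pow_le_pow_right h (by norm_num)

/-- The case p = m is included, which is why there are m / b + 1 blocks. -/
theorem lookC_spec {X : ℕ} {h : St} {E : Env} {I : ℕ} {i k p : Var} (K : E.OK)
    (hX : E.g.St ^ 3 ≤ X) (P : Par E.g h) (D : Cells E I (h.a .ABS) (h.a .CODE)) (hI : I ≤ E.g.n)
    (hi : h.v i ≤ I) (hk : h.v k < E.g.kk) (hp : h.v p ≤ E.g.m) (hpo : p ≠ .o) :
    Tr X (lookC i k p) h fun h' => h'.v .val = E.G (h.v k) (h.v i) (h.v p) ∧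
      h'.time ≤ h.time + 2 := by
  have hb := K.good.b_pos
  have hkk := K.good.kk_lt
  have hm : E.g.m < E.g.St := by unfold Pm.St Pm.M; omega
  have hn : E.g.n < E.g.St := by unfold Pm.St Pm.M; omega
  have hβ : h.v p / E.g.b < E.g.nb := Nat.lt_succ_of_le (Nat.div_le_div_right hp)
  have hβ' : h.v p / E.g.b < E.g.St := (Nat.div_le_self _ _).trans_lt (by omega)
  have hc := cube_le hX (show h.v i < E.g.St by omega) (show h.v k < E.g.St by omega) hβ'
  have hl := (D _ hi _ hk _ hβ).look K.good
  have hle := K.G_le (h.v k) (h.v i) (h.v p)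
  have hS : E.g.St ≤ E.g.St ^ 3 := Nat.le_self_pow (by norm_num) _
  have hpw := P.powb _ (Nat.mod_lt (h.v p) hb)
  simp only [lookC, Tr_seq, Tr_asg]
  simp [P.eSt, P.eb, hpo, hpw, hl]
  omega

/-- The parent of the match `(i, p)`. -/
def ParOK (E : Env) (i p v : ℕ) : Prop :=
  (v = 0 ∧ E.below i p = E.G (E.pre i) i p) ∨ ∃ i' < i, ∃ p' < p, E.a i' = E.bb p' ∧
    E.a i' < E.a i ∧ E.e (i' + 1) p' = E.below i p ∧ v = i' * E.g.St + p' + 1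

/-- The value of a column, and the row in which it is attained. -/
def RowL (E : Env) (i p lv lc : ℕ) : Prop :=
  lv = E.e i p ∧ (0 < lv → ∃ i' < i, E.a i' = E.bb p ∧ E.e (i' + 1) p = E.e i p ∧
    lc = i' * E.g.St + p + 1)

/-- The largest value of a column with smaller symbol among those inspected. -/
structure ScanC (E : Env) (L : ℕ → ℕ) (i z cur cc : ℕ) : Prop where
  le : ∀ z' < z, E.bb (L z') < E.a i → E.e i (L z') ≤ cur
  wit : cur = 0 ∨ ∃ z' < z, E.bb (L z') < E.a i ∧ ∃ i' < i, E.a i' = E.bb (L z') ∧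
    E.e (i' + 1) (L z') = cur ∧ E.e i (L z') = cur ∧ cc = i' * E.g.St + L z' + 1

/-- The state of the arrays during the treatment of row `i`. -/
structure ScanT (E : Env) (L : ℕ → ℕ) (i z : ℕ) (LV LC PAR MASK : ℕ → ℕ) : Prop where
  new : ∀ z' < z, RowL E (i + 1) (L z') (LV (L z')) (LC (L z'))
  old : ∀ p < E.g.m, ¬ E.Heavy (E.bb p) → (∀ z' < z, L z' ≠ p) → RowL E i p (LV p) (LC p)
  par : ∀ i' < i, ∀ p < E.g.m, E.a i' = E.bb p → ParOK E i' p (PAR (i' * E.g.St + p))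
  parn : ∀ z' < z, E.a i = E.bb (L z') → ParOK E i (L z') (PAR (i * E.g.St + L z'))
  parz : ∀ i' > i, ∀ p < E.g.m, PAR (i' * E.g.St + p) = 0
  mask : ∀ β < E.g.nb, MASK (2 * E.cls (E.a i) * E.g.St + β) =
    mask E.g.b (fun p => (∃ z' < z, L z' = p) ∧ E.Mark i p) β
  odd : HeavyMasks E E.g.m MASK

theorem RowL.succ {E : Env} {i p lv lc : ℕ} (H : RowL E i p lv lc) (h : E.a i ≠ E.bb p) :
    RowL E (i + 1) p lv lc := by
  have : E.e (i + 1) p = E.e i p := dpE_succ_of_ne h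
  refine ⟨this ▸ H.1, fun h0 => ?_⟩
  obtain ⟨i', h1, h2⟩ := H.2 h0
  exact ⟨i', by omega, by rw [this]; exact h2⟩

section scan

variable {E : Env} {L : ℕ → ℕ} {i z cur cc : ℕ} {LV LC PAR MASK : ℕ → ℕ}

theorem ScanC.skip (H : ScanC E L i z cur cc) (h : ¬ E.bb (L z) < E.a i ∨ E.e i (L z) ≤ cur) :
    ScanC E L i (z + 1) cur cc := by
  refine ⟨fun z' hz' hb => ?_, ?_⟩
  · rcases (show z' < z ∨ z' = z by omega) with h1 | rfl
    · exact H.le z' h1 hb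
    · tauto
  · rcases H.wit with h1 | ⟨z', h1, h2⟩
    · exact Or.inl h1
    · exact Or.inr ⟨z', by omega, h2⟩

theorem ScanC.push (H : ScanC E L i z cur cc) {lv lc : ℕ} (h : E.bb (L z) < E.a i) (hlt : cur < lv)
    (R : RowL E i (L z) lv lc) : ScanC E L i (z + 1) lv lc := by
  obtain ⟨i', h1, h2, h3, h4⟩ := R.2 (by omega)
  refine ⟨fun z' hz' hb => ?_, Or.inr ⟨z, by omega, h, i', h1, h2, h3.trans R.1.symm, R.1.symm, h4⟩⟩
  rcases (show z' < z ∨ z' = z by omega) with h5 | rfl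
  · exact (H.le z' h5 hb).trans hlt.le
  · exact R.1.ge

theorem mark_iff (E : Env) (i p : ℕ) (hl : ¬ E.Heavy (E.a i)) :
    E.Mark i p ↔ E.a i = E.bb p ∧ E.below i p = E.G (2 * E.cls (E.a i)) i p := by
  unfold Env.Mark
  rw [Env.grp, if_neg hl, add_zero]
  tauto

theorem ScanT.skip (H : ScanT E L i z LV LC PAR MASK) (hm : L z < E.g.m)
    (hl : ¬ E.Heavy (E.bb (L z))) (hL : ∀ z' < z, L z' ≠ L z) (h : E.a i ≠ E.bb (L z)) :
    ScanT E L i (z + 1) LV LC PAR MASK := by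
  refine ⟨fun z' hz' => ?_, fun p hp h1 h2 => H.old p hp h1 fun z' hz' => h2 z' (by omega), H.par,
    fun z' hz' he => ?_, H.parz, fun β hβ => ?_, H.odd⟩
  · rcases (show z' < z ∨ z' = z by omega) with h5 | rfl
    · exact H.new z' h5
    · exact (H.old _ hm hl hL).succ h
  · rcases (show z' < z ∨ z' = z by omega) with h5 | rfl
    · exact H.parn z' h5 he
    · exact absurd he h
  · rw [H.mask β hβ]
    refine mask_congr fun t _ => and_congr_left fun hM => ⟨?_, ?_⟩
    · rintro ⟨z', h1, h2⟩
      exact ⟨z', by omega, h2⟩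
    · rintro ⟨z', h1, h2⟩
      refine ⟨z', ?_, h2⟩
      rcases (show z' < z ∨ z' = z by omega) with h5 | rfl
      · exact h5
      · rw [h2] at h
        exact absurd hM.1 h

open Classical in
-- A match sets the value of its column to below + 1, attained in row i. The column has not been
-- visited before in this row, so its mark bit is still 0 and no earlier result is overwritten.
-- Masks of light rows use even rows of `MASK`, which leaves the heavy masks alone.
theorem ScanT.push (K : E.OK) (H : ScanT E L i z LV LC PAR MASK) (hi : i < E.g.n) (hm : L z < E.g.m)
    (hlm : ∀ z' < z, L z' < E.g.m)
    (hl : ¬ E.Heavy (E.bb (L z))) (hL : ∀ z' < z, L z' ≠ L z) (h : E.a i = E.bb (L z)) {v : ℕ}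
    (hv : ParOK E i (L z) v) :
    ScanT E L i (z + 1) (Function.update LV (L z) (E.below i (L z) + 1))
      (Function.update LC (L z) (i * E.g.St + L z + 1))
      (Function.update PAR (i * E.g.St + L z) v)
      (if E.Mark i (L z) then Function.update MASK (2 * E.cls (E.a i) * E.g.St + L z / E.g.b)
        (MASK (2 * E.cls (E.a i) * E.g.St + L z / E.g.b) + 2 ^ (L z % E.g.b)) else MASK) := by
  have hSt : E.g.m < E.g.St := by unfold Pm.St Pm.M; omega
  have hnb := K.good.nb_lt
  have hnbz : L z / E.g.b < E.g.nb := Nat.lt_succ_of_le (Nat.div_le_div_right hm.le)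
  refine ⟨fun z' hz' => ?_, fun p hp h1 h2 => ?_, fun i' hi' p hp hb => ?_, fun z' hz' he => ?_,
    fun i' hi' p hp => ?_, fun β hβ => ?_, fun c β hβ => ?_⟩
  · rcases (show z' < z ∨ z' = z by omega) with h5 | rfl
    · rw [Function.update_of_ne (hL z' h5), Function.update_of_ne (hL z' h5)]
      exact H.new z' h5
    · rw [Function.update_self, Function.update_self]
      have e1 : E.e (i + 1) (L z') = 1 + E.below i (L z') := dpE_succ_of_eq h
      exact ⟨by omega, fun _ => ⟨i, by omega, h, rfl, rfl⟩⟩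
  · have h3 : p ≠ L z := fun e => h2 z (by omega) e.symm
    rw [Function.update_of_ne h3, Function.update_of_ne h3]
    exact H.old p hp h1 fun z' hz' => h2 z' (by omega)
  · rw [Function.update_of_ne]
    · exact H.par i' hi' p hp hb
    · intro e
      have := (pair_inj (by omega) (by omega) e).1
      omega
  · rcases (show z' < z ∨ z' = z by omega) with h5 | rfl
    · rw [Function.update_of_ne]
      · exact H.parn z' h5 he
      · have := hL z' h5
        omega
    · rwa [Function.update_self]
  · rw [Function.update_of_ne]
    · exact H.parz i' hi' p hp
    · intro e
      have := (pair_inj (by omega) (by omega) e).1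
      omega
  · by_cases hM : E.Mark i (L z)
    · rw [if_pos hM]
      have key := mask_insert (b := E.g.b) (p := L z) K.good.b_pos
        (P := fun p => (∃ z' < z, L z' = p) ∧ E.Mark i p)
        (P' := fun p => (∃ z' < z + 1, L z' = p) ∧ E.Mark i p)
        (fun hc => by obtain ⟨⟨z', h1, h2⟩, _⟩ := hc; exact hL z' h1 h2)
        (fun p => by
          constructor
          · rintro ⟨⟨z', h1, h2⟩, h3⟩
            rcases (show z' < z ∨ z' = z by omega) with h5 | rfl
            · exact Or.inl ⟨⟨z', h5, h2⟩, h3⟩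
            · exact Or.inr h2.symm
          · rintro (⟨⟨z', h1, h2⟩, h3⟩ | rfl)
            · exact ⟨⟨z', by omega, h2⟩, h3⟩
            · exact ⟨⟨z, by omega, rfl⟩, hM⟩) β
      rw [key]
      split_ifs with h1
      · rw [h1, Function.update_self, H.mask _ hnbz]
      · rw [Function.update_of_ne, H.mask β hβ]
        omega
    · rw [if_neg hM, H.mask β hβ]
      refine mask_congr fun t _ => and_congr_left fun hM' => ⟨?_, ?_⟩
      · rintro ⟨z', h1, h2⟩
        exact ⟨z', by omega, h2⟩
      · rintro ⟨z', h1, h2⟩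
        refine ⟨z', ?_, h2⟩
        rcases (show z' < z ∨ z' = z by omega) with h5 | rfl
        · exact h5
        · rw [h2] at hM
          exact absurd hM' hM
  · rw [← H.odd c β hβ]
    split_ifs
    · rw [Function.update_of_ne]
      intro e
      have := (pair_inj (by omega) (by omega) e).1
      omega
    · rfl

end scan

def parC : Cm :=
  .ite (.lt Var.val Var.cur) (.d ≔ Var.cur + 1 ;; .par ≔ Var.cc) (.d ≔ Var.val + 1 ;; .par ≔ 0) ;;
  .sto .LV Var.p Var.d ;; .sto .LC Var.p (Var.i * Var.St + Var.p + 1) ;;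
  .sto .PAR (Var.i * Var.St + Var.p) Var.par

def markC : Cm :=
  .ite (.eq Var.d (Var.val + 1))
    (.sto .MASK (Var.g * Var.St + Var.p / Var.b)
      (Arr.MASK (Var.g * Var.St + Var.p / Var.b) + Arr.POW2 (Var.p % Var.b))) .skip

/-- Treatment of a match with a rare symbol. -/
def hitC : Cm := lookC .i .k0 .p ;; parC ;; lookC .i .g .p ;; markC

def scanStep : Cm :=
  .p ≔ Arr.LST (Var.c * Var.St + Var.z) ;; .y ≔ Arr.RK (Var.n + Var.p) ;;
  .ite (.lt Var.y Var.x)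
    (.ite (.lt Var.cur (Arr.LV Var.p)) (.cur ≔ Arr.LV Var.p ;; .cc ≔ Arr.LC Var.p) .skip)
    (.ite (.eq Var.y Var.x) hitC .skip)

/-- The variables that describe row `i` with a rare symbol. -/
structure RowV (E : Env) (i : ℕ) (h : St) : Prop where
  ei : h.v .i = i
  ex : h.v .x = E.a i
  ec : h.v .c = E.cls (E.a i)
  eg : h.v .g = 2 * E.cls (E.a i)
  ek : h.v .k0 = E.pre i

theorem RowV.fr {E : Env} {i : ℕ} {h h' : St} {c : Cm} (R : RowV E i h) (F : Fr c h h')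
    (hv : ∀ x ∈ [Var.i, .x, .c, .g, .k0], c.wv x = false := by decide) : RowV E i h' := by
  have e1 : ∀ x ∈ [Var.i, .x, .c, .g, .k0], h'.v x = h.v x := fun x hx => F.v x (hv x hx)
  obtain ⟨⟩ := R
  constructor <;> (rw [e1 _ (by decide)]; assumption)

theorem RowV.tick {E : Env} {i : ℕ} {h : St} (R : RowV E i h) : RowV E i h.tick := by
  obtain ⟨⟩ := R; constructor <;> assumption

section

variable {X : ℕ} {h : St} {E : Env} {cnt lst : ℕ → ℕ} {i : ℕ}

theorem e_le (E : Env) (i p : ℕ) : E.e i p ≤ p + 1 := by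
  have h1 : E.e i p ≤ _ := dpE_le E.a E.bb i p
  have h2 := dpG_add_right_le (a := E.a) (bb := E.bb) (i := i) (p := 0) (P := (· < E.bb p))
    (fun _ _ x y => lt_trans x y) p
  rw [zero_add, dpG_zero_right] at h2
  omega

/-- The class list is increasing, so its entries before z are exactly the light columns of the class
in front of the current column. The witness in `ScanC` gives the reverse inequality. -/
theorem below_cases (K : E.OK) (hi : i < E.g.n) (hl : ¬ E.Heavy (E.a i))
    (HL : Lists E E.g.m cnt lst) {z cur cc : ℕ} (hz : z < cnt (E.cls (E.a i)))
    (SC : ScanC E (fun z => lst (E.cls (E.a i) * E.g.St + z)) i z cur cc) :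
    E.below i (lst (E.cls (E.a i) * E.g.St + z)) =
      max (E.G (E.pre i) i (lst (E.cls (E.a i) * E.g.St + z))) cur := by
  have hM := K.a_lt hi
  refine le_antisymm (K.below_le hi hl (le_max_left _ _) fun p' hp' h1 h2 h3 => ?_) (max_le ?_ ?_)
  · obtain ⟨z', hz', e⟩ := HL.all p' (Env.bb_le (by omega)) h1
    rw [h2] at hz' e
    refine le_trans ?_ (le_max_right _ _)
    rw [← e]
    refine SC.le z' ?_ (by rw [← e] at h3; exact h3)
    by_contra hc
    rcases (show z = z' ∨ z < z' by omega) with rfl | h5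
    · omega
    · have := HL.mono _ z z' h5 hz'
      omega
  · exact K.pre_le_below hi _
  · rcases SC.wit with h0 | ⟨z', h1, h2, _, _, _, _, h3, _⟩
    · omega
    · rw [← h3]
      exact Env.e_le_below (HL.mono _ z' z h1 hz) h2

theorem ScanC.parOK (hl : ¬ E.Heavy (E.a i))
    (HL : Lists E E.g.m cnt lst) {z cur cc : ℕ} (hz : z < cnt (E.cls (E.a i)))
    (SC : ScanC E (fun z => lst (E.cls (E.a i) * E.g.St + z)) i z cur cc) (h0 : 0 < cur)
    (h1 : E.below i (lst (E.cls (E.a i) * E.g.St + z)) = cur) :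
    ParOK E i (lst (E.cls (E.a i) * E.g.St + z)) cc := by
  rcases SC.wit with h2 | ⟨z', h2, h3, i', h4, h5, h6, h7, h8⟩
  · omega
  · exact Or.inr ⟨i', h4, _, HL.mono _ z' z h2 hz, h5, h5 ▸ h3, h6.trans h1.symm, h8⟩

theorem hitC_spec (K : E.OK) (hX : E.g.St ^ 3 ≤ X) (hi : i < E.g.n) (hl : ¬ E.Heavy (E.a i))
    (P : Fix E cnt lst h) (R : RowV E i h) (D : Cells E i (h.a .ABS) (h.a .CODE)) {z p : ℕ}
    (hz : z < cnt (E.cls (E.a i))) (hpz : p = lst (E.cls (E.a i) * E.g.St + z))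
    (hp : h.v .p = p) (hb : E.a i = E.bb p)
    (SC : ScanC E (fun z => lst (E.cls (E.a i) * E.g.St + z)) i z (h.v .cur) (h.v .cc))
    (hcc : h.v .cc ≤ X)
    (T : ScanT E (fun z => lst (E.cls (E.a i) * E.g.St + z)) i z (h.a .LV) (h.a .LC) (h.a .PAR)
      (h.a .MASK)) :
    Tr X hitC h fun h' =>
      ScanT E (fun z => lst (E.cls (E.a i) * E.g.St + z)) i (z + 1) (h'.a .LV) (h'.a .LC)
        (h'.a .PAR) (h'.a .MASK) ∧ h'.time ≤ h.time + 12 := by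
  classical
  have hm : E.g.m < E.g.St := by unfold Pm.St Pm.M; omega
  have hn : E.g.n < E.g.St := by unfold Pm.St Pm.M; omega
  have hmM : E.g.m ≤ E.g.M := by unfold Pm.M; omega
  have hX2 := sq_le_of_cube hX
  have hX1 : 16 * E.g.M + 64 ≤ X := by unfold Pm.St at hX2; nlinarith
  have hM := K.a_lt hi
  have hcl := E.cls_le K.good hM
  have hpos := K.cls_pos hi hl
  have hpm : p < E.g.m := Env.bb_le (by omega)
  have hb1 := K.good.b_pos
  have hpre : E.pre i < E.g.kk := by unfold Env.pre Pm.kk; rw [if_neg hl]; omega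
  have hg : 2 * E.cls (E.a i) < E.g.kk := by unfold Pm.kk; omega
  have hbel := below_cases K hi hl P.lists hz SC
  have hcode : i * E.g.St + p + 1 ≤ X := by nlinarith
  rw [← hpz] at hbel
  simp only [hitC, Tr_seq]
  refine (lookC_spec (i := .i) (k := .k0) (p := .p) K hX P.ppar D hi.le R.ei.le
    (by rw [R.ek]; exact hpre) (by rw [hp]; omega) (by decide)).mono ?_
  rintro h1 F1 ⟨v1, t1⟩
  rw [R.ek, R.ei, hp] at v1
  have P1 := P.fr F1
  have R1 := R.fr F1
  have ecur : h1.v .cur = h.v .cur := F1.v _ rfl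
  have ecc : h1.v .cc = h.v .cc := F1.v _ rfl
  have ep : h1.v .p = p := by rw [F1.v _ rfl, hp]
  have hle := K.G_le (E.pre i) i p
  have hcurX : h.v .cur ≤ p := by
    rcases SC.wit with h0 | ⟨z', a1, _, _, _, _, _, a2, _⟩
    · omega
    · have a3 := P.lists.mono _ z' z a1 hz
      have a4 := e_le E i (lst (E.cls (E.a i) * E.g.St + z'))
      omega
  -- Parent 0 stands for the function with index `pre`. A pointer is stored only if the scan is
  -- strictly better, and then `below` equals `cur`.
  have first : Tr X parC h1 fun h2 => h2.v .d = E.below i p + 1 ∧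
      h2.a .LV = Function.update (h1.a .LV) p (E.below i p + 1) ∧
      h2.a .LC = Function.update (h1.a .LC) p (i * E.g.St + p + 1) ∧
      (∃ v, ParOK E i p v ∧ h2.a .PAR = Function.update (h1.a .PAR) (i * E.g.St + p) v) ∧
      h2.time ≤ h1.time + 6 := by
    simp only [parC, Tr_seq, Tr_ite, Tr_asg, Tr_sto]
    simp [v1, ecur, ecc, ep, R1.ei, P1.ppar.eSt]
    refine ⟨fun h3 => ?_, fun h3 => ?_⟩
    · have e : h.v .cur = E.below i p := by omega
      rw [e]
      refine ⟨by omega, hcc, by omega, hcode, hcc, rfl, rfl, _, ?_, rfl⟩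
      rw [hpz] at e ⊢
      exact SC.parOK hl P.lists hz (by omega) e.symm
    · have e : E.G (E.pre i) i p = E.below i p := by omega
      rw [e]
      exact ⟨by omega, by omega, rfl, rfl, _, Or.inl ⟨rfl, e.symm⟩, rfl⟩
  refine first.mono ?_
  rintro h2 F2 ⟨d2, l2, c2, ⟨v, hv, p2⟩, t2⟩
  have P2 := P1.fr F2
  have R2 := R1.fr F2
  have ep2 : h2.v .p = p := by rw [F2.v _ rfl, ep]
  have D2 : Cells E i (h2.a .ABS) (h2.a .CODE) := by
    rwa [F2.a _ rfl, F2.a _ rfl, F1.a _ rfl, F1.a _ rfl]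
  refine (lookC_spec (i := .i) (k := .g) (p := .p) K hX P2.ppar D2 hi.le R2.ei.le
    (by rw [R2.eg]; exact hg) (by rw [ep2]; omega) (by decide)).mono ?_
  rintro h3 F3 ⟨v3, t3⟩
  rw [R2.eg, R2.ei, ep2] at v3
  have P3 := P2.fr F3
  have R3 := R2.fr F3
  have ep3 : h3.v .p = p := by rw [F3.v _ rfl, ep2]
  have d3 : h3.v .d = E.below i p + 1 := by rw [F3.v _ rfl, d2]
  have l3 : h3.a .LV = Function.update (h.a .LV) p (E.below i p + 1) := by
    rw [F3.a _ rfl, l2, F1.a _ rfl]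
  have c3 : h3.a .LC = Function.update (h.a .LC) p (i * E.g.St + p + 1) := by
    rw [F3.a _ rfl, c2, F1.a _ rfl]
  have p3 : h3.a .PAR = Function.update (h.a .PAR) (i * E.g.St + p) v := by
    rw [F3.a _ rfl, p2, F1.a _ rfl]
  have m3 : h3.a .MASK = h.a .MASK := by rw [F3.a _ rfl, F2.a _ rfl, F1.a _ rfl]
  have push := T.push K hi (show _ < E.g.m by rw [← hpz]; exact hpm)
    (fun z' hz' => (P.lists.mem _ z' (hz'.trans hz)).1) (P.lists.mem _ z hz).2.2
    (fun z' hz' => (P.lists.mono _ z' z hz' hz).ne) (hpz ▸ hb) (hpz ▸ hv)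
  simp only [← hpz] at push
  have hbit := Nat.mod_lt p hb1
  have hmk := T.mask (p / E.g.b) (Nat.lt_succ_of_le (Nat.div_le_div_right hpm.le))
  have hmk2 := mask_lt E.g.b (fun p => (∃ z' < z, lst (E.cls (E.a i) * E.g.St + z') = p) ∧ E.Mark i p)
    (p / E.g.b)
  have h2b := K.good.two_pow_le
  have hC := K.good.C_le
  have hpw := Nat.pow_le_pow_right (show 0 < 2 by norm_num) hbit.le
  simp only [markC, Tr_ite, Tr_sto, Tr_skip]
  simp [d3, v3, R3.eg, P3.ppar.eSt, P3.ppar.eb, ep3, l3, c3, p3, m3, P3.ppar.pow2 _ hbit]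
  refine ⟨fun h4 => ⟨by omega, ?_, by omega⟩, fun h4 => ⟨?_, by omega⟩⟩
  · rw [if_pos ((mark_iff E i p hl).2 ⟨hb, h4⟩)] at push
    exact push
  · rw [if_neg fun hc => h4 ((mark_iff E i p hl).1 hc).2] at push
    exact push

theorem scanStep_spec (K : E.OK) (hX : E.g.St ^ 3 ≤ X) (hi : i < E.g.n) (hl : ¬ E.Heavy (E.a i))
    (P : Fix E cnt lst h) (R : RowV E i h) (D : Cells E i (h.a .ABS) (h.a .CODE)) {z : ℕ}
    (hz : z < cnt (E.cls (E.a i))) (hvz : h.v .z = z)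
    (SC : ScanC E (fun z => lst (E.cls (E.a i) * E.g.St + z)) i z (h.v .cur) (h.v .cc))
    (hcc : h.v .cc ≤ X)
    (T : ScanT E (fun z => lst (E.cls (E.a i) * E.g.St + z)) i z (h.a .LV) (h.a .LC) (h.a .PAR)
      (h.a .MASK)) :
    Tr X scanStep h fun h' =>
      ScanC E (fun z => lst (E.cls (E.a i) * E.g.St + z)) i (z + 1) (h'.v .cur) (h'.v .cc) ∧
      h'.v .cc ≤ X ∧
      ScanT E (fun z => lst (E.cls (E.a i) * E.g.St + z)) i (z + 1) (h'.a .LV) (h'.a .LC)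
        (h'.a .PAR) (h'.a .MASK) ∧ h'.time ≤ h.time + 16 := by
  have hm : E.g.m < E.g.St := by unfold Pm.St Pm.M; omega
  have hn : E.g.n < E.g.St := by unfold Pm.St Pm.M; omega
  have hmM : E.g.m ≤ E.g.M := by unfold Pm.M; omega
  have hX2 := sq_le_of_cube hX
  have hX1 : 16 * E.g.M + 64 ≤ X := by unfold Pm.St at hX2; nlinarith
  have hM := K.a_lt hi
  have hmem := P.lists.mem _ z hz
  have hL : ∀ z' < z, lst (E.cls (E.a i) * E.g.St + z') ≠ lst (E.cls (E.a i) * E.g.St + z) :=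
    fun z' hz' => (P.lists.mono _ z' z hz' hz).ne
  have hskip := fun he => T.skip hmem.1 hmem.2.2 hL he
  -- Column z has not been visited in this row, so its stored value is still that of row i.
  have hpush := fun hb hlt => SC.push (z := z) hb hlt (T.old _ hmem.1 hmem.2.2 hL)
  have hbX : ∀ lv lc, RowL E i (lst (E.cls (E.a i) * E.g.St + z)) lv lc → lv ≤ X ∧ (0 < lv → lc ≤ X) := by
    intro lv lc H
    have := e_le E i (lst (E.cls (E.a i) * E.g.St + z))
    refine ⟨by rw [H.1]; omega, fun h0 => ?_⟩
    obtain ⟨i', h1, _, _, h2⟩ := H.2 h0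
    rw [h2]
    nlinarith
  have hold := hbX _ _ (T.old _ hmem.1 hmem.2.2 hL)
  have hrk := Env.bb_of_lt hmem.1
  have hbM := K.bb_lt hmem.1
  have hli := (T.old _ hmem.1 hmem.2.2 hL).1
  obtain ⟨p, hp⟩ : ∃ p, lst (E.cls (E.a i) * E.g.St + z) = p := ⟨_, rfl⟩
  simp only [hp] at hmem hskip hpush hold hrk hbM hli
  simp only [scanStep, Tr_seq, Tr_ite, Tr_asg, Tr_skip]
  simp [R.ec, R.ex, hvz, P.ppar.eSt, P.eLST, P.ppar.en, P.eRK, hp, ← hrk]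
  refine ⟨by omega, by omega, fun h1 => ⟨fun h2 => ⟨hold.1, hold.2 (by omega), hpush h1 h2,
    hold.2 (by omega), hskip (by omega)⟩, fun h2 => ⟨SC.skip (Or.inr ?_), hcc, hskip (by omega)⟩⟩, fun h1 => ⟨fun h2 => ?_,
    fun h2 => ⟨SC.skip (Or.inl ?_), hcc, hskip (by omega)⟩⟩⟩
  · simp only [hp, ← hli]
    exact h2
  · refine (hitC_spec (h := ((h.set .p p).set .y (E.bb p)).tick.tick) (p := p) K hX hi hl ?_ ?_ D hz hp.symm ?_ h2.symm ?_ ?_ T).mono ?_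
    · exact P.fr (c := (.p ≔ 0) ;; (.y ≔ 0)) ⟨fun x hx => by
        simp [Cm.wv] at hx; simp [hx], fun _ _ => rfl, fun _ => rfl⟩
    · exact R.fr (c := (.p ≔ 0) ;; (.y ≔ 0)) ⟨fun x hx => by
        simp [Cm.wv] at hx; simp [hx], fun _ _ => rfl, fun _ => rfl⟩
    · simp
    · simpa using SC
    · simpa using hcc
    · rintro h' F ⟨a1, a2⟩
      have e1 : h'.v .cur = h.v .cur := by rw [F.v _ rfl]; simp
      have e2 : h'.v .cc = h.v .cc := by rw [F.v _ rfl]; simp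
      rw [e1, e2]
      refine ⟨SC.skip (Or.inl ?_), hcc, a1, ?_⟩
      · simp only [hp]
        omega
      · simp at a2
        omega
  · simp only [hp]
    omega

end

/-- The values of the columns and the parents, after the treatment of `i` rows. -/
structure Lows (E : Env) (i : ℕ) (LV LC PAR : ℕ → ℕ) : Prop where
  low : ∀ p < E.g.m, ¬ E.Heavy (E.bb p) → RowL E i p (LV p) (LC p)
  par : ∀ i' < i, ∀ p < E.g.m, E.a i' = E.bb p → ParOK E i' p (PAR (i' * E.g.St + p))
  parz : ∀ i' ≥ i, ∀ p < E.g.m, PAR (i' * E.g.St + p) = 0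

/-- The masks of row `i`. -/
def RowMask (E : Env) (i : ℕ) (MASK : ℕ → ℕ) : Prop :=
  ∀ β < E.g.nb, MASK (E.grp (E.a i) * E.g.St + β) = mask E.g.b (E.Mark i) β

section

variable {X : ℕ} {h : St} {E : Env} {cnt lst : ℕ → ℕ} {i : ℕ} {LV LC PAR MASK : ℕ → ℕ}

/-- A heavy row writes nothing here: light columns do not match it, and the untouched parent 0 is
correct because `below` is the function with index `pre`. -/
theorem Lows.heavy (K : E.OK) (H : Lows E i LV LC PAR) (hi : i < E.g.n) (hv : E.Heavy (E.a i)) :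
    Lows E (i + 1) LV LC PAR := by
  refine ⟨fun p hp hl => (H.low p hp hl).succ fun e => hl (e ▸ hv), fun i' hi' p hp hb => ?_,
    fun i' hi' p hp => H.parz i' (by omega) p hp⟩
  rcases (show i' < i ∨ i' = i by omega) with h1 | rfl
  · exact H.par i' h1 p hp hb
  · refine Or.inl ⟨H.parz i' le_rfl p hp, ?_⟩
    rw [K.below_eq hi hv, Env.pre, if_pos hv, Env.bas]

/-- Every match of a heavy symbol is marked, whatever the row, and the symbol is alone in its group.
One mask computed in advance therefore serves all its rows. -/
theorem HeavyMasks.rowMask (H : HeavyMasks E E.g.m MASK) (hb : E.g.nb ≤ E.g.St)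
    (hM : E.a i < E.g.M) (hv : E.Heavy (E.a i)) : RowMask E i MASK := by
  intro β hβ
  rw [show E.grp (E.a i) = 2 * E.cls (E.a i) + 1 by rw [Env.grp, if_pos hv],
    H _ β (by omega)]
  refine mask_congr fun t _ => ⟨fun ⟨h1, h2, h3⟩ => ?_, fun ⟨h1, h2⟩ => ?_⟩
  · have := Env.heavy_inj hv (v' := E.bb (β * E.g.b + t))
      (by rw [Env.grp, Env.grp, if_pos hv, if_pos h2, h3])
    exact ⟨this, Or.inl hv⟩
  · exact ⟨Env.bb_le (by omega), h1 ▸ hv, by rw [h1]⟩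

theorem Lows.scanT (H : Lows E i LV LC PAR) (HM : HeavyMasks E E.g.m MASK)
    (h0 : ∀ β < E.g.nb, MASK (2 * E.cls (E.a i) * E.g.St + β) = 0) (L : ℕ → ℕ) :
    ScanT E L i 0 LV LC PAR MASK := by
  refine ⟨by simp, fun p hp hl _ => H.low p hp hl, H.par, by simp,
    fun i' hi' p hp => H.parz i' (by omega) p hp, fun β hβ => ?_, HM⟩
  rw [h0 β hβ, mask_eq_zero]
  simp

theorem ScanT.lows (K : E.OK) (HL : Lists E E.g.m cnt lst) (hi : i < E.g.n)
    (hl : ¬ E.Heavy (E.a i))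
    (T : ScanT E (fun z => lst (E.cls (E.a i) * E.g.St + z)) i (cnt (E.cls (E.a i))) LV LC PAR MASK) :
    Lows E (i + 1) LV LC PAR ∧ RowMask E i MASK := by
  have hM := K.a_lt hi
  have hin : ∀ p, E.a i = E.bb p →
      ∃ z < cnt (E.cls (E.a i)), lst (E.cls (E.a i) * E.g.St + z) = p := by
    intro p hp
    rw [hp] at hl hM ⊢
    exact HL.all p (Env.bb_le (by omega)) hl
  refine ⟨⟨fun p hp hlp => ?_, fun i' hi' p hp hb => ?_, T.parz⟩, fun β hβ => ?_⟩
  · by_cases h1 : ∃ z < cnt (E.cls (E.a i)), lst (E.cls (E.a i) * E.g.St + z) = p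
    · obtain ⟨z, hz, rfl⟩ := h1
      exact T.new z hz
    · refine (T.old p hp hlp fun z hz e => h1 ⟨z, hz, e⟩).succ fun e => h1 (hin p e)
  · rcases (show i' < i ∨ i' = i by omega) with h1 | rfl
    · exact T.par i' h1 p hp hb
    · obtain ⟨z, hz, rfl⟩ := hin p hb
      exact T.parn z hz hb
  · rw [Env.grp, if_neg hl, add_zero, T.mask β hβ]
    exact mask_congr fun t _ => ⟨fun h => h.2, fun h => ⟨hin _ h.1, h⟩⟩

/-! ### Processing a row with a light symbol -/

def clearC : Cm := .loop .w .nb (.sto .MASK (Var.g * Var.St + Var.w) 0)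

def initC : Cm := .cur ≔ 0 ;; .cc ≔ 0 ;; .k0 ≔ Var.g - 1 ;; .u ≔ Arr.CNT Var.c

/-- Treatment of a row with a rare symbol. -/
def lightC : Cm := clearC ;; initC ;; .loop .z .u scanStep

theorem lightC_spec (K : E.OK) (hX : E.g.St ^ 3 ≤ X) (hi : i < E.g.n) (hl : ¬ E.Heavy (E.a i))
    (P : Fix E cnt lst h) (D : Cells E i (h.a .ABS) (h.a .CODE)) (e1 : h.v .i = i)
    (e2 : h.v .x = E.a i) (e3 : h.v .c = E.cls (E.a i)) (e4 : h.v .g = 2 * E.cls (E.a i))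
    (HL : Lows E i (h.a .LV) (h.a .LC) (h.a .PAR)) (HM : HeavyMasks E E.g.m (h.a .MASK)) :
    Tr X lightC h fun h' => Lows E (i + 1) (h'.a .LV) (h'.a .LC) (h'.a .PAR) ∧
      RowMask E i (h'.a .MASK) ∧ HeavyMasks E E.g.m (h'.a .MASK) ∧
      h'.time ≤ h.time + 18 * E.g.s + 3 * E.g.nb + 10 := by
  have hnb := K.good.nb_lt
  have hX2 := sq_le_of_cube hX
  have hSX : E.g.St ≤ X := by nlinarith
  have hM := K.a_lt hi
  have hcl := E.cls_le K.good hM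
  have hpos := K.cls_pos hi hl
  have hcnt := P.lists.cnt (E.cls (E.a i))
  have hcnts := P.lists.cnt_le K (E.cls (E.a i))
  have hm : E.g.m < E.g.St := by unfold Pm.St Pm.M; omega
  have hkk := K.good.kk_lt
  unfold Pm.kk at hkk
  simp only [lightC, Tr_seq]
  have first : Tr X clearC h fun h1 => (∀ β < E.g.nb, h1.a .MASK (2 * E.cls (E.a i) * E.g.St + β) = 0) ∧
      HeavyMasks E E.g.m (h1.a .MASK) ∧ h1.time ≤ h.time + 2 + 3 * E.g.nb := by
    refine Tr_loop (fun j h1 => (∀ β < j, h1.a .MASK (2 * E.cls (E.a i) * E.g.St + β) = 0) ∧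
      HeavyMasks E E.g.m (h1.a .MASK)) 2 E.g.nb P.ppar.enb (by omega) (by decide) rfl rfl ?_ ?_ ?_
    · exact ⟨by simp, HM⟩
    · rintro j h1 hj F hw ⟨I1, I2⟩
      have P1 := P.fr F
      have e5 : h1.v .g = 2 * E.cls (E.a i) := by rw [F.v _ rfl, e4]
      rw [Tr_sto]
      simp [hw, e5, P1.ppar.eSt]
      refine ⟨fun β hβ => ?_, fun c β hβ => ?_⟩
      · rw [Function.update_apply]
        split_ifs with h2
        · rfl
        · exact I1 β (by omega)
      -- Clearing affects the even row 2·cls, whereas heavy masks occupy odd rows.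
      · rw [Function.update_of_ne, I2 c β hβ]
        intro e
        have := (pair_inj (by omega) (by omega) e).1
        omega
    · rintro h1 F ⟨I1, I2⟩ ht
      refine ⟨I1, I2, ?_⟩
      simp at ht ⊢
      omega
  refine first.mono ?_
  rintro h1 F1 ⟨I1, I2, t1⟩
  have P1 := P.fr F1
  have T1 := Lows.scanT (LV := h1.a .LV) (LC := h1.a .LC) (PAR := h1.a .PAR)
    (by rwa [F1.a _ rfl, F1.a _ rfl, F1.a _ rfl]) I2 I1 fun z => lst (E.cls (E.a i) * E.g.St + z)
  have second : Tr X initC h1 fun h2 => h2.v .cur = 0 ∧ h2.v .cc = 0 ∧ h2.v .k0 = E.pre i ∧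
      h2.v .u = cnt (E.cls (E.a i)) ∧ h2.time ≤ h1.time + 4 := by
    have e5 : h1.v .g = 2 * E.cls (E.a i) := by rw [F1.v _ rfl, e4]
    have e6 : h1.v .c = E.cls (E.a i) := by rw [F1.v _ rfl, e3]
    simp only [initC, Tr_seq, Tr_asg]
    simp [e5, e6, P1.eCNT, Env.pre, if_neg hl]
    omega
  refine second.mono ?_
  rintro h2 F2 ⟨a1, a2, a3, a4, t2⟩
  have P2 := P1.fr F2
  have R2 : RowV E i h2 := ⟨by rw [F2.v _ rfl, F1.v _ rfl, e1], by rw [F2.v _ rfl, F1.v _ rfl, e2],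
    by rw [F2.v _ rfl, F1.v _ rfl, e3], by rw [F2.v _ rfl, F1.v _ rfl, e4], a3⟩
  have D2 : Cells E i (h2.a .ABS) (h2.a .CODE) := by
    rwa [F2.a _ rfl, F2.a _ rfl, F1.a _ rfl, F1.a _ rfl]
  refine Tr_loop (fun z h3 =>
    ScanC E (fun z => lst (E.cls (E.a i) * E.g.St + z)) i z (h3.v .cur) (h3.v .cc) ∧ h3.v .cc ≤ X ∧
    ScanT E (fun z => lst (E.cls (E.a i) * E.g.St + z)) i z (h3.a .LV) (h3.a .LC) (h3.a .PAR)
      (h3.a .MASK)) 17 (cnt (E.cls (E.a i))) a4 (by omega) (by decide) rfl rfl ?_ ?_ ?_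
  · refine ⟨?_, ?_, ?_⟩
    · refine ⟨by simp, Or.inl ?_⟩
      simpa using a1
    · simp [a2]
    · show ScanT E _ i 0 (h2.a .LV) (h2.a .LC) (h2.a .PAR) (h2.a .MASK)
      rwa [F2.a _ rfl, F2.a _ rfl, F2.a _ rfl, F2.a _ rfl]
  · rintro z h3 hz F3 hvz ⟨J1, J2, J3⟩
    have P3 := (P2.fr F3).tick
    have D3 : Cells E i (h3.a .ABS) (h3.a .CODE) := by rwa [F3.a _ rfl, F3.a _ rfl]
    refine (scanStep_spec (h := h3.tick) K hX hi hl P3 (R2.fr F3).tick D3 hz hvz J1 J2 J3).mono ?_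
    rintro h4 F4 ⟨b1, b2, b3, t4⟩
    refine ⟨⟨by simpa using b1, by simpa using b2, b3⟩, ?_⟩
    simp at t4
    omega
  · rintro h3 F3 ⟨J1, J2, J3⟩ t3
    have := J3.lows K P.lists hi hl
    refine ⟨this.1, this.2, J3.odd, ?_⟩
    simp only [St.tick_time] at t3 ⊢
    omega

def headC : Cm :=
  .x ≔ Arr.RK Var.i ;; .c ≔ (Var.x + Var.s - 1) / Var.s ;; .bs ≔ 2 * Var.c ;;
  .ite (.eq (Arr.H Var.c) Var.x) (.g ≔ 2 * Var.c + 1) (.g ≔ 2 * Var.c ;; lightC)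

theorem headC_spec (K : E.OK) (hX : E.g.St ^ 3 ≤ X) (hi : i < E.g.n)
    (P : Fix E cnt lst h) (D : Cells E i (h.a .ABS) (h.a .CODE)) (e1 : h.v .i = i)
    (HL : Lows E i (h.a .LV) (h.a .LC) (h.a .PAR)) (HM : HeavyMasks E E.g.m (h.a .MASK)) :
    Tr X headC h fun h' => h'.v .bs = E.bas i ∧ h'.v .g = E.grp (E.a i) ∧
      Lows E (i + 1) (h'.a .LV) (h'.a .LC) (h'.a .PAR) ∧
      RowMask E i (h'.a .MASK) ∧ HeavyMasks E E.g.m (h'.a .MASK) ∧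
      h'.time ≤ h.time + 18 * E.g.s + 3 * E.g.nb + 18 := by
  have hX2 := sq_le_of_cube hX
  have hX1 : 16 * E.g.M + 64 ≤ X := by unfold Pm.St at hX2; nlinarith
  have hM := K.a_lt hi
  have hcl := E.cls_le K.good hM
  have hs : 1 ≤ E.g.s := Env.s_pos
  have hkk := K.good.kk_lt
  unfold Pm.kk Pm.St at hkk
  have ecls : (E.a i + E.g.s - 1) / E.g.s = E.cls (E.a i) := rfl
  have hrk : E.rk i = E.a i := rfl
  have hsX : E.g.s ≤ E.g.M + 1 := Nat.succ_le_succ (Nat.div_le_self _ _)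
  simp only [headC, Tr_seq, Tr_ite, Tr_asg]
  simp [e1, P.eRK, P.eH, hrk, P.ppar.es, ecls]
  refine ⟨by omega, by omega, by omega, by omega, fun h1 => ⟨by omega, rfl, ?_, HL.heavy K hi h1,
    HM.rowMask K.good.nb_lt.le hM h1, HM, by omega⟩, fun h1 => ⟨by omega, ?_⟩⟩
  · rw [Env.grp, if_pos (show E.Heavy (E.a i) from h1)]
  · have F : Fr ((.x ≔ 0) ;; (.c ≔ 0) ;; (.bs ≔ 0) ;; (.g ≔ 0)) h ((((h.set .x (E.a i)).set .c (E.cls (E.a i))).set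
      .bs (2 * E.cls (E.a i))).tick.set .g (2 * E.cls (E.a i))) :=
      ⟨fun x hx => by simp [Cm.wv] at hx; simp [hx], fun _ _ => rfl, fun _ => rfl⟩
    refine (lightC_spec (h := ((((h.set .x (E.a i)).set .c (E.cls (E.a i))).set
      .bs (2 * E.cls (E.a i))).tick.set .g (2 * E.cls (E.a i)))) K hX hi h1 (P.fr F) D ?_ ?_ ?_ ?_
      HL HM).mono ?_
    · simpa using e1
    · simp
    · simp
    · simp
    · rintro h' F' ⟨b1, b2, b3, t⟩
      have e5 : h'.v .bs = 2 * E.cls (E.a i) := by rw [F'.v _ rfl]; simp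
      have e6 : h'.v .g = 2 * E.cls (E.a i) := by rw [F'.v _ rfl]; simp
      refine ⟨e5, ?_, b1, b2, b3, ?_⟩
      · rw [e6, Env.grp, if_neg (show ¬ E.Heavy (E.a i) from h1), add_zero]
      · simp at t
        omega

end

/-! ### Rows -/

theorem index_lt {a b x y : ℕ} (hx : x < a) (hy : y < b) : x * b + y < a * b := by
  have : (x + 1) * b ≤ a * b := Nat.mul_le_mul hx le_rfl
  nlinarith

theorem index_div {b x y : ℕ} (hy : y < b) : (x * b + y) / b = x := by
  rw [mul_comm, Nat.mul_add_div (by omega), Nat.div_eq_of_lt hy, add_zero]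

theorem index_mod {b x y : ℕ} (hy : y < b) : (x * b + y) % b = y := by
  rw [mul_comm, Nat.mul_add_mod, Nat.mod_eq_of_lt hy]

theorem RunTab.get {g : Pm} {T2 T3 : ℕ → ℕ} (H : RunTab g T2 T3) {x mk e : ℕ} (hx : x < g.C)
    (hm : mk < 2 ^ g.b) (he : e < 2) :
    T2 ((x * 2 ^ g.b + mk) * 2 + e) = enc g.b g.b (runD g.b x mk e) ∧
      T3 ((x * 2 ^ g.b + mk) * 2 + e) = runMax g.b x mk e g.b := by
  have := H ((x * 2 ^ g.b + mk) * 2 + e) (index_lt (index_lt hx hm) he)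
  rwa [index_div he, index_mod he, index_div hm, index_mod hm] at this

theorem MaxTab.get {g : Pm} {T : ℕ → ℕ} (H : MaxTab g T) {x y d : ℕ} (hx : x < g.C)
    (hy : y < g.C) (hd : d < 2 * g.b) :
    T ((x * g.C + y) * (2 * g.b) + d) = enc g.b g.b (maxD g.b x y d) := by
  have := H ((x * g.C + y) * (2 * g.b) + d) (index_lt (index_lt hx hy) hd)
  rwa [index_div hd, index_mod hd, index_div hy, index_mod hy] at this

/-- The function by which row `i` updates the stored functions. -/
noncomputable def Env.U (E : Env) (i p : ℕ) : ℕ :=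
  max (E.G (E.bas i) i p) (hmax (E.G (E.bas i) i) (E.Mark i) p)

def runPre : Cm :=
  .o ≔ (Var.i * Var.St + Var.bs) * Var.St + Var.w ;; .ab ≔ Arr.ABS Var.o ;; .cd ≔ Arr.CODE Var.o ;;
  .mk ≔ Arr.MASK (Var.g * Var.St + Var.w) ;;
  .ite (.lt Var.ab Var.h) (.e ≔ 1) (.e ≔ 0) ;;
  .o ≔ (Var.cd * Var.P2 + Var.mk) * 2 + Var.e

def runPost : Cm :=
  .sto .UA Var.w (Var.ab + Var.e) ;; .sto .UX Var.w (Arr.T2 Var.o) ;; .h ≔ Var.ab + Arr.T3 Var.o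

def runC : Cm := .h ≔ 0 ;; .loop .w .nb (runPre ;; runPost)

theorem Pm.mul_b_le {g : Pm} {β : ℕ} (h : β < g.nb) : β * g.b ≤ g.m := by
  have h1 : β ≤ g.m / g.b := Nat.lt_succ_iff.1 h
  exact (Nat.mul_le_mul h1 le_rfl).trans (Nat.div_mul_le_self _ _)

section

variable {X : ℕ} {h : St} {E : Env} {cnt lst : ℕ → ℕ} {i : ℕ} {LV LC PAR MASK : ℕ → ℕ}

theorem runC_spec (K : E.OK) (hX : E.g.St ^ 3 ≤ X) (hi : i < E.g.n)
    (P : Fix E cnt lst h) (D : Cells E i (h.a .ABS) (h.a .CODE)) (e1 : h.v .i = i)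
    (e2 : h.v .bs = E.bas i) (e3 : h.v .g = E.grp (E.a i)) (HM : RowMask E i (h.a .MASK)) :
    Tr X runC h fun h' => (∀ β < E.g.nb, Cell E.g (E.U i) β (h'.a .UA β) (h'.a .UX β)) ∧
      h'.time ≤ h.time + 13 * E.g.nb + 3 := by
  have hX2 := sq_le_of_cube hX
  have hX1 : 16 * E.g.M + 64 ≤ X := by unfold Pm.St at hX2; nlinarith
  have hM := K.a_lt hi
  have hcl := E.cls_le K.good hM
  have hkk := K.good.kk_lt
  have hnb := K.good.nb_lt
  have hb1 := K.good.b_pos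
  have hC := K.good.C_le
  have hbC := K.good.b_le_C
  have h2b := K.good.two_pow_le
  have hsz := K.good.sz2_le
  have hn : E.g.n < E.g.St := by unfold Pm.St Pm.M; omega
  have hm : E.g.m ≤ E.g.M := by unfold Pm.M; omega
  have hSX : E.g.St ≤ X := by nlinarith
  have hbas : E.bas i < E.g.kk := by unfold Env.bas Pm.kk; omega
  rw [runC, Tr_seq, Tr_asg]
  refine ⟨trivial, by simp, ?_⟩
  -- The variable h carries the running maximum into block j, exact only up to values that the base
  -- function reaches anyway; `Cell.run` needs no more.
  refine Tr_loop (fun j h1 => (∀ β < j, Cell E.g (E.U i) β (h1.a .UA β) (h1.a .UX β)) ∧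
    hmax (E.G (E.bas i) i) (E.Mark i) (j * E.g.b) ≤ h1.v .h ∧
    h1.v .h ≤ max (hmax (E.G (E.bas i) i) (E.Mark i) (j * E.g.b)) (E.G (E.bas i) i (j * E.g.b)))
    12 E.g.nb (by simpa using P.ppar.enb) (by omega) (by decide) rfl rfl ?_ ?_ ?_
  · refine ⟨by simp, ?_, ?_⟩ <;> simp [hmax]
  · rintro j h1 hj F hw ⟨I1, I2, I3⟩
    have F' : Fr runC h h1 := by
      refine Fr.trans (h1 := h.set .h 0) ⟨fun y hy => ?_, fun _ _ => rfl, fun _ => rfl⟩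
        (F.sub ?_ ?_ ?_)
      · simp [runC, Cm.wv] at hy
        simp [hy]
      · simp +contextual [runC, Cm.wv]
      · simp +contextual [runC, Cm.wa]
      · simp +contextual [runC, Cm.wr]
    have P1 := (P.fr F').tick
    have D1 := D i le_rfl _ hbas j hj
    have eA : h1.a .ABS = h.a .ABS := F'.a _ rfl
    have eC : h1.a .CODE = h.a .CODE := F'.a _ rfl
    have eM : h1.a .MASK = h.a .MASK := F'.a _ rfl
    have ei : h1.v .i = i := by rw [F'.v _ rfl, e1]
    have ebs : h1.v .bs = E.bas i := by rw [F'.v _ rfl, e2]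
    have eg : h1.v .g = E.grp (E.a i) := by rw [F'.v _ rfl, e3]
    have hcube := cube_le hX (show i < E.g.St by omega) (show E.bas i < E.g.St by omega)
      (show j < E.g.St by omega)
    have hmk := HM j hj
    have hmkl := mask_lt E.g.b (E.Mark i) j
    obtain ⟨ab, hab⟩ : ∃ ab, ab = h.a .ABS ((i * E.g.St + E.bas i) * E.g.St + j) := ⟨_, rfl⟩
    obtain ⟨cd, hcd⟩ : ∃ cd, cd = h.a .CODE ((i * E.g.St + E.bas i) * E.g.St + j) := ⟨_, rfl⟩
    rw [← hab, ← hcd] at D1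
    obtain ⟨mk, hmk'⟩ : ∃ mk, mk = mask E.g.b (E.Mark i) j := ⟨_, rfl⟩
    rw [← hmk'] at hmk hmkl
    obtain ⟨e, he⟩ : ∃ e, e = if ab < h1.v .h then 1 else 0 := ⟨_, rfl⟩
    have he2 : e < 2 := by rw [he]; split_ifs <;> omega
    have habm : ab ≤ E.g.m := by
      rw [D1.fst]
      exact (K.G_le _ _ _).trans (Pm.mul_b_le hj)
    have hoX := index_lt (index_lt D1.lt hmkl) he2
    obtain ⟨g1, g2⟩ := P1.run.get D1.lt hmkl he2
    obtain ⟨r1, r2, r3⟩ := D1.run K.good (E.Mark i) (Env.G_mono_p _ _)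
      (fun p t => K.G_add_le _ _ _ _) I2 I3 he
    rw [← hmk'] at r1 r2 r3
    rw [Tr_seq]
    have first : Tr X runPre h1.tick fun h2 => h2.v .ab = ab ∧ h2.v .e = e ∧
        h2.v .o = (cd * 2 ^ E.g.b + mk) * 2 + e ∧ h2.time ≤ h1.time + 8 := by
      have eS := P1.ppar.eSt
      have eP := P1.ppar.eP2
      simp only [St.tick_v] at eS eP
      have hcdX := D1.lt
      simp only [runPre, Tr_seq, Tr_asg, Tr_ite]
      simp [eA, eC, eM, ei, ebs, eg, hw, eS, eP, ← hab, ← hcd, hmk]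
      refine ⟨by omega, by omega, by omega, by omega, fun h3 => ?_, fun h3 => ?_⟩
      · rw [if_pos h3] at he
        rw [he] at hoX ⊢
        exact ⟨by omega, by omega, rfl⟩
      · rw [if_neg (by omega)] at he
        rw [he] at hoX ⊢
        exact ⟨by omega, rfl, by omega⟩
    refine first.mono ?_
    rintro h2 F2 ⟨a1, a2, a3, t2⟩
    have ew : h2.v .w = j := by
      rw [F2.v _ rfl]
      exact hw
    have eT2 : h2.a .T2 = h1.a .T2 := F2.a _ rfl
    have eT3 : h2.a .T3 = h1.a .T3 := F2.a _ rfl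
    have eUA : h2.a .UA = h1.a .UA := F2.a _ rfl
    have eUX : h2.a .UX = h1.a .UX := F2.a _ rfl
    simp only [St.tick_a] at g1 g2
    have hrm := runMax_le hb1 cd mk (show e ≤ 1 by omega) E.g.b
    have hr1 := r1.lt
    simp only [runPost, Tr_seq, Tr_sto, Tr_asg]
    simp [a1, a2, a3, ew, eT2, eT3, eUA, eUX, g1, g2]
    refine ⟨by omega, by omega, by omega, ⟨fun β hβ => ?_, r2, ?_⟩, by omega⟩
    · rw [Function.update_apply, Function.update_apply]
      split_ifs with h3
      · rw [h3]
        exact r1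
      · exact I1 β (by omega)
    · simpa using r3
  · rintro h2 F ⟨I1, _, _⟩ ht
    refine ⟨I1, ?_⟩
    simp at ht ⊢
    omega

/-- The blocks of the next row that are already computed. -/
def PartCells (E : Env) (i k w : ℕ) (ABS CODE : ℕ → ℕ) : Prop :=
  Cells E i ABS CODE ∧ ∀ k' < E.g.kk, ∀ β < E.g.nb, (k' < k ∨ k' = k ∧ β < w) →
    Cell E.g (E.G k' (i + 1)) β (ABS (((i + 1) * E.g.St + k') * E.g.St + β))
      (CODE (((i + 1) * E.g.St + k') * E.g.St + β))

theorem PartCells.push (K : E.OK) {k w : ℕ} {ABS CODE : ℕ → ℕ} (H : PartCells E i k w ABS CODE)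
    (hk : k < E.g.kk) (hw : w < E.g.nb) {A c : ℕ} (hc : Cell E.g (E.G k (i + 1)) w A c) :
    PartCells E i k (w + 1) (Function.update ABS (((i + 1) * E.g.St + k) * E.g.St + w) A)
      (Function.update CODE (((i + 1) * E.g.St + k) * E.g.St + w) c) := by
  have hkk := K.good.kk_lt
  have hnb := K.good.nb_lt
  refine ⟨fun i' hi' k' hk' β hβ => ?_, fun k' hk' β hβ h => ?_⟩
  · have : (i' * E.g.St + k') * E.g.St + β ≠ ((i + 1) * E.g.St + k) * E.g.St + w := by
      intro e
      have := (pair_inj (by omega) (by omega) (pair_inj (by omega) (by omega) e).1).1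
      omega
    rw [Function.update_of_ne this, Function.update_of_ne this]
    exact H.1 i' hi' k' hk' β hβ
  · by_cases he : k' = k ∧ β = w
    · obtain ⟨rfl, rfl⟩ := he
      rwa [Function.update_self, Function.update_self]
    · have : ((i + 1) * E.g.St + k') * E.g.St + β ≠ ((i + 1) * E.g.St + k) * E.g.St + w := by
        intro e
        have h1 := pair_inj (by omega) (by omega) e
        have h2 := pair_inj (by omega) (by omega) h1.1
        omega
      rw [Function.update_of_ne this, Function.update_of_ne this]
      exact H.2 k' hk' β hβ (by omega)

/-! ### Maximum of the row update with every stored function -/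

def copyC : Cm := .sto .ABS Var.o Var.ab ;; .sto .CODE Var.o Var.cd

def takeC : Cm := .sto .ABS Var.o Var.ua ;; .sto .CODE Var.o Var.ux

def joinC : Cm :=
  .ite (.le Var.ab Var.ua) (.sto .ABS Var.o Var.ua) (.sto .ABS Var.o Var.ab) ;;
  .sto .CODE Var.o (Arr.T1 ((Var.cd * Var.Cc + Var.ux) * Var.B2 + (Var.ab + Var.b - Var.ua)))

def mergePre : Cm :=
  .o ≔ (Var.i * Var.St + Var.k) * Var.St + Var.w ;; .ab ≔ Arr.ABS Var.o ;; .cd ≔ Arr.CODE Var.o ;;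
  .o ≔ ((Var.i + 1) * Var.St + Var.k) * Var.St + Var.w ;; .ua ≔ Arr.UA Var.w ;; .ux ≔ Arr.UX Var.w

def mergePost : Cm :=
  .ite (.lt Var.k Var.g) copyC (.ite (.le (Var.ua + Var.b) Var.ab) copyC
    (.ite (.le (Var.ab + Var.b) Var.ua) takeC joinC))

def mergeC : Cm := .loop .k .kk (.loop .w .nb (mergePre ;; mergePost))

theorem merge_spec (K : E.OK) (hX : E.g.St ^ 3 ≤ X) (hi : i < E.g.n)
    (P : Fix E cnt lst h) (e1 : h.v .i = i) (e3 : h.v .g = E.grp (E.a i)) {k w : ℕ}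
    (ek : h.v .k = k) (hk : k < E.g.kk) (ew : h.v .w = w) (hw : w < E.g.nb)
    (U : Cell E.g (E.U i) w (h.a .UA w) (h.a .UX w))
    (D : PartCells E i k w (h.a .ABS) (h.a .CODE)) :
    Tr X (mergePre ;; mergePost) h fun h' => PartCells E i k (w + 1) (h'.a .ABS) (h'.a .CODE) ∧
      h'.time ≤ h.time + 12 := by
  have hX2 := sq_le_of_cube hX
  have hX1 : 16 * E.g.M + 64 ≤ X := by unfold Pm.St at hX2; nlinarith
  have hM := K.a_lt hi
  have hkk := K.good.kk_lt
  have hnb := K.good.nb_lt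
  have hb1 := K.good.b_pos
  have hC := K.good.C_le
  have hbC := K.good.b_le_C
  have hn : E.g.n < E.g.St := by unfold Pm.St Pm.M; omega
  have hm : E.g.m ≤ E.g.M := by unfold Pm.M; omega
  have c1 := cube_le hX (show i < E.g.St by omega) (show k < E.g.St by omega)
    (show w < E.g.St by omega)
  have c2 := cube_le hX (show i + 1 < E.g.St by unfold Pm.St Pm.M; omega) (show k < E.g.St by omega)
    (show w < E.g.St by omega)
  have D1 := D.1 i le_rfl k hk w hw
  have push := fun A c => PartCells.push (A := A) (c := c) K D hk hw
  obtain ⟨ab, hab⟩ : ∃ ab, ab = h.a .ABS ((i * E.g.St + k) * E.g.St + w) := ⟨_, rfl⟩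
  obtain ⟨cd, hcd⟩ : ∃ cd, cd = h.a .CODE ((i * E.g.St + k) * E.g.St + w) := ⟨_, rfl⟩
  obtain ⟨ua, hua⟩ : ∃ ua, ua = h.a .UA w := ⟨_, rfl⟩
  obtain ⟨ux, hux⟩ : ∃ ux, ux = h.a .UX w := ⟨_, rfl⟩
  rw [← hab, ← hcd] at D1
  rw [← hua, ← hux] at U
  have hwb := Pm.mul_b_le hw
  have l1 : ab ≤ E.g.m := by
    rw [D1.fst]
    exact (K.G_le _ _ _).trans hwb
  have l2 : ua ≤ E.g.m + 1 := by
    have h1 := K.G_le (E.bas i) i (w * E.g.b)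
    have h2 := Env.OK.hmax_le (E := E) i (w * E.g.b)
    rw [U.fst, Env.U]
    omega
  have l3 := D1.lt
  have l4 := U.lt
  have first : Tr X mergePre h fun h2 => h2.v .o = ((i + 1) * E.g.St + k) * E.g.St + w ∧
      h2.v .ab = ab ∧ h2.v .cd = cd ∧ h2.v .ua = ua ∧ h2.v .ux = ux ∧ h2.time ≤ h.time + 6 := by
    simp only [mergePre, Tr_seq, Tr_asg]
    simp [e1, ek, ew, P.ppar.eSt, ← hab, ← hcd, ← hua, ← hux]
    omega
  rw [Tr_seq]
  refine first.mono ?_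
  rintro h2 F2 ⟨a1, a2, a3, a4, a5, t2⟩
  have P2 := P.fr F2
  have ek2 : h2.v .k = k := by rw [F2.v _ rfl, ek]
  have eg2 : h2.v .g = E.grp (E.a i) := by rw [F2.v _ rfl, e3]
  have eA : h2.a .ABS = h.a .ABS := F2.a _ rfl
  have eC : h2.a .CODE = h.a .CODE := F2.a _ rfl
  simp only [mergePost, copyC, takeC, joinC, Tr_ite, Tr_seq, Tr_sto]
  simp [a1, a2, a3, a4, a5, ek2, eg2, P2.ppar.eC, P2.ppar.eB2, P2.ppar.eb, eA, eC]
  -- The cases below: a function of a lower group is copied; if one block starts at least b above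
  -- the other, it is taken; otherwise the starts differ by less than b and the table applies.
  have hG : E.grp (E.a i) ≤ k → ∀ p, E.G k (i + 1) p = max (E.G k i p) (E.U i p) :=
    fun h3 p => K.G_succ hi h3 p
  refine ⟨fun h3 => ⟨by omega, by omega, push _ _ ?_, by omega⟩, fun h3 => ⟨fun h4 => ⟨by omega, by omega,
    push _ _ ?_, by omega⟩, fun h4 => ⟨fun h5 => ⟨by omega, by omega, push _ _ ?_, by omega⟩,
    fun h5 => ?_⟩⟩⟩
  · rw [show E.G k (i + 1) = E.G k i from funext fun p => Env.G_succ_of_lt h3 p]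
    exact D1
  · rw [show E.G k (i + 1) = _ from funext (hG h3)]
    exact D1.merge_left K.good U h4
  · rw [show E.G k (i + 1) = _ from funext (hG h3)]
    exact (U.merge_left K.good D1 h5).merge_comm
  · have hd : ab + E.g.b - ua < 2 * E.g.b := by omega
    have hj := D1.merge K.good U h5
    rw [P2.max.get l3 l4 hd]
    have hjl := hj.lt
    have key := push _ _ (show Cell E.g (E.G k (i + 1)) w _ _ by
      rw [show E.G k (i + 1) = _ from funext (hG h3)]
      exact hj)
    refine ⟨fun h6 => ⟨by omega, by omega, by omega, ?_, by omega⟩, fun h6 => ⟨by omega, by omega, by omega, ?_, by omega⟩⟩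
    · rwa [max_eq_right h6] at key
    · rwa [max_eq_left h6.le] at key

theorem mergeC_spec (K : E.OK) (hX : E.g.St ^ 3 ≤ X) (hi : i < E.g.n)
    (P : Fix E cnt lst h) (D : Cells E i (h.a .ABS) (h.a .CODE)) (e1 : h.v .i = i)
    (e3 : h.v .g = E.grp (E.a i))
    (U : ∀ β < E.g.nb, Cell E.g (E.U i) β (h.a .UA β) (h.a .UX β)) :
    Tr X mergeC h fun h' => Cells E (i + 1) (h'.a .ABS) (h'.a .CODE) ∧
      h'.time ≤ h.time + 18 * (E.g.kk * E.g.nb) + 2 := by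
  have hX2 := sq_le_of_cube hX
  have hSX : E.g.St ≤ X := by nlinarith
  have hkk := K.good.kk_lt
  have hnb := K.good.nb_lt
  have hnb1 : 1 ≤ E.g.nb := Nat.le_add_left 1 _
  refine Tr_loop (fun k h1 => PartCells E i k 0 (h1.a .ABS) (h1.a .CODE)) (14 * E.g.nb + 3) E.g.kk
    P.ppar.ekk (by omega) (by decide) rfl rfl ⟨D, fun _ _ _ _ h => by omega⟩ ?_ ?_
  · intro k h1 hk F ek I
    have P1 := (P.fr F).tick
    refine Tr_loop (fun w h2 => PartCells E i k w (h2.a .ABS) (h2.a .CODE)) 13 E.g.nb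
      P1.ppar.enb (by omega) (by decide) rfl rfl I ?_ ?_
    · intro w h2 hw F2 ew I2
      have P2 := (P1.fr F2).tick
      refine (merge_spec (h := h2.tick) K hX hi P2 ?_ ?_ ?_ hk ew hw ?_ I2).mono ?_
      · rw [St.tick_v, F2.v _ rfl, St.tick_v, F.v _ rfl, e1]
      · rw [St.tick_v, F2.v _ rfl, St.tick_v, F.v _ rfl, e3]
      · rw [St.tick_v, F2.v _ rfl, St.tick_v, ek]
      · rw [St.tick_a, F2.a _ rfl, F2.a _ rfl, St.tick_a, F.a _ rfl, F.a _ rfl]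
        exact U w hw
      · rintro h3 F3 ⟨J, t3⟩
        refine ⟨J, ?_⟩
        simp at t3
        omega
    · intro h2 F2 I2 t2
      refine ⟨⟨I2.1, fun k' hk' β hβ h => I2.2 k' hk' β hβ (by omega)⟩, ?_⟩
      simp at t2 ⊢
      omega
  · intro h1 F I t1
    refine ⟨fun i' hi' k hk β hβ => ?_, ?_⟩
    · rcases (show i' ≤ i ∨ i' = i + 1 by omega) with h2 | rfl
      · exact I.1 i' h2 k hk β hβ
      · exact I.2 k hk β hβ (by omega)
    · simp only [St.tick_time] at t1 ⊢
      have : E.g.kk ≤ E.g.kk * E.g.nb := Nat.le_mul_of_pos_right _ hnb1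
      have e : (14 * E.g.nb + 3 + 1) * E.g.kk = 14 * (E.g.kk * E.g.nb) + 4 * E.g.kk := by ring
      omega

end

/-! ### One row, and all rows -/

def rowC : Cm := headC ;; runC ;; mergeC

def rowsC : Cm := .loop .i .n rowC

section

variable {X : ℕ} {h : St} {E : Env} {cnt lst : ℕ → ℕ} {i : ℕ}

/-- What is computed after `i` rows. -/
structure RowInv (E : Env) (i : ℕ) (h : St) : Prop where
  cells : Cells E i (h.a .ABS) (h.a .CODE)
  lows : Lows E i (h.a .LV) (h.a .LC) (h.a .PAR)
  masks : HeavyMasks E E.g.m (h.a .MASK)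

theorem rowC_spec (K : E.OK) (hX : E.g.St ^ 3 ≤ X) (hi : i < E.g.n)
    (P : Fix E cnt lst h) (e1 : h.v .i = i) (I : RowInv E i h) :
    Tr X rowC h fun h' => RowInv E (i + 1) h' ∧
      h'.time ≤ h.time + 18 * E.g.s + 18 * (E.g.kk * E.g.nb) + 16 * E.g.nb + 23 := by
  rw [rowC, Tr_seq]
  refine (headC_spec K hX hi P I.cells e1 I.lows I.masks).mono ?_
  rintro h1 F1 ⟨a1, a2, a3, a4, a5, t1⟩
  have P1 := P.fr F1
  have D1 : Cells E i (h1.a .ABS) (h1.a .CODE) := by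
    rw [F1.a _ rfl, F1.a _ rfl]
    exact I.cells
  rw [Tr_seq]
  refine (runC_spec K hX hi P1 D1 (by rw [F1.v _ rfl, e1]) a1 a2 a4).mono ?_
  rintro h2 F2 ⟨b1, t2⟩
  have P2 := P1.fr F2
  have D2 : Cells E i (h2.a .ABS) (h2.a .CODE) := by rwa [F2.a _ rfl, F2.a _ rfl]
  refine (mergeC_spec K hX hi P2 D2 (by rw [F2.v _ rfl, F1.v _ rfl, e1]) (by rw [F2.v _ rfl, a2])
    b1).mono ?_
  rintro h3 F3 ⟨c1, t3⟩
  refine ⟨⟨c1, ?_, ?_⟩, by omega⟩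
  · rwa [F3.a _ rfl, F3.a _ rfl, F3.a _ rfl, F2.a _ rfl, F2.a _ rfl, F2.a _ rfl]
  · rwa [F3.a _ rfl, F2.a _ rfl]

/-- Zero memory is the correct content for row 0: all functions vanish, no column has a value, and
parent 0 is the default. -/
theorem rowInv_zero (K : E.OK) (H : HeavyMasks E E.g.m (h.a .MASK))
    (h0 : ∀ r ∈ [Arr.ABS, .CODE, .LV, .PAR], ∀ j, h.a r j = 0) : RowInv E 0 h := by
  refine ⟨fun i hi k hk β hβ => ?_, ⟨fun p hp hl => ?_, by simp, fun i' _ p _ =>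
    h0 _ (by simp) _⟩, H⟩
  · obtain rfl : i = 0 := by omega
    have e : ∀ p, E.G k 0 p = 0 := fun p => dpG_zero
    rw [h0 _ (by simp), h0 _ (by simp)]
    exact ⟨K.good.C_pos, (e _).symm, fun t _ => by rw [e]; simp [dg]⟩
  · rw [h0 _ (by simp)]
    exact ⟨rfl, fun h => by omega⟩

/-- Here s is about M/q and `kk`·`nb` about 2q·m/q², so both parts of a row cost O(M/q) up to
lower-order terms; this balance dictates b = q². -/
theorem rowsC_spec (K : E.OK) (hX : E.g.St ^ 3 ≤ X) (P : Fix E cnt lst h)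
    (H : HeavyMasks E E.g.m (h.a .MASK))
    (h0 : ∀ r ∈ [Arr.ABS, .CODE, .LV, .PAR], ∀ j, h.a r j = 0) :
    Tr X rowsC h fun h' => Cells E E.g.n (h'.a .ABS) (h'.a .CODE) ∧
      (∀ i < E.g.n, ∀ p < E.g.m, E.a i = E.bb p → ParOK E i p (h'.a .PAR (i * E.g.St + p))) ∧
      h'.time ≤ h.time + (18 * E.g.s + 34 * (E.g.kk * E.g.nb) + 25) * E.g.n + 2 := by
  have hX2 := sq_le_of_cube hX
  have hn : E.g.n ≤ X := by
    have h1 : E.g.n ≤ E.g.St := by unfold Pm.St Pm.M; omega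
    have h2 : E.g.St ≤ E.g.St ^ 2 := Nat.le_self_pow (by norm_num) _
    omega
  have hkn : E.g.nb ≤ E.g.kk * E.g.nb := Nat.le_mul_of_pos_left _ (by unfold Pm.kk; omega)
  refine Tr_loop (fun i h1 => RowInv E i h1) (18 * E.g.s + 34 * (E.g.kk * E.g.nb) + 24) E.g.n
    P.ppar.en hn (by decide) rfl rfl (rowInv_zero K H h0) ?_ ?_
  · intro i h1 hi F ei I
    refine (rowC_spec (h := h1.tick) K hX hi (P.fr F).tick ei ⟨I.1, I.2, I.3⟩).mono ?_
    rintro h2 F2 ⟨J, t2⟩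
    refine ⟨⟨J.1, J.2, J.3⟩, ?_⟩
    simp only [St.tick_time] at t2
    omega
  · rintro h2 F2 I t2
    refine ⟨I.1, I.2.par, ?_⟩
    simp only [St.tick_time]
    rw [show 18 * E.g.s + 34 * (E.g.kk * E.g.nb) + 24 + 1 =
      18 * E.g.s + 34 * (E.g.kk * E.g.nb) + 25 by omega] at t2
    omega

end

/-! ### Reconstruction -/

/-- Lists of matches that form a common increasing subsequence. -/
structure Valid (E : Env) (l : List (ℕ × ℕ)) : Prop where
  mem : ∀ x ∈ l, x.1 < E.g.n ∧ x.2 < E.g.m ∧ E.a x.1 = E.bb x.2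
  chain : l.IsChain fun x y => x.1 < y.1 ∧ x.2 < y.2 ∧ E.a x.1 < E.a y.1

/-- The list `l` is already found, and `z` matches have to be put in front of it. -/
structure Back (E : Env) (i p k cc z : ℕ) (l : List (ℕ × ℕ)) : Prop where
  valid : Valid E l
  hi : i ≤ E.g.n
  hp : p ≤ E.g.m
  hk : k < E.g.kk
  head : ∀ x ∈ l.head?, i ≤ x.1 ∧ p ≤ x.2
  st : (cc = 0 ∧ z = E.G k i p ∧ ∀ x ∈ l.head?, ∀ u, E.Upto k (E.bb u) → E.bb u < E.a x.1) ∨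
    ∃ i' < i, ∃ p' < p, E.a i' = E.bb p' ∧ E.e (i' + 1) p' = z ∧ cc = i' * E.g.St + p' + 1 ∧
      ∀ x ∈ l.head?, E.a i' < E.a x.1

/-- The match `(i', p')` can be put in front of `l`. -/
structure Hit (E : Env) (i p z : ℕ) (l : List (ℕ × ℕ)) (i' p' : ℕ) : Prop where
  lti : i' < i
  ltp : p' < p
  eq : E.a i' = E.bb p'
  len : E.e (i' + 1) p' = z
  head : ∀ x ∈ l.head?, E.a i' < E.a x.1

section

variable {E : Env} {i p k cc z : ℕ} {l : List (ℕ × ℕ)}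

/-- A chain found in the function that parent 0 refers to can be continued by the match, since all
its symbols are smaller than a i. -/
theorem Env.OK.upto_pre (K : E.OK) (hi : i < E.g.n) {u : ℕ} (h : E.Upto (E.pre i) (E.bb u)) :
    E.bb u < E.a i := by
  by_contra hc
  have h1 := K.mono_a_bb hi (Env.bb_le h.1) (by omega)
  have h2 := h.2
  unfold Env.pre at h2
  split_ifs at h2 with h
  · rw [Env.grp, if_pos h] at h1
    omega
  · have := K.cls_pos hi h
    rw [Env.grp, if_neg h] at h1
    omega

theorem Env.OK.pre_lt (K : E.OK) (hi : i < E.g.n) : E.pre i < E.g.kk := by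
  have := E.cls_le K.good (K.a_lt hi)
  unfold Env.pre Pm.kk
  split_ifs <;> omega

theorem Back.jump (B : Back E i p k cc z l) (h : cc ≠ 0) :
    Hit E i p z l ((cc - 1) / E.g.St) ((cc - 1) % E.g.St) := by
  rcases B.st with ⟨h0, _⟩ | ⟨i', h1, p', h2, h3, h4, h5, h6⟩
  · exact absurd h0 h
  · have hp := B.hp
    have : p' < E.g.St := by unfold Pm.St Pm.M; omega
    rw [h5, Nat.add_sub_cancel, index_div this, index_mod this]
    exact ⟨h1, h2, h3, h4, h6⟩

theorem Back.pos (B : Back E i p k 0 z l) (hz : 0 < z) : 1 ≤ i ∧ 1 ≤ p ∧ z = E.G k i p := by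
  rcases B.st with ⟨_, h0, _⟩ | ⟨i', h1, p', h2, h3, h4, h5, h6⟩
  · refine ⟨?_, ?_, h0⟩
    · by_contra hc
      obtain rfl : i = 0 := by omega
      have : E.G k 0 p = 0 := dpG_zero
      omega
    · by_contra hc
      obtain rfl : p = 0 := by omega
      have : E.G k i 0 = 0 := rfl
      omega
  · omega

theorem Back.up (B : Back E i p k 0 z l) (hz : 0 < z) (h : E.G k (i - 1) p = z) :
    Back E (i - 1) p k 0 z l := by
  obtain ⟨h1, h2, h3⟩ := B.pos hz
  have hi := B.hi
  rcases B.st with ⟨_, h0, h4⟩ | ⟨i', _, p', _, _, _, h5, _⟩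
  · refine ⟨B.valid, by omega, B.hp, B.hk, fun x hx => ?_, Or.inl ⟨rfl, h.symm, h4⟩⟩
    have := B.head x hx
    omega
  · omega

/-- If the value drops without row i - 1, then a column attaining it must have received its value in
that row, so it carries the symbol a (i - 1). -/
theorem Back.witness (B : Back E i p k 0 z l) (hz : 0 < z) (h : E.G k (i - 1) p ≠ z) :
    ∃ u < p, E.Upto k (E.bb u) ∧ E.e i u = z ∧ E.a (i - 1) = E.bb u := by
  obtain ⟨h1, h2, h3⟩ := B.pos hz
  have h4 : E.G k (i - 1) p ≤ E.G k i p := Env.G_mono le_rfl (by omega) le_rfl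
  by_contra hc
  push Not at hc
  have h5 : E.G k i p ≤ z - 1 := by
    refine pmax_le_iff.2 fun u hu hU => ?_
    have h6 : E.e i u ≤ E.G k i p := le_pmax hu hU
    by_cases h7 : E.a (i - 1) = E.bb u
    · have := hc u hu hU
      have h8 : E.e i u ≠ z := fun e => this e h7
      show E.e i u ≤ _
      omega
    · obtain ⟨j, rfl⟩ : ∃ j, i = j + 1 := ⟨i - 1, by omega⟩
      have h8 : E.e (j + 1) u = E.e j u := dpE_succ_of_ne h7
      have h9 : E.e j u ≤ E.G k j p := le_pmax hu hU
      rw [Nat.add_sub_cancel] at h h4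
      show E.e (j + 1) u ≤ _
      omega
  omega

/-- The last column does not match row i - 1, so it is not the witness and can be dropped without
changing the value. -/
theorem Back.left (B : Back E i p k 0 z l) (hz : 0 < z) (h : E.G k (i - 1) p ≠ z)
    (h' : E.a (i - 1) ≠ E.bb (p - 1)) : Back E i (p - 1) k 0 z l := by
  obtain ⟨h1, h2, h3⟩ := B.pos hz
  obtain ⟨u, h4, h5, h6, h7⟩ := B.witness hz h
  have hp := B.hp
  rcases B.st with ⟨_, h0, h8⟩ | ⟨i', _, p', _, _, _, h5, _⟩
  · refine ⟨B.valid, B.hi, by omega, B.hk, fun x hx => ?_, Or.inl ⟨rfl, ?_, h8⟩⟩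
    · have := B.head x hx
      omega
    · have h9 : u < p - 1 := by
        by_contra hc
        obtain rfl : u = p - 1 := by omega
        exact h' h7
      refine le_antisymm ?_ (h3 ▸ Env.G_mono le_rfl le_rfl (by omega))
      rw [← h6]
      exact le_pmax h9 h5
  · omega

/-- Among the columns matching row i - 1, the value 1 + `below` is monotone in the position, so the
last column is as good as the witness. -/
theorem Back.hit (B : Back E i p k 0 z l) (hz : 0 < z) (h : E.G k (i - 1) p ≠ z)
    (h' : E.a (i - 1) = E.bb (p - 1)) : Hit E i p z l (i - 1) (p - 1) := by
  obtain ⟨h1, h2, h3⟩ := B.pos hz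
  obtain ⟨u, h4, h5, h6, h7⟩ := B.witness hz h
  have hU : E.Upto k (E.bb (p - 1)) := by rwa [← h', h7]
  rcases B.st with ⟨_, h0, h8⟩ | ⟨i', _, p', _, _, _, h5, _⟩
  · refine ⟨by omega, by omega, h', ?_, fun x hx => h' ▸ h8 x hx _ hU⟩
    rw [Nat.sub_add_cancel h1]
    refine le_antisymm ?_ ?_
    · rw [h3]
      exact le_pmax (by omega) hU
    · obtain ⟨j, rfl⟩ : ∃ j, i = j + 1 := ⟨i - 1, by omega⟩
      rw [Nat.add_sub_cancel] at h7 h'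
      have e1 : E.e (j + 1) u = 1 + E.below j u := dpE_succ_of_eq h7
      have e2 : E.e (j + 1) (p - 1) = 1 + E.below j (p - 1) := dpE_succ_of_eq h'
      have e3 : E.below j u ≤ E.below j (p - 1) := dpG_mono le_rfl (by omega) fun _ _ h => h
      omega
  · omega

/-- In front of the match a chain of length `below` = z - 1 remains, and the parent tells whether it
is found in the function `pre` or at a stored match. -/
theorem Hit.back (K : E.OK) {i' p' v : ℕ} (B : Back E i p k cc z l) (H : Hit E i p z l i' p')
    (hv : ParOK E i' p' v) : Back E i' p' (E.pre i') v (z - 1) ((i', p') :: l) := by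
  have h1 := H.lti
  have h2 := H.ltp
  have h3 := B.hi
  have h4 := B.hp
  have e1 : E.e (i' + 1) p' = 1 + E.below i' p' := dpE_succ_of_eq H.eq
  have e2 := H.len
  refine ⟨⟨fun x hx => ?_, ?_⟩, by omega, by omega, K.pre_lt (by omega), fun x hx => ?_, ?_⟩
  · rcases List.mem_cons.1 hx with rfl | hx
    · exact ⟨by omega, by omega, H.eq⟩
    · exact B.valid.mem x hx
  · refine List.isChain_cons.2 ⟨fun y hy => ⟨?_, ?_, H.head y hy⟩, B.valid.chain⟩
    · exact h1.trans_le (B.head y hy).1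
    · exact h2.trans_le (B.head y hy).2
  · simp at hx
    rw [← hx]
    exact ⟨le_rfl, le_rfl⟩
  · rcases hv with ⟨h5, h6⟩ | ⟨i2, h5, p2, h6, h7, h8, h9, h10⟩
    · refine Or.inl ⟨h5, by omega, fun x hx u hu => ?_⟩
      simp at hx
      rw [← hx]
      exact K.upto_pre (by omega) hu
    · refine Or.inr ⟨i2, h5, p2, h6, h7, by omega, h10, fun x hx => ?_⟩
      simp at hx
      rw [← hx]
      exact h8

end

/-! ### Code of the trace-back -/

def jumpC : Cm :=
  .i1 ≔ (Var.cc - 1) / Var.St ;; .p1 ≔ (Var.cc - 1) % Var.St ;; .f ≔ 1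

def decC : Cm :=
  .ite (.eq Var.val Var.z) (.i ≔ Var.i - 1)
    (.ite (.eq (Arr.RK (Var.i - 1)) (Arr.RK (Var.n + Var.p - 1)))
      (.i1 ≔ Var.i - 1 ;; .p1 ≔ Var.p - 1 ;; .f ≔ 1) (.p ≔ Var.p - 1))

def findC : Cm := .ite (.eq Var.cc 0) (.w ≔ Var.i - 1 ;; lookC .w .k .p ;; decC) jumpC

def emitC : Cm :=
  .z ≔ Var.z - 1 ;; .rst (2 * Var.z) Var.i1 ;; .rst (2 * Var.z + 1) Var.p1 ;;
  .i ≔ Var.i1 ;; .p ≔ Var.p1 ;; .x ≔ Arr.RK Var.i ;; .c ≔ (Var.x + Var.s - 1) / Var.s ;;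
  .cc ≔ Arr.PAR (Var.i * Var.St + Var.p) ;;
  .ite (.eq (Arr.H Var.c) Var.x) (.k ≔ 2 * Var.c) (.k ≔ 2 * Var.c - 1)

def traceC : Cm :=
  .whl (.lt 0 Var.z) (.f ≔ 0 ;; findC ;; .ite (.eq Var.f 1) emitC .skip)

def startC : Cm :=
  .i ≔ Var.n ;; .p ≔ Var.m ;; .k ≔ 2 * Var.q + 1 ;; .cc ≔ 0

def backC : Cm :=
  startC ;; lookC .i .k .p ;; .z ≔ Var.val ;; .len ≔ Var.val ;; traceC ;;
  .n ≔ Var.len ;; .m ≔ 0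

section

variable {X : ℕ} {h : St} {E : Env} {cnt lst : ℕ → ℕ} {i p k cc z : ℕ} {l : List (ℕ × ℕ)}

/-- The output cells contain the list `l` from position `z` on. -/
def OutAt (z : ℕ) (l : List (ℕ × ℕ)) (raw : ℕ → ℤ) : Prop :=
  ∀ (j : ℕ) (hj : j < l.length), raw (2 * (z + j)) = l[j].1 ∧ raw (2 * (z + j) + 1) = l[j].2

theorem OutAt.cons {raw : ℕ → ℤ} (H : OutAt z l raw) (hz : 0 < z) (x : ℕ × ℕ) :
    OutAt (z - 1) (x :: l) (Function.update (Function.update raw (2 * (z - 1)) (x.1 : ℤ))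
      (2 * (z - 1) + 1) (x.2 : ℤ)) := by
  intro j hj
  cases j with
  | zero =>
    simp [Function.update_apply]
  | succ j =>
    have h1 := H j (by simpa using hj)
    have e : 2 * (z - 1 + (j + 1)) = 2 * (z + j) := by omega
    rw [e]
    rw [Function.update_of_ne (by omega), Function.update_of_ne (by omega),
      Function.update_of_ne (by omega), Function.update_of_ne (by omega)]
    simpa using h1

theorem findC_spec (K : E.OK) (hX : E.g.St ^ 3 ≤ X) (P : Fix E cnt lst h)
    (D : Cells E E.g.n (h.a .ABS) (h.a .CODE)) (e1 : h.v .i = i) (e2 : h.v .p = p)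
    (e3 : h.v .k = k) (e4 : h.v .cc = cc) (e5 : h.v .z = z) (e6 : h.v .f = 0) (hz : 0 < z)
    (B : Back E i p k cc z l) :
    Tr X findC h fun h' => h'.time ≤ h.time + 10 ∧ (h'.v .f = 1 ∧ h'.v .i = i ∧ h'.v .p = p ∧
        Hit E i p z l (h'.v .i1) (h'.v .p1) ∨
      h'.v .f ≠ 1 ∧ Back E (h'.v .i) (h'.v .p) k cc z l ∧ h'.v .i + h'.v .p < i + p) := by
  have hX2 := sq_le_of_cube hX
  have hX1 : 16 * E.g.M + 64 ≤ X := by unfold Pm.St at hX2; nlinarith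
  have hm : E.g.m ≤ E.g.M := by unfold Pm.M; omega
  have hn : E.g.n ≤ E.g.M := by unfold Pm.M; omega
  have hBi := B.hi
  have hBp := B.hp
  rw [findC, Tr_ite]
  refine ⟨by simp, fun hc => ?_, fun hc => ?_⟩
  · have hc0 : cc = 0 := by simpa [e4] using hc
    subst hc0
    obtain ⟨i1, p1, _⟩ := B.pos hz
    rw [Tr_seq, Tr_asg]
    refine ⟨by simpa [e1] using i1, by simp [e1]; omega, ?_⟩
    rw [Tr_seq]
    have ew : Ex.ev h.tick (Var.i - 1) = i - 1 := by simp [e1]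
    rw [ew]
    have F0 : Fr (.w ≔ 0) h (h.tick.set .w (i - 1)) :=
      ⟨fun x hx => by simp [Cm.wv] at hx; simp [hx], fun _ _ => rfl, fun _ => rfl⟩
    refine (lookC_spec (h := h.tick.set .w (i - 1)) (i := .w) (k := .k) (p := .p) K hX
      (P.fr F0).ppar D le_rfl (by simp; omega) (by simp [e3, B.hk]) (by simp [e2, B.hp])
      (by decide)).mono ?_
    rintro h1 F1 ⟨v1, t1⟩
    have P1 := (P.fr F0).fr F1
    simp [e2, e3] at v1 t1
    have f1 : h1.v .i = i := by rw [F1.v _ rfl, F0.v _ rfl, e1]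
    have f2 : h1.v .p = p := by rw [F1.v _ rfl, F0.v _ rfl, e2]
    have f5 : h1.v .z = z := by rw [F1.v _ rfl, F0.v _ rfl, e5]
    have f6 : h1.v .f = 0 := by rw [F1.v _ rfl, F0.v _ rfl, e6]
    have er1 : E.rk (i - 1) = E.a (i - 1) := rfl
    have er2 : E.rk (E.g.n + p - 1) = E.bb (p - 1) := by
      rw [Env.bb_of_lt (by omega)]
      congr 1
      omega
    simp only [decC, Tr_ite, Tr_asg, Tr_seq]
    simp [f1, f2, f5, f6, v1, P1.eRK, P1.ppar.en, er1, er2]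
    refine ⟨fun h2 => ⟨by omega, by omega, by omega, B.up hz h2, by omega⟩, fun h2 => ⟨by omega,
      fun h3 => ⟨by omega, by omega, by omega, by omega, by omega, by omega, B.hit hz h2 h3⟩,
      fun h3 => ⟨by omega, by omega, by omega, B.left hz h2 h3, by omega⟩⟩⟩
  · have hc0 : cc ≠ 0 := by simpa [e4] using hc
    have J := B.jump hc0
    have j1 := J.lti
    have j2 := J.ltp
    simp only [jumpC, Tr_seq, Tr_asg]
    simp [e4, P.ppar.eSt, e1, e2]
    exact ⟨by omega, by omega, by omega, by omega, by omega, J⟩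

/-- The output is written from the back and overwrites the input cells. This is harmless because
symbols are now read only through their ranks. -/
theorem emitC_spec (K : E.OK) (hX : E.g.St ^ 3 ≤ X) (P : Fix E cnt lst h)
    (hpar : ∀ i < E.g.n, ∀ p < E.g.m, E.a i = E.bb p → ParOK E i p (h.a .PAR (i * E.g.St + p)))
    (e5 : h.v .z = z) (hz : 0 < z) (O : OutAt z l h.raw)
    (B : Back E i p k cc z l) (H : Hit E i p z l (h.v .i1) (h.v .p1)) :
    Tr X emitC h fun h' => h'.time ≤ h.time + 11 ∧ h'.v .z = z - 1 ∧
      Back E (h'.v .i) (h'.v .p) (h'.v .k) (h'.v .cc) (z - 1) ((h.v .i1, h.v .p1) :: l) ∧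
      h'.v .i = h.v .i1 ∧ h'.v .p = h.v .p1 ∧ OutAt (z - 1) ((h.v .i1, h.v .p1) :: l) h'.raw := by
  have hX2 := sq_le_of_cube hX
  have hX1 : 16 * E.g.M + 64 ≤ X := by unfold Pm.St at hX2; nlinarith
  have hm : E.g.m ≤ E.g.M := by unfold Pm.M; omega
  have hn : E.g.n ≤ E.g.M := by unfold Pm.M; omega
  have hSt : E.g.M < E.g.St := by unfold Pm.St; omega
  have hBi := B.hi
  have hBp := B.hp
  obtain ⟨i1, ei1⟩ : ∃ i1, i1 = h.v .i1 := ⟨_, rfl⟩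
  obtain ⟨p1, ep1⟩ : ∃ p1, p1 = h.v .p1 := ⟨_, rfl⟩
  rw [← ei1, ← ep1] at H ⊢
  have h1 := H.lti
  have h2 := H.ltp
  have hM := K.a_lt (show i1 < E.g.n by omega)
  have hcl := E.cls_le K.good hM
  have hq := K.good.q_le_b
  have hbC := K.good.b_le_C
  have hC := K.good.C_le
  have hs : 1 ≤ E.g.s := Env.s_pos
  have hpO := hpar i1 (by omega) p1 (by omega) H.eq
  have hB := H.back K B hpO
  have hOut := O.cons hz (i1, p1)
  have ecls : (E.a i1 + E.g.s - 1) / E.g.s = E.cls (E.a i1) := rfl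
  have hrk : E.rk i1 = E.a i1 := rfl
  have hsM : E.g.s ≤ E.g.M + 1 := Nat.succ_le_succ (Nat.div_le_self _ _)
  have hzX : z ≤ E.g.m + 1 := by
    have := e_le E (i1 + 1) p1
    rw [H.len] at this
    omega
  have hv : h.a .PAR (i1 * E.g.St + p1) ≤ X := by
    rcases hpO with ⟨h5, _⟩ | ⟨i2, h5, p2, h6, _, _, _, h10⟩
    · omega
    · rw [h10]
      nlinarith
  simp only [emitC, Tr_seq, Tr_asg, Tr_rst, Tr_ite]
  simp [e5, ← ei1, ← ep1, P.eRK, P.eH, hrk, P.ppar.es, P.ppar.eSt, ecls]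
  refine ⟨by omega, by omega, by omega, by omega, by omega, by omega, by omega, hv,
    fun h3 => ⟨by omega, ?_, hOut⟩, fun h3 => ⟨?_, by omega, ?_, hOut⟩⟩
  · rwa [Env.pre, if_pos (show E.Heavy (E.a i1) from h3)] at hB
  · have := K.cls_pos (show i1 < E.g.n by omega) h3
    omega
  · rwa [Env.pre, if_neg (show ¬ E.Heavy (E.a i1) from h3)] at hB

/-- Each round moves up, moves left or goes to a match with smaller coordinates, so i + p decreases
and the trace takes O(M) steps. -/
theorem traceC_spec (K : E.OK) (hX : E.g.St ^ 3 ≤ X) (P : Fix E cnt lst h)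
    (D : Cells E E.g.n (h.a .ABS) (h.a .CODE))
    (hpar : ∀ i < E.g.n, ∀ p < E.g.m, E.a i = E.bb p → ParOK E i p (h.a .PAR (i * E.g.St + p)))
    (B : Back E (h.v .i) (h.v .p) (h.v .k) (h.v .cc) (h.v .z) []) :
    Tr X traceC h fun h' => h'.time ≤ h.time + 25 * (h.v .i + h.v .p) + 1 ∧
      ∃ l, Valid E l ∧ l.length = h.v .z ∧ OutAt 0 l h'.raw := by
  refine Tr_whl (fun h1 => ∃ l, h1.v .z + l.length = h.v .z ∧
    Back E (h1.v .i) (h1.v .p) (h1.v .k) (h1.v .cc) (h1.v .z) l ∧ OutAt (h1.v .z) l h1.raw)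
    (fun h1 => h1.v .i + h1.v .p) 25 ⟨[], rfl, B, fun j hj => by simp at hj⟩ ?_ ?_
  · rintro h1 F1 ⟨l, a1, a2, a3⟩
    refine ⟨⟨trivial, trivial⟩, fun hc => ?_⟩
    have hz : 0 < h1.v .z := hc
    rw [Tr_seq, Tr_asg]
    refine ⟨trivial, by simp, ?_⟩
    have F0 : Fr (.f ≔ 0) h1 (h1.tick.set .f 0) :=
      ⟨fun x hx => by simp [Cm.wv] at hx; simp [hx], fun _ _ => rfl, fun _ => rfl⟩
    have P1 := (P.fr F1).fr F0
    have D1 : Cells E E.g.n ((h1.tick.set .f 0).a .ABS) ((h1.tick.set .f 0).a .CODE) := by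
      rwa [F0.a _ rfl, F0.a _ rfl, F1.a _ rfl, F1.a _ rfl]
    rw [Tr_seq]
    refine (findC_spec (h := h1.tick.set .f 0) K hX P1 D1 (by simp) (by simp) (by simp) (by simp)
      (by simp) (by simp) hz a2).mono ?_
    rintro h2 F2 ⟨t2, alt⟩
    have P2 := P1.fr F2
    have ez : h2.v .z = h1.v .z := by rw [F2.v _ rfl, F0.v _ rfl]
    have er : h2.raw = h1.raw := by rw [F2.raw rfl, F0.raw rfl]
    simp at t2
    rw [Tr_ite]
    refine ⟨by simp, fun hf => ?_, fun hf => ?_⟩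
    · rcases alt with ⟨b1, b2, b3, b4⟩ | ⟨b1, b2⟩
      · refine (emitC_spec (h := h2.tick) (z := h1.v .z) K hX P2.tick ?_ ez hz (er ▸ a3) a2 b4).mono ?_
        · rw [St.tick_a, F2.a _ rfl, F0.a _ rfl, F1.a _ rfl]
          exact hpar
        · rintro h3 F3 ⟨t3, c1, c2, c3, c4, c5⟩
          rw [← c1] at c2 c5
          refine ⟨⟨_, ?_, c2, c5⟩, ?_, ?_⟩
          · rw [List.length_cons]
            omega
          · rw [c3, c4]
            have := b4.lti
            have := b4.ltp
            simp only [St.tick_v]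
            omega
          · simp at t3
            omega
      · exact absurd hf (by simpa using b1)
    · rcases alt with ⟨b1, b2, b3, b4⟩ | ⟨b1, b2, b3⟩
      · exact absurd b1 (by simpa using hf)
      · have ek : h2.v .k = h1.v .k := by rw [F2.v _ rfl, F0.v _ rfl]
        have ec : h2.v .cc = h1.v .cc := by rw [F2.v _ rfl, F0.v _ rfl]
        rw [Tr_skip]
        refine ⟨⟨l, ?_, ?_, ?_⟩, b3, ?_⟩
        · simpa [ez] using a1
        · simpa [ez, ek, ec] using b2
        · simpa [ez, er] using a3
        · simp
          omega
  · rintro h2 F2 ⟨l, a1, a2, a3⟩ hc ht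
    have hz : h2.v .z = 0 := by
      have : ¬ 0 < h2.v .z := hc
      omega
    rw [hz] at a1 a3
    exact ⟨by simpa using ht, l, a2.valid, by omega, a3⟩

theorem backC_spec (K : E.OK) (hX : E.g.St ^ 3 ≤ X) (P : Fix E cnt lst h)
    (D : Cells E E.g.n (h.a .ABS) (h.a .CODE))
    (hpar : ∀ i < E.g.n, ∀ p < E.g.m, E.a i = E.bb p → ParOK E i p (h.a .PAR (i * E.g.St + p))) :
    Tr X backC h fun h' => h'.time ≤ h.time + 25 * E.g.M + 12 ∧ h'.v .m = 0 ∧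
      ∃ l, Valid E l ∧ l.length = E.G (2 * E.g.q + 1) E.g.n E.g.m ∧ h'.v .n = l.length ∧
        OutAt 0 l h'.raw := by
  have hX2 := sq_le_of_cube hX
  have hX1 : 16 * E.g.M + 64 ≤ X := by unfold Pm.St at hX2; nlinarith
  have hm : E.g.m ≤ E.g.M := by unfold Pm.M; omega
  have hn : E.g.n ≤ E.g.M := by unfold Pm.M; omega
  have hq := K.good.q_le_b
  have hbC := K.good.b_le_C
  have hC := K.good.C_le
  have hk : 2 * E.g.q + 1 < E.g.kk := by unfold Pm.kk; omega
  rw [backC, Tr_seq]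
  have first : Tr X startC h fun h1 => h1.v .i = E.g.n ∧ h1.v .p = E.g.m ∧
      h1.v .k = 2 * E.g.q + 1 ∧ h1.v .cc = 0 ∧ h1.time ≤ h.time + 4 := by
    simp only [startC, Tr_seq, Tr_asg]
    simp [P.ppar.en, P.ppar.em, P.ppar.eq]
    omega
  refine first.mono ?_
  rintro h1 F1 ⟨a1, a2, a3, a4, t1⟩
  have P1 := P.fr F1
  have D1 : Cells E E.g.n (h1.a .ABS) (h1.a .CODE) := by rwa [F1.a _ rfl, F1.a _ rfl]
  rw [Tr_seq]
  refine (lookC_spec (i := .i) (k := .k) (p := .p) K hX P1.ppar D1 le_rfl a1.le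
    (by rw [a3]; exact hk) a2.le (by decide)).mono ?_
  rintro h2 F2 ⟨v2, t2⟩
  rw [a1, a2, a3] at v2
  have hle := K.G_le (2 * E.g.q + 1) E.g.n E.g.m
  rw [Tr_seq, Tr_asg]
  refine ⟨trivial, by simp [v2]; omega, ?_⟩
  rw [Tr_seq, Tr_asg]
  refine ⟨trivial, by simp [v2]; omega, ?_⟩
  rw [Tr_seq]
  have F3 : Fr ((.z ≔ 0) ;; (.len ≔ 0)) h2 ((h2.set .z (Ex.ev h2 Var.val)).set .len
      (Ex.ev (h2.set .z (Ex.ev h2 Var.val)) Var.val)) :=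
    ⟨fun x hx => by simp [Cm.wv] at hx; simp [hx], fun _ _ => rfl, fun _ => rfl⟩
  have el : ((h2.set .z (Ex.ev h2 Var.val)).set .len
      (Ex.ev (h2.set .z (Ex.ev h2 Var.val)) Var.val)).v .len = E.G (2 * E.g.q + 1) E.g.n E.g.m := by
    simp [v2]
  have ez : ((h2.set .z (Ex.ev h2 Var.val)).set .len
      (Ex.ev (h2.set .z (Ex.ev h2 Var.val)) Var.val)).v .z = E.G (2 * E.g.q + 1) E.g.n E.g.m := by
    simp [v2]
  have et : ((h2.set .z (Ex.ev h2 Var.val)).set .len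
      (Ex.ev (h2.set .z (Ex.ev h2 Var.val)) Var.val)).time = h2.time + 2 := by
    simp
  generalize ((h2.set .z (Ex.ev h2 Var.val)).set .len
      (Ex.ev (h2.set .z (Ex.ev h2 Var.val)) Var.val)) = h3 at *
  have P3 := (P1.fr F2).fr F3
  have ei : h3.v .i = E.g.n := by rw [F3.v _ rfl, F2.v _ rfl, a1]
  have ep : h3.v .p = E.g.m := by rw [F3.v _ rfl, F2.v _ rfl, a2]
  have ek : h3.v .k = 2 * E.g.q + 1 := by rw [F3.v _ rfl, F2.v _ rfl, a3]
  have ec : h3.v .cc = 0 := by rw [F3.v _ rfl, F2.v _ rfl, a4]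
  refine (traceC_spec K hX P3 ?_ ?_ ?_).mono ?_
  · rwa [F3.a _ rfl, F3.a _ rfl, F2.a _ rfl, F2.a _ rfl]
  · rwa [F3.a _ rfl, F2.a _ rfl, F1.a _ rfl]
  · rw [ei, ep, ek, ec, ez]
    -- With the empty list the conditions on the head are void, and z is the value of the last
    -- stored function.
    exact ⟨⟨by simp, by simp⟩, le_rfl, le_rfl, hk, by simp, Or.inl ⟨rfl, rfl, by simp⟩⟩
  · rintro h4 F4 ⟨t4, l, c1, c2, c3⟩
    have e4 : h4.v .len = E.G (2 * E.g.q + 1) E.g.n E.g.m := by rw [F4.v _ rfl, el]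
    rw [ei, ep] at t4
    simp only [Tr_seq, Tr_asg]
    refine ⟨trivial, by simp [e4]; omega, trivial, by simp, ?_, by simp, l, c1, ?_, ?_, c3⟩
    · simp [Pm.M]
      omega
    · rw [c2, ez]
    · simp [e4, c2, ez]

end

/-! ### The program -/

def prepC : Cm := sortC ;; rankC ;; pivC ;; listC ;; maxTabC ;; runTabC

def mainC : Cm := paramC ;; prepC ;; rowsC ;; backC

/-- Bound for the number of steps. -/
theorem Pm.Good.total_le {g : Pm} (G : g.Good) : g.q * (40 * (g.M + 1) +
    (24 * (g.l + 2) + 220) * (g.M + 1) + ((18 * g.s + 34 * (g.kk * g.nb) + 25) * g.n + 2) +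
    (25 * g.M + 12)) ≤ 1000 * (g.M + 1) * (g.M + 1) + 1000 * g.q * ((g.M + 1) * (g.l + 2)) := by
  have hq := G.q1
  have hn : g.n ≤ g.M := by unfold M; omega
  have hm : g.m ≤ g.M := by unfold M; omega
  have hql : g.q ≤ g.l + 1 := by
    rcases G.q2 with h | h
    · omega
    · nlinarith [Nat.mul_le_mul hq hq]
  -- Multiplying the bound by q avoids divisions: both q·s and q·`kk`·`nb` become linear in M up to
  -- powers of q, which q ≤ l + 1 lets the sorting term absorb.
  have h1 : g.q * g.s ≤ g.M + g.q := by
    have := Nat.mul_div_le g.M g.q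
    unfold s
    rw [mul_add]
    omega
  have h2 : g.q * (g.kk * g.nb) ≤ 4 * (g.M + g.q * g.q) := by
    have h3 : g.b * (g.m / g.b) ≤ g.m := Nat.mul_div_le g.m g.b
    have h4 : g.kk ≤ 4 * g.q := by unfold kk; omega
    have h5 : g.q * g.q * g.nb ≤ g.M + g.q * g.q := by
      unfold nb
      rw [mul_add]
      unfold b at h3 ⊢
      omega
    calc g.q * (g.kk * g.nb) ≤ g.q * (4 * g.q * g.nb) :=
          Nat.mul_le_mul le_rfl (Nat.mul_le_mul h4 le_rfl)
      _ = 4 * (g.q * g.q * g.nb) := by ring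
      _ ≤ _ := by omega
  have h3 : g.q * ((18 * g.s + 34 * (g.kk * g.nb) + 25) * g.n) ≤
      (18 * (g.M + g.q) + 136 * (g.M + g.q * g.q) + 25 * g.q) * g.M := by
    calc _ = (18 * (g.q * g.s) + 34 * (g.q * (g.kk * g.nb)) + 25 * g.q) * g.n := by ring
      _ ≤ _ := Nat.mul_le_mul (by omega) hn
  have h4 : g.q * (g.q * g.M) ≤ (g.l + 1) * (g.q * g.M) := Nat.mul_le_mul hql le_rfl
  have e : g.q * (40 * (g.M + 1) +
    (24 * (g.l + 2) + 220) * (g.M + 1) + ((18 * g.s + 34 * (g.kk * g.nb) + 25) * g.n + 2) +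
    (25 * g.M + 12)) = 40 * g.q * (g.M + 1) + (24 * (g.l + 2) + 220) * (g.q * (g.M + 1)) +
      g.q * ((18 * g.s + 34 * (g.kk * g.nb) + 25) * g.n) + 25 * (g.q * g.M) + 14 * g.q := by ring
  rw [e]
  refine (show _ ≤ 40 * g.q * (g.M + 1) + (24 * (g.l + 2) + 220) * (g.q * (g.M + 1)) +
      (18 * (g.M + g.q) + 136 * (g.M + g.q * g.q) + 25 * g.q) * g.M + 25 * (g.q * g.M) + 14 * g.q
      by omega).trans ?_
  nlinarith [Nat.zero_le (g.q * g.M), Nat.zero_le (g.q * g.l), Nat.zero_le (g.q * g.M * g.l),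
    Nat.zero_le (g.M * g.M), Nat.zero_le g.q, Nat.zero_le g.M]

section

variable {X : ℕ} {h : St}

theorem prepC_spec {g : Pm} (G : g.Good) (hX : g.St ^ 2 ≤ X) (P : Par g h)
    (h0 : ∀ r ∈ [Arr.CNT, .MASK], ∀ j, h.a r j = 0) :
    Tr X prepC h fun h' => ∃ E cnt lst S, E.g = g ∧ Ranked h.raw g.M S E.rk ∧ E.OK ∧
      Fix E cnt lst h' ∧ HeavyMasks E g.m (h'.a .MASK) ∧
      h'.time ≤ h.time + (24 * (g.l + 2) + 220) * (g.M + 1) := by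
  rw [prepC, Tr_seq]
  refine (sortC_spec G hX P).mono ?_
  rintro h1 F1 ⟨s1, t1⟩
  have P1 := P.fr F1
  rw [Tr_seq]
  refine (rankC_spec hX P1 (by rwa [F1.raw rfl])).mono ?_
  rintro h2 F2 ⟨s2, t2⟩
  have P2 := P1.fr F2
  have eS : h2.a .S = h1.a .S := F2.a _ rfl
  rw [Tr_seq]
  refine (pivC_spec (key := h1.raw) G hX P2 (by rwa [eS])).mono ?_
  rintro h3 F3 ⟨s3, t3⟩
  have P3 := P2.fr F3
  rw [eS] at s3
  have R : Ranked h.raw g.M (h1.a .S) (h2.a .RK) := by rwa [F1.raw rfl] at s2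
  obtain ⟨E, rfl, hER, hEH⟩ : ∃ E : Env, E.g = g ∧ E.rk = h2.a .RK ∧ E.H = h3.a .H :=
    ⟨⟨g, h2.a .RK, h3.a .H⟩, rfl, rfl, rfl⟩
  rw [← hER] at R s3
  have K : E.OK := .of_ranked G R fun c hc => by rw [hEH, s3 c hc]
  rw [Tr_seq]
  refine (listC_spec K hX P3 ?_ hEH.symm ?_ ?_).mono ?_
  · rw [F3.a _ rfl, hER]
  · rw [F3.a _ rfl, F2.a _ rfl, F1.a _ rfl]
    exact h0 _ (by simp)
  · rw [F3.a _ rfl, F2.a _ rfl, F1.a _ rfl]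
    exact h0 _ (by simp)
  rintro h4 F4 ⟨s4, m4, t4⟩
  have P4 := P3.fr F4
  rw [Tr_seq]
  refine (maxTabC_spec G hX P4).mono ?_
  rintro h5 F5 ⟨s5, t5⟩
  have P5 := P4.fr F5
  refine (runTabC_spec G hX P5).mono ?_
  rintro h6 F6 ⟨s6, t6⟩
  have P6 := P5.fr F6
  refine ⟨E, h4.a .CNT, h4.a .LST, h1.a .S, rfl, R, K, ⟨P6, ?_, ?_, ?_, ?_, s4, ?_, s6⟩, ?_, ?_⟩
  · rw [F6.a _ rfl, F5.a _ rfl, F4.a _ rfl, F3.a _ rfl, hER]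
  · rw [F6.a _ rfl, F5.a _ rfl, F4.a _ rfl, hEH]
  · rw [F6.a _ rfl, F5.a _ rfl]
  · rw [F6.a _ rfl, F5.a _ rfl]
  · rwa [F6.a _ rfl]
  · rwa [F6.a _ rfl, F5.a _ rfl]
  · rw [add_mul]
    omega

theorem mainC_spec (hX : (2 * (h.v .n + h.v .m) + 8) ^ 3 ≤ X)
    (h0 : ∀ r j, h.a r j = 0) :
    Tr X mainC h fun h' => ∃ E S, E.g.n = h.v .n ∧ E.g.m = h.v .m ∧ E.OK ∧
      Ranked h.raw E.g.M S E.rk ∧ h'.v .m = 0 ∧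
      (∃ l, Valid E l ∧ l.length = E.G (2 * E.g.q + 1) E.g.n E.g.m ∧ h'.v .n = l.length ∧
        OutAt 0 l h'.raw) ∧
      E.g.q * h'.time ≤ E.g.q * h.time + 1000 * (E.g.M + 1) * (E.g.M + 1) +
        1000 * E.g.q * ((E.g.M + 1) * (E.g.l + 2)) := by
  rw [mainC, Tr_seq]
  refine (paramC_spec (sq_le_of_cube hX)).mono ?_
  rintro h1 F1 ⟨g, G, gn, gm, P1, t1⟩
  have hX' : g.St ^ 3 ≤ X := by
    unfold Pm.St Pm.M
    rwa [gn, gm]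
  rw [Tr_seq]
  refine (prepC_spec G (sq_le_of_cube hX') P1 ?_).mono ?_
  · intro r hr j
    have : paramC.wa r = false := by fin_cases hr <;> rfl
    rw [F1.a _ this, h0]
  rintro h2 F2 ⟨E, cnt, lst, S, rfl, R, K, P2, M2, t2⟩
  rw [F1.raw rfl] at R
  rw [Tr_seq]
  refine (rowsC_spec K hX' P2 M2 ?_).mono ?_
  · intro r hr j
    have e1 : paramC.wa r = false := by fin_cases hr <;> rfl
    have e2 : prepC.wa r = false := by fin_cases hr <;> rfl
    rw [F2.a _ e2, F1.a _ e1, h0]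
  rintro h3 F3 ⟨D3, p3, t3⟩
  refine (backC_spec K hX' (P2.fr F3) D3 p3).mono ?_
  rintro h4 F4 ⟨t4, m4, l, a1, a2, a3, a4⟩
  refine ⟨E, S, gn, gm, K, R, m4, ⟨l, a1, a2, a3, a4⟩, ?_⟩
  have := G.total_le
  have h5 : h4.time ≤ h.time + (40 * (E.g.M + 1) +
    (24 * (E.g.l + 2) + 220) * (E.g.M + 1) + ((18 * E.g.s + 34 * (E.g.kk * E.g.nb) + 25) * E.g.n + 2) +
    (25 * E.g.M + 12)) := by omega
  have h6 := Nat.mul_le_mul (le_refl E.g.q) h5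
  rw [mul_add] at h6
  omega

end

/-! ### Running time -/

/-- The fourth root of the logarithm of `2 n + 2`. -/
noncomputable def root (n : ℕ) : ℝ := Real.log (2 * n + 2) ^ ((1 : ℝ) / 4)

theorem log_pos_aux (n : ℕ) : 0 < Real.log (2 * n + 2) :=
  Real.log_pos (by have : (0 : ℝ) ≤ n := n.cast_nonneg; linarith)

theorem root_pos (n : ℕ) : 0 < root n := Real.rpow_pos_of_pos (log_pos_aux n) _

theorem root_pow (n : ℕ) : root n ^ 4 = Real.log (2 * n + 2) := by
  rw [root, ← Real.rpow_natCast, ← Real.rpow_mul (log_pos_aux n).le]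
  norm_num

/-- q is tied to log (M + 1), but the bound is in terms of n, and M may be much smaller than 2n.
With N = M + 1 and R = 2n + 2, splitting log R = log N + log (R/N) and using N·log (R/N) ≤ R shows
N·log R ≤ 2(l + 1)R, so a short input compensates for its small q. -/
theorem steps_le {g : Pm} (G : g.Good) {n τ : ℕ} (hn : g.M ≤ 2 * n)
    (h : g.q * τ ≤ 1000 * (g.M + 1) * (g.M + 1) + 1000 * g.q * ((g.M + 1) * (g.l + 2))) :
    (τ : ℝ) ≤ 12000 * ((2 * n + 2) ^ 2 / root n) := by
  obtain ⟨R, hR⟩ : ∃ R : ℝ, R = 2 * n + 2 := ⟨_, rfl⟩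
  obtain ⟨N, hN⟩ : ∃ N : ℝ, N = g.M + 1 := ⟨_, rfl⟩
  obtain ⟨y, hy⟩ : ∃ y : ℝ, y = root n := ⟨_, rfl⟩
  have y0 : 0 < y := hy ▸ root_pos n
  have y4 : y ^ 4 = Real.log R := by rw [hy, hR, root_pow]
  have L0 : 0 < Real.log R := by rw [hR]; exact log_pos_aux n
  have q1 : (1 : ℝ) ≤ g.q := by exact_mod_cast G.q1
  have N1 : 1 ≤ N := by rw [hN]; have : (0 : ℝ) ≤ g.M := Nat.cast_nonneg _; linarith
  have hNR : N ≤ R := by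
    have : (g.M : ℝ) ≤ 2 * n := by exact_mod_cast hn
    rw [hN, hR]
    linarith
  have R1 : 1 ≤ R := N1.trans hNR
  have h1 : (g.q : ℝ) * τ ≤ 1000 * (N * N) + 1000 * g.q * (N * (g.l + 2)) := by
    have : ((g.q * τ : ℕ) : ℝ) ≤ ((1000 * (g.M + 1) * (g.M + 1) +
      1000 * g.q * ((g.M + 1) * (g.l + 2)) : ℕ) : ℝ) := by exact_mod_cast h
    push_cast at this
    rw [hN]
    linarith
  have hl1 : (g.l : ℝ) + 1 ≤ 64 * (g.q : ℝ) ^ 4 := by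
    have h2 := G.q3
    have h3 : (g.q + 1) * (g.q + 1) ≤ 4 * (g.q * g.q) := by have := G.q1; nlinarith
    have h4 := Nat.mul_le_mul h3 h3
    have h5 : g.l + 1 ≤ 64 * g.q ^ 4 := by
      have : 64 * g.q ^ 4 = 4 * (4 * (g.q * g.q) * (4 * (g.q * g.q))) := by ring
      omega
    exact_mod_cast h5
  have hlN : Real.log N ≤ g.l + 1 := by
    have h2 : N ≤ 2 ^ (g.l + 1) := by
      rw [hN]
      exact_mod_cast G.l2.le
    calc Real.log N ≤ Real.log (2 ^ (g.l + 1)) := Real.log_le_log (by linarith) h2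
      _ = (g.l + 1) * Real.log 2 := by rw [Real.log_pow]; push_cast; ring
      _ ≤ (g.l + 1) * 1 := by
        have := Real.log_two_lt_d9
        gcongr
        linarith
      _ = _ := mul_one _
  have hlR : (g.l : ℝ) ≤ 2 * Real.log R := by
    have h2 : (2 : ℝ) ^ g.l ≤ R := by
      refine le_trans ?_ hNR
      rw [hN]
      exact_mod_cast G.l1
    have h3 := Real.log_le_log (by positivity) h2
    rw [Real.log_pow] at h3
    have := Real.log_two_gt_d9
    have : (0 : ℝ) ≤ g.l := Nat.cast_nonneg _
    nlinarith
  have hl0 : (0 : ℝ) ≤ g.l := Nat.cast_nonneg _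
  have hLam : N * Real.log R ≤ 2 * (g.l + 1) * R := by
    have h2 : Real.log R = Real.log N + Real.log (R / N) := by
      rw [Real.log_div (by linarith) (by linarith)]
      ring
    have h3 := Real.log_le_sub_one_of_pos (show 0 < R / N by positivity)
    have h4 : N * Real.log (R / N) ≤ R := by
      calc N * Real.log (R / N) ≤ N * (R / N) := by gcongr; linarith
        _ = R := by field_simp
    rw [h2]
    nlinarith
  -- Compare fourth powers: N³·(N·log R) ≤ R³·128q⁴·R, and 128 ≤ 4⁴.
  have key : N * y ≤ 4 * g.q * R := by
    refine le_of_pow_le_pow_left₀ (n := 4) (by norm_num) (by positivity) ?_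
    calc (N * y) ^ 4 = N ^ 3 * (N * Real.log R) := by rw [mul_pow, y4]; ring
      _ ≤ R ^ 3 * (2 * (64 * (g.q : ℝ) ^ 4) * R) :=
        mul_le_mul (by gcongr) (hLam.trans (by gcongr)) (by positivity) (by positivity)
      _ ≤ (4 * g.q * R) ^ 4 := by
        have : (0 : ℝ) ≤ (g.q : ℝ) ^ 4 * R ^ 4 := by positivity
        nlinarith
  -- This makes the sorting term harmless: (l + 2)·y is at most of order log² R, hence O(R).
  have hlog : (Real.log R + 1) ^ 2 ≤ 4 * R := by
    have h2 : Real.log R = 2 * Real.log (Real.sqrt R) := by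
      rw [Real.log_sqrt (by linarith)]
      ring
    have h3 := Real.log_le_sub_one_of_pos (Real.sqrt_pos.2 (show 0 < R by linarith))
    have h4 : Real.log R + 1 ≤ 2 * Real.sqrt R := by linarith
    calc (Real.log R + 1) ^ 2 ≤ (2 * Real.sqrt R) ^ 2 := by gcongr
      _ = 4 * R := by rw [mul_pow, Real.sq_sqrt (by linarith)]; ring
  have hyl : y ≤ Real.log R + 1 := by
    by_contra hc
    push Not at hc
    have h2 : 1 ≤ y := by linarith
    have h3 : y ≤ y ^ 4 := le_self_pow₀ h2 (by norm_num)
    linarith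
  rw [← hR, ← hy]
  have h5 : (g.l + 2) * y ≤ 8 * R := by
    calc (g.l + 2) * y ≤ (2 * (Real.log R + 1)) * (Real.log R + 1) := by
          gcongr
          linarith
      _ = 2 * (Real.log R + 1) ^ 2 := by ring
      _ ≤ _ := by linarith
  rw [mul_div_assoc', le_div_iff₀ y0]
  have h6 : (g.q : ℝ) * (τ * y) ≤ g.q * (12000 * R ^ 2) := by
    calc (g.q : ℝ) * (τ * y) = (g.q * τ) * y := by ring
      _ ≤ (1000 * (N * N) + 1000 * g.q * (N * (g.l + 2))) * y := by gcongr
      _ = 1000 * N * (N * y) + 1000 * g.q * N * ((g.l + 2) * y) := by ring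
      _ ≤ 1000 * R * (4 * g.q * R) + 1000 * g.q * R * (8 * R) := by gcongr
      _ = _ := by ring
  exact le_of_mul_le_mul_left h6 (by linarith)

/-- The running time. -/
noncomputable def bound (F : ℕ) (n : ℕ) : ℕ := ⌈F * (12000 * ((2 * n + 2) ^ 2 / root n))⌉₊

open Filter Asymptotics

/-- The rounding up costs at most 1, which is absorbed because n²/log^{1/4} n is eventually at least
1. -/
theorem bound_isBigO_aux (F : ℕ) : (fun n : ℕ => (bound F n : ℝ)) =O[atTop]
    fun n : ℕ => (n : ℝ) ^ 2 * Real.log n ^ (-((1 : ℝ) / 4)) := by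
  refine IsBigO.of_bound (F * 192000 + 1) ?_
  have h1 : ∀ᶠ n : ℕ in atTop, 1 ≤ Real.log n :=
    (Real.tendsto_log_atTop.comp tendsto_natCast_atTop_atTop).eventually_ge_atTop 1
  filter_upwards [h1, eventually_ge_atTop 1] with n hl hn
  have n1 : (1 : ℝ) ≤ n := by exact_mod_cast hn
  have e0 : 0 < Real.log n ^ ((1 : ℝ) / 4) := Real.rpow_pos_of_pos (by linarith) _
  have e1 : Real.log n ^ ((1 : ℝ) / 4) ≤ root n :=
    Real.rpow_le_rpow (by linarith) (Real.log_le_log (by linarith) (by linarith)) (by norm_num)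
  have e2 : (1 : ℝ) ≤ (n : ℝ) ^ 2 * Real.log n ^ (-((1 : ℝ) / 4)) := by
    rw [Real.rpow_neg (by linarith), ← div_eq_mul_inv, one_le_div e0]
    calc Real.log n ^ ((1 : ℝ) / 4) ≤ Real.log n ^ (1 : ℝ) :=
          Real.rpow_le_rpow_of_exponent_le hl (by norm_num)
      _ = Real.log n := Real.rpow_one _
      _ ≤ n := (Real.log_le_sub_one_of_pos (by linarith)).trans (by linarith)
      _ ≤ (n : ℝ) ^ 2 := le_self_pow₀ n1 (by norm_num)
  have e3 : ((2 : ℝ) * n + 2) ^ 2 / root n ≤ 16 * ((n : ℝ) ^ 2 * Real.log n ^ (-((1 : ℝ) / 4))) := by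
    calc ((2 : ℝ) * n + 2) ^ 2 / root n ≤ (4 * n) ^ 2 / Real.log n ^ ((1 : ℝ) / 4) := by
          gcongr
          linarith
      _ = _ := by rw [Real.rpow_neg (by linarith), mul_pow, div_eq_mul_inv]; ring
  have e4 : (0 : ℝ) ≤ F * (12000 * ((2 * n + 2) ^ 2 / root n)) := by
    have := root_pos n
    positivity
  have e5 := (Nat.ceil_lt_add_one e4).le
  have F0 : (0 : ℝ) ≤ F := Nat.cast_nonneg _
  rw [Real.norm_of_nonneg (Nat.cast_nonneg _), Real.norm_of_nonneg (by linarith)]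
  refine e5.trans ?_
  have e6 := mul_le_mul_of_nonneg_left e3 (show (0 : ℝ) ≤ F * 12000 by positivity)
  nlinarith

/-- The exponent 1/4 beats 1/6 once log n ≥ 1, and the factor (log log n)² is eventually at least 1.
-/
theorem bound_isBigO (F : ℕ) : (fun n : ℕ => (bound F n : ℝ)) =O[atTop] fun n : ℕ =>
    (n : ℝ) ^ 2 * Real.log (Real.log n) ^ 2 / Real.log n ^ ((1 : ℝ) / 6) := by
  refine (bound_isBigO_aux F).trans (IsBigO.of_bound 1 ?_)
  have h0 : Tendsto (fun n : ℕ => Real.log n) atTop atTop :=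
    Real.tendsto_log_atTop.comp tendsto_natCast_atTop_atTop
  filter_upwards [h0.eventually_ge_atTop 1,
    (Real.tendsto_log_atTop.comp h0).eventually_ge_atTop 1] with n h1 h2
  have h2' : 1 ≤ Real.log (Real.log n) := h2
  have e0 : 0 < Real.log n ^ ((1 : ℝ) / 6) := Real.rpow_pos_of_pos (by linarith) _
  have e1 : Real.log n ^ (-((1 : ℝ) / 4)) ≤ Real.log n ^ (-((1 : ℝ) / 6)) :=
    Real.rpow_le_rpow_of_exponent_le h1 (by norm_num)
  have e2 : 0 ≤ Real.log n ^ (-((1 : ℝ) / 4)) := Real.rpow_nonneg (by linarith) _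
  rw [Real.norm_of_nonneg (by positivity), Real.norm_of_nonneg (by positivity), one_mul,
    div_eq_mul_inv _ (Real.log n ^ ((1 : ℝ) / 6)), ← Real.rpow_neg (by linarith)]
  calc (n : ℝ) ^ 2 * Real.log n ^ (-((1 : ℝ) / 4))
      ≤ (n : ℝ) ^ 2 * Real.log n ^ (-((1 : ℝ) / 6)) := by gcongr
    _ = (n : ℝ) ^ 2 * 1 ^ 2 * Real.log n ^ (-((1 : ℝ) / 6)) := by ring
    _ ≤ _ := by gcongr

theorem bound_isLittleO (F : ℕ) :
    (fun n : ℕ => (bound F n : ℝ)) =o[atTop] fun n : ℕ => (n : ℝ) ^ 2 := by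
  refine (bound_isBigO_aux F).trans_isLittleO ?_
  have h0 : Tendsto (fun n : ℕ => Real.log n) atTop atTop :=
    Real.tendsto_log_atTop.comp tendsto_natCast_atTop_atTop
  have h1 : (fun n : ℕ => Real.log n ^ (-((1 : ℝ) / 4))) =o[atTop] fun _ => (1 : ℝ) :=
    (isLittleO_one_iff ℝ).2 ((tendsto_rpow_neg_atTop (by norm_num)).comp h0)
  simpa using (isBigO_refl (fun n : ℕ => (n : ℝ) ^ 2) atTop).mul_isLittleO h1

/-! ### Correctness -/

/-- The state at the beginning. -/
def start (A B : List ℤ) : St where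
  v x := if x = .n then A.length else if x = .m then B.length else 0
  a _ _ := 0
  raw i := (A ++ B).getD i 0
  time := 0

theorem rep_start (A B : List ℤ) : Rep (inputState A B) (start A B) := by
  refine ⟨fun x => ?_, fun r i => ?_, fun i => ?_⟩
  · have h0 : x.idx = 0 ↔ x = .n := ⟨fun h => Var.idx_inj h, fun h => h ▸ rfl⟩
    have h1 : x.idx = 1 ↔ x = .m := ⟨fun h => Var.idx_inj h, fun h => h ▸ rfl⟩
    simp only [inputState, start, h0, h1]
    split_ifs <;> rfl
  · have : ¬ 0 ≤ addr r i := by unfold addr; omega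
    simp [inputState, start, this]
  · simp [inputState, start]

/-- M ≤ 2n gives 2M + 8 ≤ (n + 2)³, so values are at most (n + 2)^9 and degree D uses the exponent
9D. The extra 8 contributes a factor of at least 2^8 for the constants in `Wide`. -/
theorem wide_of_le {n w D M : ℕ} (hM : M ≤ 2 * n) (h : (n + 2) ^ (9 * D + 8) ≤ 2 ^ w) :
    Wide w ((2 * M + 8) ^ 3) D := by
  have h1 : 2 * M + 8 ≤ (n + 2) ^ 3 := by nlinarith [sq_nonneg n]
  have h2 : ((2 * M + 8) ^ 3) ^ D ≤ (n + 2) ^ (9 * D) := by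
    calc ((2 * M + 8) ^ 3) ^ D ≤ (((n + 2) ^ 3) ^ 3) ^ D :=
          Nat.pow_le_pow_left (Nat.pow_le_pow_left h1 _) _
      _ = _ := by
        rw [← pow_mul, ← pow_mul]
        congr 1
        ring
  have h3 : 2 ^ 8 ≤ (n + 2) ^ 8 := Nat.pow_le_pow_left (by omega) _
  have h4 : 1 ≤ (n + 2) ^ (9 * D) := Nat.pow_pos (by omega)
  have h5 : 2 ^ 8 * (n + 2) ^ (9 * D) ≤ 2 ^ w := by
    calc 2 ^ 8 * (n + 2) ^ (9 * D) ≤ (n + 2) ^ 8 * (n + 2) ^ (9 * D) := Nat.mul_le_mul h3 le_rfl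
      _ = (n + 2) ^ (9 * D + 8) := by ring
      _ ≤ _ := h
  unfold Wide
  omega

/-- Positions of a match as numbers. -/
def toNat {a b : ℕ} (x : Fin a × Fin b) : ℕ × ℕ := (x.1, x.2)

theorem exists_map_toNat {a b : ℕ} (l : List (ℕ × ℕ)) (h : ∀ x ∈ l, x.1 < a ∧ x.2 < b) :
    ∃ L : List (Fin a × Fin b), L.map toNat = l := by
  have : l ∈ Set.range (List.map (toNat (a := a) (b := b))) := by
    rw [Set.range_list_map]
    exact fun x hx => ⟨(⟨x.1, (h x hx).1⟩, ⟨x.2, (h x hx).2⟩), rfl⟩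
  exact this

section

variable {A B : List ℤ} {E : Env} {S : ℕ → ℕ}

/-- Ranks and symbols agree on equality and order by `Ranked.lt_iff`, so chains of ranks are chains
of symbols. -/
theorem valid_map_iff (hn : E.g.n = A.length) (hm : E.g.m = B.length)
    (R : Ranked (start A B).raw E.g.M S E.rk) (L : List (Fin A.length × Fin B.length)) :
    Valid E (L.map toNat) ↔ IsCommonIncreasing A B L := by
  have hA : ∀ i : Fin A.length, (start A B).raw i = A.get i := fun i => by
    simp [start, List.getElem?_append_left i.2]
  have hB : ∀ i : Fin B.length, (start A B).raw (E.g.n + i) = B.get i := fun i => by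
    rw [hn]
    simp [start, List.getElem?_append_right]
  have lA : ∀ i : Fin A.length, (i : ℕ) < E.g.M := fun i => by
    have := i.2
    unfold Pm.M
    omega
  have lB : ∀ i : Fin B.length, E.g.n + (i : ℕ) < E.g.M := fun i => by
    have := i.2
    unfold Pm.M
    omega
  have hbb : ∀ i : Fin B.length, E.bb i = E.rk (E.g.n + i) := fun i =>
    Env.bb_of_lt (by have := i.2; omega)
  have hmatch : ∀ x : Fin A.length × Fin B.length,
      E.a x.1 = E.bb x.2 ↔ IsMatching A B x := by
    intro x
    rw [hbb, IsMatching, ← hA, ← hB]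
    have h1 := R.lt_iff (lA x.1) (lB x.2)
    have h2 := R.lt_iff (lB x.2) (lA x.1)
    unfold Env.a
    omega
  have hlt : ∀ i j : Fin A.length, E.a i < E.a j ↔ A.get i < A.get j := by
    intro i j
    rw [← hA, ← hA]
    exact R.lt_iff (lA i) (lA j)
  constructor
  · rintro ⟨h1, h2⟩
    refine ⟨fun x hx => (hmatch x).1 (h1 _ (List.mem_map_of_mem hx)).2.2, ?_⟩
    rw [List.isChain_map] at h2
    exact h2.imp fun x y h => ⟨h.1, h.2.1, (hlt _ _).1 h.2.2⟩
  · rintro ⟨h1, h2⟩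
    refine ⟨fun x hx => ?_, ?_⟩
    · obtain ⟨y, hy, rfl⟩ := List.mem_map.1 hx
      exact ⟨by rw [hn]; exact y.1.2, by rw [hm]; exact y.2.2, (hmatch y).2 (h1 y hy)⟩
    · rw [List.isChain_map]
      exact h2.imp fun x y h => ⟨h.1, h.2.1, (hlt _ _).2 h.2.2⟩

/-- Every rank lies in a group up to 2q + 1, so the last stored function bounds all chains; the
traced list attains this bound. -/
theorem Valid.length_le (K : E.OK) {l : List (ℕ × ℕ)} (V : Valid E l) :
    l.length ≤ E.G (2 * E.g.q + 1) E.g.n E.g.m := by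
  refine chain_le l (fun x hx => ?_) V.chain
  obtain ⟨h1, h2, h3⟩ := V.mem x hx
  exact ⟨h1, h2, h3, (K.bb_lt h2).le, E.grp_le K.good (K.bb_lt h2)⟩

end

theorem mainC_solves (A B : List ℤ) {n w : ℕ} (hA : A.length ≤ n) (hB : B.length ≤ n)
    (hw : (n + 2) ^ (9 * mainC.deg + 8) ≤ 2 ^ w) :
    ∃ (s : State) (t : ℕ) (L : List (Fin A.length × Fin B.length)),
      Exec w mainC.comp (inputState A B) t s ∧ t ≤ bound mainC.fac n ∧ IsLCIS A B L ∧
        Outputs s L := by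
  have en : (start A B).v .n = A.length := rfl
  have em : (start A B).v .m = B.length := rfl
  obtain ⟨h', H, E, S, gn, gm, K, R, m', ⟨l, V, hl, n', O⟩, ht⟩ :=
    mainC_spec (h := start A B) (X := (2 * (A.length + B.length) + 8) ^ 3) le_rfl fun _ _ => rfl
  rw [en] at gn
  rw [em] at gm
  have hM : E.g.M = A.length + B.length := by unfold Pm.M; omega
  have hX : 2 * (A.length + B.length) + 8 ≤ (2 * (A.length + B.length) + 8) ^ 3 :=
    Nat.le_self_pow (by norm_num) _
  have hbdd : (start A B).Bdd ((2 * (A.length + B.length) + 8) ^ 3) := by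
    refine ⟨fun x => ?_, fun r i => Nat.zero_le _⟩
    simp only [start]
    split_ifs <;> omega
  obtain ⟨s', t, hex, hrep, htime⟩ := H.sim (by omega) hbdd mainC.fac (inputState A B)
    (wide_of_le (by omega) hw) le_rfl (rep_start A B)
  obtain ⟨L, rfl⟩ := exists_map_toNat (a := A.length) (b := B.length) l fun x hx =>
    ⟨gn ▸ (V.mem x hx).1, gm ▸ (V.mem x hx).2.1⟩
  have e0 : (start A B).time = 0 := rfl
  rw [e0, mul_zero, add_zero] at htime
  rw [e0, mul_zero, zero_add] at ht
  rw [List.length_map] at hl n'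
  refine ⟨s', t, L, hex, ?_, ⟨(valid_map_iff gn gm R L).1 V, fun L' hL' => ?_⟩, ?_, fun i hi => ?_⟩
  · have h1 := steps_le K.good (n := n) (by omega) ht
    have h2 : ((t : ℕ) : ℝ) ≤ ((mainC.fac * h'.time : ℕ) : ℝ) := by exact_mod_cast htime
    have h3 : (t : ℝ) ≤ (bound mainC.fac n : ℝ) := by
      refine h2.trans (le_trans ?_ (Nat.le_ceil _))
      push_cast
      exact mul_le_mul_of_nonneg_left h1 (Nat.cast_nonneg _)
    exact_mod_cast h3
  · have := ((valid_map_iff gn gm R L').2 hL').length_le K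
    rw [List.length_map] at this
    omega
  -- The variables `n` and `m` are registers 0 and 1, which finally hold the length and the output
  -- address 0.
  · have := hrep.reg .n
    rw [n'] at this
    exact this
  · have h1 : s'.reg 1 = 0 := by
      have := hrep.reg .m
      rw [m'] at this
      exact this
    obtain ⟨o1, o2⟩ := O i (by simpa using hi)
    have r1 := hrep.raw (2 * (0 + i))
    have r2 := hrep.raw (2 * (0 + i) + 1)
    rw [o1] at r1
    rw [o2] at r2
    push_cast at r1 r2
    rw [h1]
    simp only [zero_add] at r1 r2 ⊢
    rw [r1, r2]
    simp [toNat]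

end LCIS

theorem mainTheorem3 :
    ∃ (P : LCIS.Prog) (k : ℕ) (T : ℕ → ℕ),
      LCIS.SolvesLCISInTime P k T ∧
      Asymptotics.IsBigO Filter.atTop (fun n : ℕ => (T n : ℝ))
        (fun n : ℕ => (n : ℝ) ^ 2 * Real.log (Real.log n) ^ 2 / Real.log n ^ ((1 : ℝ) / 6)) ∧
      Asymptotics.IsLittleO Filter.atTop (fun n : ℕ => (T n : ℝ)) (fun n : ℕ => (n : ℝ) ^ 2) :=
  ⟨LCIS.mainC.comp, 9 * LCIS.mainC.deg + 8, LCIS.bound LCIS.mainC.fac,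
    fun n A B hA hB w hw _ => LCIS.mainC_solves A B hA hB hw,
    LCIS.bound_isBigO _, LCIS.bound_isLittleO _⟩
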